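/- Fix signs $\varepsilon,\delta\in\{1,-1\}$ and $p\in\mathbb R\smallsetminus\{0\}$, and let $q=e^{2\pi i/3}$. Let $V=\mathbb C\times\mathbb R$ with the symmetric bilinear form $\langle(z,t),(z',t')\rangle=\operatorname{Im}(zz')+\varepsilon tt'$ and the linear operator $F(z,t)=(pqz,pt)$. Let $M$ be a nonempty (Hausdorff, $C^\infty$) manifold with a vector space $\mathcal X=V\oplus\mathbb Ru$ of $C^\infty$ vector fields on $M$ such that evaluation $\mathcal X\to T_xM$ is bijective for every $x\in M$, and $[u,v]=Fv$, $[v,v']=0$ for all $v,v'\in V$. (For example, $M=V\times(0,\infty)$, with $v\in V$ acting as the constant field $(v,0)$ and $u(x,t)=(-Fx,t)$, has these properties.) Then $\dim M=4$, and $g(u,u)=\delta$, $g(u,v)=0$, $g(v,v')=\langle v,v'\rangle$ for $v,v'\in V$ defines a $C^\infty$ pseudo-Riemannian metric $g$ on $M$. The curvature conventions are: $R(u,v)w=\nabla_v\nabla_uw-\nabla_u\nabla_vw+\nabla_{[u,v]}w$, with $\nabla$ the Levi-Civita connection of $g$; $\operatorname{Ric}(u,w)=\operatorname{Trace}[v\mapsto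 R(u,v)w]$; bivectors carry the form $\langle v\wedge u,v'\wedge u'\rangle=g(v,v')g(u,u')-g(v,u')g(u,v')$; and the curvature operator $R:\Lambda^2T_xM\to\Lambda^2T_xM$ is given by $\langle R(u\wedge v),w\wedge w'\rangle=g(R(u,v)w,w')$. For an orientation of $T_xM$, the Hodge star is given by $*(e_1\wedge e_2)=\varepsilon_3\varepsilon_4\,e_3\wedge e_4$ for positively oriented orthonormal bases $e_1,\dots,e_4$, with $\varepsilon_a=g(e_a,e_a)=\pm1$. The following hold. 1. $g$ has the sign pattern $(-,+,\varepsilon,\delta)$; thus $g$ is Lorentzian $(-+++)$ if (i) $\delta=\varepsilon=1$, and neutral $(--++)$ if (ii) $\delta=-\varepsilon$. 2. $g$ is Ricci-flat, and it is not locally symmetric (that is, $\nabla R$ does not vanish identically). 3. $(M,g)$ is locally homogeneous: for all $x,y\in M$ some isometry between open subsets of $M$ sends $x$ to $y$. Moreover, there is a Lie group $G$ with a left-invariant metric such that every point of $M$ has a neighbourhood isometric to an open subset of $G$. 4. At every point $x\in M$ the curvature operator is complex-diagonalizable: its complex-linear extension to the complexification of $\Lambda^2T_xM$ is diagonalizable.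 5. Let $\lambda=-\delta p^2\in\mathbb R\smallsetminus\{0\}$, let $x\in M$, and fix either orientation of $T_xM$. In case (i), $*^2=-\mathrm{Id}$, the curvature operator is complex-linear on the three-dimensional complex vector space $\Lambda^2T_xM$ in which $*$ is the multiplication by $i$, and it is diagonalizable there with the eigenvalues $\lambda,\lambda e^{2\pi i/3},\lambda e^{4\pi i/3}$. In case (ii), the space $\Lambda^+$ of self-dual bivectors (the $+1$-eigenspace of $*$) is three-dimensional and invariant under the curvature operator, and the restriction $R^+:\Lambda^+\to\Lambda^+$ is complex-diagonalizable with the complex eigenvalues $\lambda,\lambda e^{2\pi i/3},\lambda e^{4\pi i/3}$. -/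

import Mathlib

open Bundle Module
open scoped Manifold ContDiff TensorProduct

universe u v

noncomputable section

namespace Petrov

/-! ### Pseudo-Riemannian geometry on a manifold modelled on `E` -/

section Geometry

variable {E : Type*} [NormedAddCommGroup E] [NormedSpace ℝ E]
  {M : Type*} [TopologicalSpace M] [ChartedSpace E M]

/-- A (not necessarily continuous) vector field on `M`. -/
abbrev Field (E : Type*) [NormedAddCommGroup E] [NormedSpace ℝ E]
    (M : Type*) [TopologicalSpace M] [ChartedSpace E M] : Type _ :=
  Π x : M, TangentSpace 𝓘(ℝ, E) x

/-- The vector field `U` is of class `C^∞` at `x`. -/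
def SmoothAt [IsManifold 𝓘(ℝ, E) ∞ M] (U : Field E M) (x : M) : Prop :=
  ContMDiffAt 𝓘(ℝ, E) (𝓘(ℝ, E).prod 𝓘(ℝ, E)) ∞
    (fun y ↦ (⟨y, U y⟩ : TangentBundle 𝓘(ℝ, E) M)) x

/-- The vector field `U` is differentiable at `x`. -/
def DiffAt [IsManifold 𝓘(ℝ, E) ∞ M] (U : Field E M) (x : M) : Prop :=
  MDifferentiableAt 𝓘(ℝ, E) (𝓘(ℝ, E).prod 𝓘(ℝ, E))
    (fun y ↦ (⟨y, U y⟩ : TangentBundle 𝓘(ℝ, E) M)) x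

/-- A `C^∞` pseudo-Riemannian metric: a nondegenerate symmetric bilinear form on each tangent
space, such that `g(U, V)` is smooth whenever the vector fields `U`, `V` are. -/
structure Metric (E : Type*) [NormedAddCommGroup E] [NormedSpace ℝ E]
    (M : Type*) [TopologicalSpace M] [ChartedSpace E M] [IsManifold 𝓘(ℝ, E) ∞ M] where
  form : Π x : M, LinearMap.BilinForm ℝ (TangentSpace 𝓘(ℝ, E) x)
  symm : ∀ x u v, form x u v = form x v u
  nondegenerate : ∀ x, (form x).Nondegenerate
  smooth : ∀ (x : M) (U V : Field E M), SmoothAt U x → SmoothAt V x →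
    ContMDiffAt 𝓘(ℝ, E) 𝓘(ℝ, ℝ) ∞ (fun y ↦ form y (U y) (V y)) x

variable [IsManifold 𝓘(ℝ, E) ∞ M]

/-- `g` has the sign pattern `s`: each tangent space has an orthogonal basis `b` with
`g(bᵢ, bᵢ) = sᵢ`. -/
def HasSignPattern (g : Metric E M) (s : Fin 4 → ℝ) : Prop :=
  ∀ x : M, ∃ b : Basis (Fin 4) ℝ (TangentSpace 𝓘(ℝ, E) x),
    ∀ i j, g.form x (b i) (b j) = if i = j then s i else 0

/-- Sign pattern `- + + +`. -/
def IsLorentzian (g : Metric E M) : Prop := HasSignPattern g ![-1, 1, 1, 1]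

/-- Sign pattern `- - + +`. -/
def IsNeutral (g : Metric E M) : Prop := HasSignPattern g ![-1, -1, 1, 1]

/-- Connections in the tangent bundle of `M`; `cov W x (V x)` is `∇_V W` at `x`. -/
abbrev Connection (E : Type*) [NormedAddCommGroup E] [NormedSpace ℝ E]
    (M : Type*) [TopologicalSpace M] [ChartedSpace E M] [IsManifold 𝓘(ℝ, E) ∞ M] : Type _ :=
  CovariantDerivative 𝓘(ℝ, E) E (TangentSpace 𝓘(ℝ, E) : M → Type _)

/-- `cov` is the Levi-Civita connection of `g`: it is torsion-free and makes `g` parallel. -/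
structure IsLeviCivita (g : Metric E M) (cov : Connection E M) : Prop where
  torsionFree : ∀ (x : M) (U V : Field E M), DiffAt U x → DiffAt V x →
    cov V x (U x) - cov U x (V x) = VectorField.mlieBracket 𝓘(ℝ, E) U V x
  metric : ∀ (x : M) (U V : Field E M), DiffAt U x → DiffAt V x →
    ∀ w : TangentSpace 𝓘(ℝ, E) x,
      mvfderiv 𝓘(ℝ, E) (fun y ↦ g.form y (U y) (V y)) x w =
        g.form x (cov U x w) (V x) + g.form x (U x) (cov V x w)

/-- Fields of trilinear maps `(u, v, w) ↦ R(u, v)w` on the tangent spaces. -/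
abbrev CurvatureField (E : Type*) [NormedAddCommGroup E] [NormedSpace ℝ E]
    (M : Type*) [TopologicalSpace M] [ChartedSpace E M] : Type _ :=
  Π x : M, TangentSpace 𝓘(ℝ, E) x →ₗ[ℝ] TangentSpace 𝓘(ℝ, E) x →ₗ[ℝ]
    TangentSpace 𝓘(ℝ, E) x →ₗ[ℝ] TangentSpace 𝓘(ℝ, E) x

/-- `R` is the curvature tensor of `cov`, with the sign convention
`R(U, V)W = ∇_V ∇_U W - ∇_U ∇_V W + ∇_[U, V] W`. -/
def IsCurvatureTensor (cov : Connection E M) (R : CurvatureField E M) : Prop :=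
  ∀ (x : M) (U V W : Field E M), SmoothAt U x → SmoothAt V x → SmoothAt W x →
    R x (U x) (V x) (W x) =
      cov (fun y ↦ cov W y (U y)) x (V x) - cov (fun y ↦ cov W y (V y)) x (U x)
        + cov W x (VectorField.mlieBracket 𝓘(ℝ, E) U V x)

/-- `Ric(u, w)` is the trace of `v ↦ R(u, v)w`. -/
def ricci (R : CurvatureField E M) (x : M) (u w : TangentSpace 𝓘(ℝ, E) x) : ℝ :=
  LinearMap.trace ℝ (TangentSpace 𝓘(ℝ, E) x) ((R x u).flip w)

def IsRicciFlat (R : CurvatureField E M) : Prop :=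
  ∀ (x : M) (u w : TangentSpace 𝓘(ℝ, E) x), ricci R x u w = 0

/-- The value at `x` of `(∇_Z R)(U, V)W`. -/
def covDerivCurvature (cov : Connection E M) (R : CurvatureField E M)
    (Z U V W : Field E M) (x : M) : TangentSpace 𝓘(ℝ, E) x :=
  cov (fun y ↦ R y (U y) (V y) (W y)) x (Z x)
    - R x (cov U x (Z x)) (V x) (W x)
    - R x (U x) (cov V x (Z x)) (W x)
    - R x (U x) (V x) (cov W x (Z x))

/-- Local symmetry: the curvature tensor is parallel. -/
def IsLocallySymmetric (cov : Connection E M) (R : CurvatureField E M) : Prop :=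
  ∀ (x : M) (Z U V W : Field E M), SmoothAt Z x → SmoothAt U x → SmoothAt V x → SmoothAt W x →
    covDerivCurvature cov R Z U V W x = 0

/-- The diffeomorphism `Φ` between open subsets of `M` and `N` is an isometry. -/
def IsLocalIsometry {E' : Type*} [NormedAddCommGroup E'] [NormedSpace ℝ E']
    {N : Type*} [TopologicalSpace N] [ChartedSpace E' N] [IsManifold 𝓘(ℝ, E') ∞ N]
    (g : Metric E M) (h : Metric E' N)
    (Φ : PartialDiffeomorph 𝓘(ℝ, E) 𝓘(ℝ, E') M N ∞) : Prop :=
  ∀ x ∈ Φ.source, ∀ u v : TangentSpace 𝓘(ℝ, E) x,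
    h.form (Φ x) (mfderiv 𝓘(ℝ, E) 𝓘(ℝ, E') Φ x u) (mfderiv 𝓘(ℝ, E) 𝓘(ℝ, E') Φ x v) =
      g.form x u v

/-- Any point can be moved to any other by an isometry between neighbourhoods. -/
def IsLocallyHomogeneous (g : Metric E M) : Prop :=
  ∀ x y : M, ∃ Φ : PartialDiffeomorph 𝓘(ℝ, E) 𝓘(ℝ, E) M M ∞,
    x ∈ Φ.source ∧ Φ x = y ∧ IsLocalIsometry g g Φ

/-- Every point of `M` has a neighbourhood isometric to an open subset of `N`. -/
def IsLocallyIsometricTo {E' : Type*} [NormedAddCommGroup E'] [NormedSpace ℝ E']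
    {N : Type*} [TopologicalSpace N] [ChartedSpace E' N] [IsManifold 𝓘(ℝ, E') ∞ N]
    (g : Metric E M) (h : Metric E' N) : Prop :=
  ∀ x : M, ∃ Φ : PartialDiffeomorph 𝓘(ℝ, E) 𝓘(ℝ, E') M N ∞,
    x ∈ Φ.source ∧ IsLocalIsometry g h Φ

/-- Invariance of a metric on a Lie group under left translations. -/
def IsLeftInvariant {G : Type*} [TopologicalSpace G] [ChartedSpace E G] [Group G]
    [IsManifold 𝓘(ℝ, E) ∞ G] (h : Metric E G) : Prop :=
  ∀ (a b : G) (u v : TangentSpace 𝓘(ℝ, E) b),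
    h.form (a * b) (mfderiv 𝓘(ℝ, E) 𝓘(ℝ, E) (fun c ↦ a * c) b u)
      (mfderiv 𝓘(ℝ, E) 𝓘(ℝ, E) (fun c ↦ a * c) b v) = h.form b u v

end Geometry

/-! ### Bivectors -/

section Bivectors

variable {W : Type*} [AddCommGroup W] [Module ℝ W]

/-- `u ∧ v`. -/
def wedge (u v : W) : ⋀[ℝ]^2 W := exteriorPower.ιMulti ℝ 2 ![u, v]

/-- The bilinear form on bivectors with
`⟨u ∧ v, u' ∧ v'⟩ = B(u, u') B(v, v') - B(u, v') B(v, u')`. -/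
def bivectorForm (B : LinearMap.BilinForm ℝ W) : LinearMap.BilinForm ℝ (⋀[ℝ]^2 W) :=
  exteriorPower.pairingDual ℝ W 2 ∘ₗ exteriorPower.map 2 B

theorem bivectorForm_wedge (B : LinearMap.BilinForm ℝ W) (u v u' v' : W) :
    bivectorForm B (wedge u v) (wedge u' v') = B u u' * B v v' - B u v' * B v u' := by
  simp [bivectorForm, wedge, exteriorPower.map_apply_ιMulti, Matrix.det_fin_two]
  ring

/-- `A` is the operator on bivectors with `⟨A(u ∧ v), w ∧ w'⟩ = B(R(u, v)w, w')`. -/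
def IsCurvatureOperator (B : LinearMap.BilinForm ℝ W) (R : W →ₗ[ℝ] W →ₗ[ℝ] W →ₗ[ℝ] W)
    (A : End ℝ (⋀[ℝ]^2 W)) : Prop :=
  ∀ u v w w' : W, bivectorForm B (A (wedge u v)) (wedge w w') = B (R u v w) w'

/-- `B`-orthonormal bases: `B(eᵢ, eⱼ) = 0` for `i ≠ j` and `B(eᵢ, eᵢ) = ±1`. -/
def IsOrthonormal (B : LinearMap.BilinForm ℝ W) (e : Basis (Fin 4) ℝ W) : Prop :=
  (∀ i j, i ≠ j → B (e i) (e j) = 0) ∧ ∀ i, B (e i) (e i) = 1 ∨ B (e i) (e i) = -1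

/-- `S` is the Hodge star of `B` for the orientation `o`: `S(e₁ ∧ e₂) = ε₃ ε₄ e₃ ∧ e₄`, with
`εᵢ = B(eᵢ, eᵢ)`, for every positively oriented orthonormal basis `e₁, …, e₄`. -/
def IsHodgeStar (B : LinearMap.BilinForm ℝ W) (o : Orientation ℝ W (Fin 4))
    (S : End ℝ (⋀[ℝ]^2 W)) : Prop :=
  ∀ e : Basis (Fin 4) ℝ W, IsOrthonormal B e → e.orientation = o →
    S (wedge (e 0) (e 1)) = (B (e 2) (e 2) * B (e 3) (e 3)) • wedge (e 2) (e 3)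

end Bivectors

/-! ### Diagonalizability -/

section Diagonal

/-- The complex-linear extension of `A` to the complexification is diagonalizable. -/
def IsComplexDiagonalizable {W : Type*} [AddCommGroup W] [Module ℝ W] (A : End ℝ W) : Prop :=
  (⨆ μ : ℂ, End.eigenspace (A.baseChange ℂ : End ℂ (ℂ ⊗[ℝ] W)) μ) = ⊤

/-- `T` is diagonalizable on a three-dimensional complex space, with the eigenvalues
`μ₀, μ₁, μ₂` (counted with multiplicity). -/
def IsDiagonalizableWith {W : Type*} [AddCommGroup W] [Module ℂ W] (T : End ℂ W)
    (μ : Fin 3 → ℂ) : Prop :=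
  ∃ b : Basis (Fin 3) ℂ W, ∀ k, T (b k) = μ k • b k

/-- The complex vector space structure on a real vector space in which multiplication by `i`
is the operator `S`, where `S² = -1`. -/
abbrev complexModule {W : Type*} [AddCommGroup W] [Module ℝ W] (S : End ℝ W)
    (hS : S * S = -1) : Module ℂ W :=
  Module.compHom W (Complex.lift ⟨S, hS⟩ : ℂ →ₐ[ℝ] End ℝ W).toRingHom

/-- `S² = -1`, the operator `A` is complex-linear for the complex structure in which `S` is the
multiplication by `i`, and, as such, it is diagonalizable with the eigenvalues `μ₀, μ₁, μ₂`. -/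
def IsStarDiagonalizableWith {W : Type*} [AddCommGroup W] [Module ℝ W] (S A : End ℝ W)
    (μ : Fin 3 → ℂ) : Prop :=
  ∃ hS : S * S = -1,
    letI : Module ℂ W := complexModule S hS
    ∃ A' : End ℂ W, (∀ w, A' w = A w) ∧ IsDiagonalizableWith A' μ

/-- The `+1`-eigenspace `Λ⁺` of `S` is invariant under `A`, and the restriction of `A` to `Λ⁺`
has a diagonalizable complexification, with the eigenvalues `μ₀, μ₁, μ₂`. -/
def IsSelfDualDiagonalizableWith {W : Type*} [AddCommGroup W] [Module ℝ W] (S A : End ℝ W)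
    (μ : Fin 3 → ℂ) : Prop :=
  ∃ hA : ∀ w ∈ End.eigenspace S 1, A w ∈ End.eigenspace S 1,
    IsDiagonalizableWith ((A.restrict hA).baseChange ℂ) μ

end Diagonal

/-! ### The construction -/

section Construction

variable {V : Type*} [AddCommGroup V] [Module ℝ V]

/-- `X` realizes the Lie algebra `V ⊕ ℝu`, where `u = (0, 1)`, `[u, v] = Fv` and `[v, v'] = 0`
for `v, v' ∈ V`, as a simply transitive Lie algebra of smooth vector fields on `M`. -/
structure IsSimplyTransitive (F : V →ₗ[ℝ] V)
    {E : Type*} [NormedAddCommGroup E] [NormedSpace ℝ E]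
    {M : Type*} [TopologicalSpace M] [ChartedSpace E M] [IsManifold 𝓘(ℝ, E) ∞ M]
    (X : V × ℝ →ₗ[ℝ] Field E M) : Prop where
  smooth : ∀ a x, SmoothAt (X a) x
  bijective : ∀ x, Function.Bijective fun a ↦ X a x
  bracket_u : ∀ v, VectorField.mlieBracket 𝓘(ℝ, E) (X (0, 1)) (X (v, 0)) = X (F v, 0)
  bracket_v : ∀ v v', VectorField.mlieBracket 𝓘(ℝ, E) (X (v, 0)) (X (v', 0)) = 0

/-- The metric `g` is given by `g(u, u) = δ`, `g(u, v) = 0` and `g(v, v') = B(v, v')` for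
`v, v' ∈ V`. -/
def IsPetrovMetric (B : LinearMap.BilinForm ℝ V) (δ : ℝ)
    {E : Type*} [NormedAddCommGroup E] [NormedSpace ℝ E]
    {M : Type*} [TopologicalSpace M] [ChartedSpace E M] [IsManifold 𝓘(ℝ, E) ∞ M]
    (X : V × ℝ →ₗ[ℝ] Field E M) (g : Metric E M) : Prop :=
  ∀ x : M, g.form x (X (0, 1) x) (X (0, 1) x) = δ ∧
    (∀ v, g.form x (X (0, 1) x) (X (v, 0) x) = 0) ∧
    ∀ v v', g.form x (X (v, 0) x) (X (v', 0) x) = B v v'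

/-- The manifold `V × (0, ∞)`. -/
def modelSpace (V : Type*) [NormedAddCommGroup V] [NormedSpace ℝ V] :
    TopologicalSpace.Opens (V × ℝ) :=
  ⟨{y | 0 < y.2}, isOpen_lt continuous_const continuous_snd⟩

/-- The vector fields on `V × (0, ∞)` in which `v ∈ V` is the constant field `(v, 0)`, and
`u` is the field `u(x, t) = (-Fx, t)`. -/
def modelFields {V : Type*} [NormedAddCommGroup V] [NormedSpace ℝ V] (F : V →ₗ[ℝ] V) :
    V × ℝ →ₗ[ℝ] Field (V × ℝ) (modelSpace V) where
  toFun a := fun y ↦ ((a.1 - a.2 • F y.1.1, a.2 * y.1.2) : V × ℝ)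
  map_add' a b := by
    funext y
    refine Prod.ext ?_ ?_
    · change (a.1 + b.1) - (a.2 + b.2) • F y.1.1 = (a.1 - a.2 • F y.1.1) + (b.1 - b.2 • F y.1.1)
      module
    · change (a.2 + b.2) * y.1.2 = a.2 * y.1.2 + b.2 * y.1.2
      ring
  map_smul' c a := by
    funext y
    refine Prod.ext ?_ ?_
    · change c • a.1 - (c * a.2) • F y.1.1 = c • (a.1 - a.2 • F y.1.1)
      module
    · change (c * a.2) * y.1.2 = c * (a.2 * y.1.2)
      ring

/-- `q = e^{2πi/3}`. -/
def q : ℂ := Complex.exp (2 * Real.pi * Complex.I / 3)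

/-- The form `⟨(z, t), (z', t')⟩ = Im (z z') + ε t t'` on `ℂ × ℝ`. -/
def exampleForm (ε : ℝ) : LinearMap.BilinForm ℝ (ℂ × ℝ) :=
  LinearMap.mk₂ ℝ (fun a b ↦ (a.1 * b.1).im + ε * a.2 * b.2)
    (fun a a' b ↦ by simp; ring) (fun c a b ↦ by simp; ring)
    (fun a b b' ↦ by simp; ring) (fun c a b ↦ by simp; ring)

/-- The operator `F(z, t) = (p q z, p t)` on `ℂ × ℝ`. -/
def exampleOperator (p : ℝ) : ℂ × ℝ →ₗ[ℝ] ℂ × ℝ where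
  toFun a := (p * q * a.1, p * a.2)
  map_add' a b := by ext1 <;> simp [mul_add]
  map_smul' c a := by
    ext1
    · simp only [Prod.smul_fst, Complex.real_smul, RingHom.id_apply]; ring
    · simp only [Prod.smul_snd, smul_eq_mul, RingHom.id_apply]; ring

/-- The numbers `λ`, `λ e^{2πi/3}`, `λ e^{4πi/3}`. -/
def cubeRootTriple (l : ℝ) : Fin 3 → ℂ := ![l, l * q, l * q ^ 2]

end Construction

end Petrov

end

noncomputable section

namespace Petrov

section Frame

variable {E : Type*} [NormedAddCommGroup E] [NormedSpace ℝ E]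
  {M : Type*} [TopologicalSpace M] [ChartedSpace E M] [IsManifold 𝓘(ℝ, E) ∞ M]
  {A : Type*} [NormedAddCommGroup A] [NormedSpace ℝ A]

/-- The fields `X a` form a smooth trivialization of the tangent bundle. -/
structure IsFrame (X : A →ₗ[ℝ] Field E M) : Prop where
  smooth : ∀ a x, SmoothAt (X a) x
  bijective : ∀ x, Function.Bijective fun a ↦ X a x

namespace IsFrame

variable {X : A →ₗ[ℝ] Field E M} (hX : IsFrame X)

/-- Evaluation of the frame fields at `x`. -/
def equiv (x : M) : A ≃ₗ[ℝ] TangentSpace 𝓘(ℝ, E) x :=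
  LinearEquiv.ofBijective
    ((LinearMap.proj x : (Π y : M, TangentSpace 𝓘(ℝ, E) y) →ₗ[ℝ] _) ∘ₗ X) (hX.bijective x)

@[simp] theorem equiv_apply (x : M) (a : A) : hX.equiv x a = X a x := rfl

/-- The components of a vector field with respect to the frame. -/
def coef (W : Field E M) (x : M) : A := (hX.equiv x).symm (W x)

@[simp] theorem equiv_coef (W : Field E M) (x : M) : hX.equiv x (hX.coef W x) = W x :=
  (hX.equiv x).apply_symm_apply _

theorem apply_coef (W : Field E M) (x : M) : X (hX.coef W x) x = W x := hX.equiv_coef W x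

@[simp] theorem equiv_symm_apply (a : A) (x : M) : (hX.equiv x).symm (X a x) = a :=
  (hX.equiv x).symm_apply_apply a

theorem coef_add (W W' : Field E M) : hX.coef (W + W') = hX.coef W + hX.coef W' :=
  funext fun x ↦ map_add (hX.equiv x).symm _ _

theorem coef_smul (f : M → ℝ) (W : Field E M) : hX.coef (f • W) = f • hX.coef W :=
  funext fun x ↦ map_smul (hX.equiv x).symm _ _

theorem exists_matrix [FiniteDimensional ℝ A] [FiniteDimensional ℝ E] (x : M) :
    ∃ T : M → A →L[ℝ] E, ContMDiffAt 𝓘(ℝ, E) 𝓘(ℝ, A →L[ℝ] E) ∞ T x ∧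
      ContMDiffAt 𝓘(ℝ, E) 𝓘(ℝ, E →L[ℝ] A) ∞ (fun y ↦ (T y).inverse) x ∧
      ∀ W : Field E M,
        (fun y ↦ (trivializationAt E (TangentSpace 𝓘(ℝ, E) : M → Type _) x ⟨y, W y⟩).2)
            =ᶠ[nhds x] (fun y ↦ T y (hX.coef W y)) ∧
        hX.coef W =ᶠ[nhds x] (fun y ↦ (T y).inverse
          (trivializationAt E (TangentSpace 𝓘(ℝ, E) : M → Type _) x ⟨y, W y⟩).2) := by
  set e := trivializationAt E (TangentSpace 𝓘(ℝ, E) : M → Type _) x with he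
  let b := Module.finBasis ℝ A
  let T : M → A →L[ℝ] E := fun y ↦
    ∑ i, (LinearMap.toContinuousLinearMap (b.coord i)).smulRight (e ⟨y, X (b i) y⟩).2
  have hT : ContMDiffAt 𝓘(ℝ, E) 𝓘(ℝ, A →L[ℝ] E) ∞ T x := by
    refine contMDiffAt_finsetSum fun i _ ↦ ?_
    have h1 := (contMDiffAt_section x).1 (hX.smooth (b i) x)
    exact ((ContinuousLinearMap.smulRightL ℝ A E
      (LinearMap.toContinuousLinearMap (b.coord i))).contMDiff.contMDiffAt (x := _)).comp x h1
  have hTa : ∀ y ∈ e.baseSet, ∀ a, T y a = (e ⟨y, X a y⟩).2 := by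
    intro y hy a
    have h1 : ∀ w : TangentSpace 𝓘(ℝ, E) y, (e ⟨y, w⟩).2 = e.continuousLinearEquivAt ℝ y hy w :=
      fun w ↦ rfl
    simp only [T, _root_.sum_apply, ContinuousLinearMap.smulRight_apply, h1]
    conv_rhs => rw [← b.sum_repr a, ← hX.equiv_apply, map_sum, map_sum]
    refine Finset.sum_congr rfl fun i _ ↦ ?_
    rw [map_smul, map_smul, hX.equiv_apply]
    rfl
  let TE : ∀ y ∈ e.baseSet, A ≃L[ℝ] E := fun y hy ↦
    ((hX.equiv y).trans (e.continuousLinearEquivAt ℝ y hy).toLinearEquiv).toContinuousLinearEquiv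
  have hTE : ∀ y hy, (TE y hy : A →L[ℝ] E) = T y := by
    intro y hy
    ext a
    rw [hTa y hy a]
    rfl
  have hx : x ∈ e.baseSet := FiberBundle.mem_baseSet_trivializationAt' x
  have hnear : ∀ᶠ y in nhds x, y ∈ e.baseSet := e.open_baseSet.mem_nhds hx
  refine ⟨T, hT, ?_, fun W ↦ ⟨?_, ?_⟩⟩
  · have h2 : ContDiffAt ℝ ∞ ContinuousLinearMap.inverse (T x) := by
      rw [← hTE x hx]
      exact contDiffAt_map_inverse _
    exact h2.contMDiffAt.comp x hT
  · filter_upwards [hnear] with y hy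
    rw [hTa y hy, hX.apply_coef]
  · filter_upwards [hnear] with y hy
    have h3 : (e ⟨y, W y⟩).2 = TE y hy (hX.coef W y) := by
      rw [← ContinuousLinearEquiv.coe_coe, hTE, hTa y hy, hX.apply_coef]
    rw [h3, ← hTE y hy, ContinuousLinearMap.inverse_equiv]
    simp

theorem smoothAt_iff [FiniteDimensional ℝ A] [FiniteDimensional ℝ E] {W : Field E M} {x : M} :
    SmoothAt W x ↔ ContMDiffAt 𝓘(ℝ, E) 𝓘(ℝ, A) ∞ (hX.coef W) x := by
  obtain ⟨T, hT, hT', h⟩ := hX.exists_matrix x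
  refine (contMDiffAt_section x).trans ⟨fun hW ↦ ?_, fun hW ↦ ?_⟩
  · exact (hT'.clm_apply hW).congr_of_eventuallyEq (h W).2
  · exact (hT.clm_apply hW).congr_of_eventuallyEq (h W).1

theorem diffAt_iff [FiniteDimensional ℝ A] [FiniteDimensional ℝ E] {W : Field E M} {x : M} :
    DiffAt W x ↔ MDifferentiableAt 𝓘(ℝ, E) 𝓘(ℝ, A) (hX.coef W) x := by
  obtain ⟨T, hT, hT', h⟩ := hX.exists_matrix x
  refine (mdifferentiableAt_section 𝓘(ℝ, E) W).trans ⟨fun hW ↦ ?_, fun hW ↦ ?_⟩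
  · exact ((hT'.mdifferentiableAt (by simp)).clm_apply hW).congr_of_eventuallyEq (h W).2
  · exact ((hT.mdifferentiableAt (by simp)).clm_apply hW).congr_of_eventuallyEq (h W).1

theorem _root_.Petrov.SmoothAt.diffAt {W : Field E M} {x : M} (h : SmoothAt W x) : DiffAt W x :=
  ContMDiffAt.mdifferentiableAt h (by simp)

theorem _root_.Petrov.SmoothAt.eventually_diffAt {W : Field E M} {x : M} (h : SmoothAt W x) :
    ∀ᶠ y in nhds x, DiffAt W y := by
  have h1 : ContMDiffAt 𝓘(ℝ, E) (𝓘(ℝ, E).prod 𝓘(ℝ, E)) 1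
    (fun y ↦ (⟨y, W y⟩ : TangentBundle 𝓘(ℝ, E) M)) x := ContMDiffAt.of_le h (by simp)
  filter_upwards [(contMDiffAt_iff_contMDiffAt_nhds (by simp)).1 h1] with y hy
  exact hy.mdifferentiableAt (by simp)

theorem diffAt_frame (hX : IsFrame X) (a : A) (x : M) : DiffAt (X a) x := (hX.smooth a x).diffAt

/-- The pseudo-Riemannian metric which, in terms of the frame, is the constant form `B`. -/
def metric [FiniteDimensional ℝ A] [FiniteDimensional ℝ E] (B : LinearMap.BilinForm ℝ A)
    (hs : ∀ a b, B a b = B b a) (hB : B.Nondegenerate) : Metric E M where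
  form x := B.compl₁₂ (hX.equiv x).symm.toLinearMap (hX.equiv x).symm.toLinearMap
  symm x u v := by simp [hs]
  nondegenerate x := by
    refine ⟨fun u h ↦ ?_, fun u h ↦ ?_⟩
    · have := hB.1 ((hX.equiv x).symm u) fun a ↦ by simpa using h (hX.equiv x a)
      simpa using this
    · have := hB.2 ((hX.equiv x).symm u) fun a ↦ by simpa using h (hX.equiv x a)
      simpa using this
  smooth x U V hU hV := by
    have hU' := hX.smoothAt_iff.1 hU
    have hV' := hX.smoothAt_iff.1 hV
    let B' : A →L[ℝ] A →L[ℝ] ℝ :=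
      LinearMap.toContinuousLinearMap (LinearMap.toContinuousLinearMap.toLinearMap ∘ₗ B)
    exact (B'.contMDiff.contMDiffAt.comp x hU').clm_apply hV'

theorem metric_apply [FiniteDimensional ℝ A] [FiniteDimensional ℝ E] (B : LinearMap.BilinForm ℝ A)
    (hs : ∀ a b, B a b = B b a) (hB : B.Nondegenerate) (x : M) (a b : A) :
    (hX.metric B hs hB).form x (X a x) (X b x) = B a b := by
  change B ((hX.equiv x).symm (X a x)) ((hX.equiv x).symm (X b x)) = _
  simp

end IsFrame
end Frame

section Calculus

variable {E : Type*} [NormedAddCommGroup E] [NormedSpace ℝ E]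
  {M : Type*} [TopologicalSpace M] [ChartedSpace E M]
  {A A₁ A₂ : Type*} [NormedAddCommGroup A] [NormedSpace ℝ A]
  [NormedAddCommGroup A₁] [NormedSpace ℝ A₁] [NormedAddCommGroup A₂] [NormedSpace ℝ A₂]

theorem mvfderiv_clm_comp (l : A →L[ℝ] A₁) {f : M → A} {x : M}
    (hf : MDifferentiableAt 𝓘(ℝ, E) 𝓘(ℝ, A) f x) (w : TangentSpace 𝓘(ℝ, E) x) :
    mvfderiv 𝓘(ℝ, E) (fun y ↦ l (f y)) x w = l (mvfderiv 𝓘(ℝ, E) f x w) := by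
  have h := (l.hasFDerivAt (x := f x)).hasMFDerivAt.comp x hf.hasMFDerivAt
  change mfderiv 𝓘(ℝ, E) 𝓘(ℝ, A₁) (l ∘ f) x w = _
  rw [h.mfderiv]
  rfl

theorem mvfderiv_bilin (B : A →L[ℝ] A₁ →L[ℝ] A₂) {f : M → A} {g : M → A₁} {x : M}
    (hf : MDifferentiableAt 𝓘(ℝ, E) 𝓘(ℝ, A) f x)
    (hg : MDifferentiableAt 𝓘(ℝ, E) 𝓘(ℝ, A₁) g x) (w : TangentSpace 𝓘(ℝ, E) x) :
    mvfderiv 𝓘(ℝ, E) (fun y ↦ B (f y) (g y)) x w =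
      B (mvfderiv 𝓘(ℝ, E) f x w) (g x) + B (f x) (mvfderiv 𝓘(ℝ, E) g x w) := by
  have h1 : HasMFDerivAt 𝓘(ℝ, E) 𝓘(ℝ, A × A₁) (fun y ↦ (f y, g y)) x
      ((mvfderiv 𝓘(ℝ, E) f x).prod (mvfderiv 𝓘(ℝ, E) g x)) :=
    ⟨hf.hasMFDerivAt.1.prodMk hg.hasMFDerivAt.1, hf.hasMFDerivAt.2.prodMk hg.hasMFDerivAt.2⟩
  have h := HasMFDerivAt.comp x
    (B.isBoundedBilinearMap.hasFDerivAt (f x, g x)).hasMFDerivAt h1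
  change mfderiv 𝓘(ℝ, E) 𝓘(ℝ, A₂) ((fun q : A × A₁ ↦ B q.1 q.2) ∘ fun y ↦ (f y, g y)) x w = _
  rw [h.mfderiv, add_comm]
  rfl

theorem mvfderiv_congr_of_eventuallyEq {f g : M → A} {x : M} (h : f =ᶠ[nhds x] g) :
    (mvfderiv 𝓘(ℝ, E) f x : TangentSpace 𝓘(ℝ, E) x → A) = mvfderiv 𝓘(ℝ, E) g x := by
  funext w
  change mfderiv 𝓘(ℝ, E) 𝓘(ℝ, A) f x w = mfderiv 𝓘(ℝ, E) 𝓘(ℝ, A) g x w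
  rw [h.mfderiv_eq]
  rfl

theorem contMDiffAt_mvfderiv_apply [IsManifold 𝓘(ℝ, E) ∞ M] {f : M → A} {V : Field E M} {x : M}
    (hf : ContMDiffAt 𝓘(ℝ, E) 𝓘(ℝ, A) ∞ f x) (hV : SmoothAt V x) :
    ContMDiffAt 𝓘(ℝ, E) 𝓘(ℝ, A) ∞ (fun y ↦ mvfderiv 𝓘(ℝ, E) f y (V y)) x := by
  have hV' := (contMDiffAt_section x).1 hV
  set φ := extChartAt 𝓘(ℝ, E) x with hφ
  have hφx : ContMDiffAt 𝓘(ℝ, E) 𝓘(ℝ, E) ∞ φ x := contMDiffAt_extChartAt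
  have hF : ContDiffAt ℝ ∞ (f ∘ φ.symm) (φ x) := by
    have := (contMDiffAt_iff.1 hf).2
    simpa [hφ] using! this
  have hdF : ContDiffAt ℝ ∞ (fderiv ℝ (f ∘ φ.symm)) (φ x) := hF.fderiv_right (by simp)
  refine ((hdF.contMDiffAt.comp x hφx).clm_apply hV').congr_of_eventuallyEq ?_
  have hf1 : ∀ᶠ y in nhds x, ContMDiffAt 𝓘(ℝ, E) 𝓘(ℝ, A) 1 f y :=
    (contMDiffAt_iff_contMDiffAt_nhds (by simp)).1 (hf.of_le (by simp))
  have hs : ∀ᶠ y in nhds x, y ∈ (chartAt E x).source := chart_source_mem_nhds E x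
  have hF1 : ∀ᶠ y in nhds x, DifferentiableAt ℝ (f ∘ φ.symm) (φ y) := by
    have h0 : ∀ᶠ z in nhds (φ x), ContDiffAt ℝ 1 (f ∘ φ.symm) z :=
      (hF.of_le (by simp)).eventually (by simp)
    filter_upwards [hφx.continuousAt.eventually h0] with y hy using hy.differentiableAt (by simp)
  filter_upwards [hs, hF1, (eventually_eventually_nhds.2 hs)] with y hy hFy hs'
  have h1 : f =ᶠ[nhds y] (f ∘ φ.symm) ∘ φ := by
    filter_upwards [hs'] with z hz
    have : z ∈ φ.source := by simpa [hφ] using hz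
    simp [φ.left_inv this]
  have h2 : MDifferentiableAt 𝓘(ℝ, E) 𝓘(ℝ, E) φ y :=
    mdifferentiableAt_extChartAt hy
  have h3 := hFy.hasFDerivAt.hasMFDerivAt.comp y h2.hasMFDerivAt
  rw [mvfderiv_congr_of_eventuallyEq h1]
  change mfderiv 𝓘(ℝ, E) 𝓘(ℝ, A) ((f ∘ φ.symm) ∘ φ) y (V y) = _
  rw [h3.mfderiv]
  change fderiv ℝ (f ∘ φ.symm) (φ y) (mfderiv 𝓘(ℝ, E) 𝓘(ℝ, E) φ y (V y)) = _
  have h4 := TangentBundle.continuousLinearMapAt_trivializationAt (𝕜 := ℝ) (I := 𝓘(ℝ, E)) hy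
  rw [hφ, ← h4]
  congr 1
  exact (Trivialization.continuousLinearMapAt_apply_of_mem (R := ℝ) _ hy _)

end Calculus

section FrameCalculus

open VectorField

variable {E : Type*} [NormedAddCommGroup E] [NormedSpace ℝ E] [FiniteDimensional ℝ E]
  {M : Type*} [TopologicalSpace M] [ChartedSpace E M] [IsManifold 𝓘(ℝ, E) ∞ M]
  {A : Type*} [NormedAddCommGroup A] [NormedSpace ℝ A] [FiniteDimensional ℝ A]

theorem DiffAt.add {W W' : Field E M} {x : M} (h : DiffAt W x) (h' : DiffAt W' x) :
    DiffAt (W + W') x := mdifferentiableAt_add_section h h'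

theorem DiffAt.smul {f : M → ℝ} {W : Field E M} {x : M}
    (hf : MDifferentiableAt 𝓘(ℝ, E) 𝓘(ℝ, ℝ) f x) (h : DiffAt W x) :
    DiffAt (f • W) x := MDifferentiableAt.smul_section hf h

namespace IsFrame

variable {X : A →ₗ[ℝ] Field E M} (hX : IsFrame X)

/-- A first-order derivation on vector fields at `x` is determined by its values on the frame. -/
theorem derivation_eq {x : M} (w : TangentSpace 𝓘(ℝ, E) x)
    (D : Field E M → TangentSpace 𝓘(ℝ, E) x)
    (hadd : ∀ W W', DiffAt W x → DiffAt W' x → D (W + W') = D W + D W')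
    (hsmul : ∀ (f : M → ℝ) W, MDifferentiableAt 𝓘(ℝ, E) 𝓘(ℝ, ℝ) f x → DiffAt W x →
      D (f • W) = f x • D W + mvfderiv 𝓘(ℝ, E) f x w • W x)
    {W : Field E M} (hW : DiffAt W x) :
    D W = hX.equiv x (mvfderiv 𝓘(ℝ, E) (hX.coef W) x w) + D (X (hX.coef W x)) := by
  classical
  let b := Module.finBasis ℝ A
  have hzero : D 0 = 0 := by
    have h := hadd 0 0 (mdifferentiableAt_zeroSection ..) (mdifferentiableAt_zeroSection ..)
    simpa using h
  have hsum : ∀ (s : Finset (Fin (finrank ℝ A))) (f : Fin (finrank ℝ A) → M → ℝ),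
      (∀ i, MDifferentiableAt 𝓘(ℝ, E) 𝓘(ℝ, ℝ) (f i) x) →
      DiffAt (∑ i ∈ s, f i • X (b i)) x ∧
      D (∑ i ∈ s, f i • X (b i)) =
        ∑ i ∈ s, (f i x • D (X (b i)) + mvfderiv 𝓘(ℝ, E) (f i) x w • X (b i) x) := by
    intro s f hf
    induction s using Finset.induction_on with
    | empty =>
      simp only [Finset.sum_empty]
      exact ⟨mdifferentiableAt_zeroSection .., hzero⟩
    | insert i s hi ih =>
      have h1 : DiffAt (f i • X (b i)) x := DiffAt.smul (hf i) (hX.diffAt_frame _ _)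
      rw [Finset.sum_insert hi, Finset.sum_insert hi]
      exact ⟨h1.add ih.1, by
        rw [hadd _ _ h1 ih.1, ih.2, hsmul _ _ (hf i) (hX.diffAt_frame _ _)]⟩
  have hc := hX.diffAt_iff.1 hW
  let l : Fin (finrank ℝ A) → A →L[ℝ] ℝ := fun i ↦ LinearMap.toContinuousLinearMap (b.coord i)
  have hW' : W = ∑ i, (fun y ↦ l i (hX.coef W y)) • X (b i) := by
    funext y
    rw [Finset.sum_apply]
    conv_lhs => rw [← hX.apply_coef W y, ← b.sum_repr (hX.coef W y), map_sum, Finset.sum_apply]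
    refine Finset.sum_congr rfl fun i _ ↦ ?_
    rw [map_smul]
    rfl
  have hC : X (hX.coef W x) = ∑ i, (fun _ : M ↦ l i (hX.coef W x)) • X (b i) := by
    conv_lhs => rw [← b.sum_repr (hX.coef W x), map_sum]
    refine Finset.sum_congr rfl fun i _ ↦ ?_
    rw [map_smul]
    rfl
  have h1 := (hsum Finset.univ (fun i y ↦ l i (hX.coef W y)) fun i ↦
    (l i).contMDiff.contMDiffAt.mdifferentiableAt (n := 1) (by simp) |>.comp x hc).2
  have h2 := (hsum Finset.univ (fun i _ ↦ l i (hX.coef W x)) fun i ↦ mdifferentiableAt_const).2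
  rw [← hW'] at h1
  rw [← hC] at h2
  rw [h1, h2, Finset.sum_add_distrib]
  simp only [mvfderiv_const, zero_apply, zero_smul, add_zero]
  rw [add_comm]
  congr 1
  conv_rhs => rw [← b.sum_repr (mvfderiv 𝓘(ℝ, E) (hX.coef W) x w), map_sum]
  refine Finset.sum_congr rfl fun i _ ↦ ?_
  rw [map_smul, mvfderiv_clm_comp _ hc]
  rfl

variable {c : A →ₗ[ℝ] A →ₗ[ℝ] A}

/-- The Lie bracket in terms of a frame with constant structure functions. -/
theorem mlieBracket_eq (hc : ∀ a b, mlieBracket 𝓘(ℝ, E) (X a) (X b) = X (c a b))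
    {U V : Field E M} {x : M} (hU : DiffAt U x) (hV : DiffAt V x) :
    mlieBracket 𝓘(ℝ, E) U V x = hX.equiv x (mvfderiv 𝓘(ℝ, E) (hX.coef V) x (U x)
      - mvfderiv 𝓘(ℝ, E) (hX.coef U) x (V x) + c (hX.coef U x) (hX.coef V x)) := by
  have hE := FiniteDimensional.complete ℝ E
  have h1 : ∀ (U : Field E M) {V : Field E M}, DiffAt V x → mlieBracket 𝓘(ℝ, E) U V x =
      hX.equiv x (mvfderiv 𝓘(ℝ, E) (hX.coef V) x (U x)) +
        mlieBracket 𝓘(ℝ, E) U (X (hX.coef V x)) x := fun U V hV ↦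
    hX.derivation_eq (U x) (fun W ↦ mlieBracket 𝓘(ℝ, E) U W x)
      (fun W W' hW hW' ↦ mlieBracket_add_right hW hW')
      (fun f W hf hW ↦ (mlieBracket_smul_right hf hW).trans (add_comm _ _)) hV
  rw [h1 U hV, mlieBracket_swap_apply, h1 _ hU, hc, neg_add, ← Pi.neg_apply (X _), ← map_neg X]
  have h2 : -c (hX.coef V x) (hX.coef U x) = c (hX.coef U x) (hX.coef V x) := by
    apply (hX.bijective x).1
    simp only
    rw [map_neg, Pi.neg_apply, ← hc, ← hc, mlieBracket_swap_apply, neg_neg]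
  rw [h2, hX.apply_coef, ← hX.equiv_apply, map_add, map_sub]
  abel

end IsFrame
end FrameCalculus

theorem natCast_le_infty (n : ℕ) : ((n : ℕ) : WithTop ℕ∞) ≤ ∞ := by exact_mod_cast le_top

section Commutator

open VectorField

variable {E : Type*} [NormedAddCommGroup E] [NormedSpace ℝ E] [FiniteDimensional ℝ E]
  {M : Type*} [TopologicalSpace M] [ChartedSpace E M] [IsManifold 𝓘(ℝ, E) ∞ M]
  {A : Type*} [NormedAddCommGroup A] [NormedSpace ℝ A] [FiniteDimensional ℝ A]

theorem isManifold_minSmoothness (n : ℕ) : IsManifold 𝓘(ℝ, E) (minSmoothness ℝ n) M := by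
  rw [minSmoothness_of_isRCLikeNormedField]
  exact IsManifold.of_le (n := ∞) (natCast_le_infty n)

theorem eventually_mdifferentiableAt {f : M → A} {x : M}
    (hf : ContMDiffAt 𝓘(ℝ, E) 𝓘(ℝ, A) ∞ f x) :
    ∀ᶠ y in nhds x, MDifferentiableAt 𝓘(ℝ, E) 𝓘(ℝ, A) f y := by
  have h1 : ContMDiffAt 𝓘(ℝ, E) 𝓘(ℝ, A) 1 f x := hf.of_le (by simp)
  filter_upwards [(contMDiffAt_iff_contMDiffAt_nhds (by simp)).1 h1] with y hy
  exact hy.mdifferentiableAt (by simp)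

theorem smoothAt_mlieBracket {U V : Field E M} {x : M} (hU : SmoothAt U x) (hV : SmoothAt V x) :
    SmoothAt (mlieBracket 𝓘(ℝ, E) U V) x := by
  have hE := FiniteDimensional.complete ℝ E
  have : IsManifold 𝓘(ℝ, E) ((⊤ : ℕ∞) + 1) M := by simpa
  have : IsManifold 𝓘(ℝ, E) (minSmoothness ℝ 2) M := isManifold_minSmoothness 2
  exact ContMDiffAt.mlieBracket_vectorField (m := ⊤) (n := ⊤) hU hV (by simp)

theorem mvfderiv_commutator_real {f : M → ℝ} {U V W : Field E M} {x : M}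
    (hf : ContMDiffAt 𝓘(ℝ, E) 𝓘(ℝ, ℝ) ∞ f x) (hU : SmoothAt U x) (hV : SmoothAt V x)
    (hW : SmoothAt W x) (hWx : W x ≠ 0) :
    mvfderiv 𝓘(ℝ, E) (fun y ↦ mvfderiv 𝓘(ℝ, E) f y (V y)) x (U x)
      - mvfderiv 𝓘(ℝ, E) (fun y ↦ mvfderiv 𝓘(ℝ, E) f y (U y)) x (V x) =
    mvfderiv 𝓘(ℝ, E) f x (mlieBracket 𝓘(ℝ, E) U V x) := by
  have hE := FiniteDimensional.complete ℝ E
  have : IsManifold 𝓘(ℝ, E) (minSmoothness ℝ 3) M :=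
    isManifold_minSmoothness 3
  have hf1 : ∀ᶠ y in nhds x, MDifferentiableAt 𝓘(ℝ, E) 𝓘(ℝ, ℝ) f y :=
    eventually_mdifferentiableAt hf
  have key : ∀ (U V : Field E M), SmoothAt U x → SmoothAt V x →
      mlieBracket 𝓘(ℝ, E) U (mlieBracket 𝓘(ℝ, E) V (f • W)) x =
      mvfderiv 𝓘(ℝ, E) (fun y ↦ mvfderiv 𝓘(ℝ, E) f y (V y)) x (U x) • W x
        + mvfderiv 𝓘(ℝ, E) f x (V x) • mlieBracket 𝓘(ℝ, E) U W x
        + mvfderiv 𝓘(ℝ, E) f x (U x) • mlieBracket 𝓘(ℝ, E) V W x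
        + f x • mlieBracket 𝓘(ℝ, E) U (mlieBracket 𝓘(ℝ, E) V W) x := by
    intro U V hU hV
    have h1 : mlieBracket 𝓘(ℝ, E) V (f • W) =ᶠ[nhds x]
        ((fun y ↦ mvfderiv 𝓘(ℝ, E) f y (V y)) • W + f • mlieBracket 𝓘(ℝ, E) V W : Field E M) := by
      filter_upwards [hf1, hW.eventually_diffAt] with y hfy hWy
      exact mlieBracket_smul_right hfy hWy
    have hVf := (contMDiffAt_mvfderiv_apply hf hV).mdifferentiableAt (by simp)
    have hVW := (smoothAt_mlieBracket hV hW).diffAt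
    have h2 := Filter.EventuallyEq.mlieBracket_vectorField_eq (I := 𝓘(ℝ, E))
      (Filter.EventuallyEq.refl (nhds x) U) h1
    rw [h2, mlieBracket_add_right (DiffAt.smul hVf hW.diffAt)
        (DiffAt.smul hf1.self_of_nhds hVW), mlieBracket_smul_right hVf hW.diffAt,
      mlieBracket_smul_right hf1.self_of_nhds hVW]
    abel
  have hfW : SmoothAt (f • W) x := ContMDiffAt.smul_section hf hW
  have hle : minSmoothness ℝ 2 ≤ ∞ := by
    rw [minSmoothness_of_isRCLikeNormedField]
    exact natCast_le_infty 2
  have hJ := leibniz_identity_mlieBracket_apply (I := 𝓘(ℝ, E)) (ContMDiffAt.of_le hU hle)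
    (ContMDiffAt.of_le hV hle) (ContMDiffAt.of_le hfW hle)
  have hJ' := leibniz_identity_mlieBracket_apply (I := 𝓘(ℝ, E)) (ContMDiffAt.of_le hU hle)
    (ContMDiffAt.of_le hV hle) (ContMDiffAt.of_le hW hle)
  rw [key U V hU hV, key V U hV hU, mlieBracket_smul_right hf1.self_of_nhds hW.diffAt, hJ'] at hJ
  have h3 : (mvfderiv 𝓘(ℝ, E) (fun y ↦ mvfderiv 𝓘(ℝ, E) f y (V y)) x (U x)
      - mvfderiv 𝓘(ℝ, E) (fun y ↦ mvfderiv 𝓘(ℝ, E) f y (U y)) x (V x)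
      - mvfderiv 𝓘(ℝ, E) f x (mlieBracket 𝓘(ℝ, E) U V x)) • W x = 0 := by
    rw [sub_smul, sub_smul, sub_sub, sub_eq_zero]
    rw [smul_add] at hJ
    have := sub_eq_zero.2 hJ
    rw [← sub_eq_zero, ← this]
    abel
  exact sub_eq_zero.1 ((smul_eq_zero.1 h3).resolve_right hWx)

theorem mvfderiv_commutator {f : M → A} {U V W : Field E M} {x : M}
    (hf : ContMDiffAt 𝓘(ℝ, E) 𝓘(ℝ, A) ∞ f x) (hU : SmoothAt U x) (hV : SmoothAt V x)
    (hW : SmoothAt W x) (hWx : W x ≠ 0) :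
    mvfderiv 𝓘(ℝ, E) (fun y ↦ mvfderiv 𝓘(ℝ, E) f y (V y)) x (U x)
      - mvfderiv 𝓘(ℝ, E) (fun y ↦ mvfderiv 𝓘(ℝ, E) f y (U y)) x (V x) =
    mvfderiv 𝓘(ℝ, E) f x (mlieBracket 𝓘(ℝ, E) U V x) := by
  let b := Module.finBasis ℝ A
  apply b.ext_elem
  intro i
  let l : A →L[ℝ] ℝ := LinearMap.toContinuousLinearMap (b.coord i)
  have hlf : ContMDiffAt 𝓘(ℝ, E) 𝓘(ℝ, ℝ) ∞ (fun y ↦ l (f y)) x :=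
    l.contMDiff.contMDiffAt.comp x hf
  have hf1 : ∀ᶠ y in nhds x, MDifferentiableAt 𝓘(ℝ, E) 𝓘(ℝ, A) f y :=
    eventually_mdifferentiableAt hf
  have key : ∀ (V : Field E M), SmoothAt V x → ∀ w,
      mvfderiv 𝓘(ℝ, E) (fun y ↦ mvfderiv 𝓘(ℝ, E) (fun y ↦ l (f y)) y (V y)) x w =
      l (mvfderiv 𝓘(ℝ, E) (fun y ↦ mvfderiv 𝓘(ℝ, E) f y (V y)) x w) := by
    intro V hV w
    rw [← mvfderiv_clm_comp l ((contMDiffAt_mvfderiv_apply hf hV).mdifferentiableAt (by simp))]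
    refine congrFun (mvfderiv_congr_of_eventuallyEq ?_) w
    filter_upwards [hf1] with y hy using mvfderiv_clm_comp l hy _
  have h := mvfderiv_commutator_real hlf hU hV hW hWx
  rw [key V hV, key U hU, mvfderiv_clm_comp l hf1.self_of_nhds, ← map_sub] at h
  exact h

end Commutator

section FrameConnection

open VectorField

variable {E : Type*} [NormedAddCommGroup E] [NormedSpace ℝ E] [FiniteDimensional ℝ E]
  {M : Type*} [TopologicalSpace M] [ChartedSpace E M] [IsManifold 𝓘(ℝ, E) ∞ M]
  {A : Type*} [NormedAddCommGroup A] [NormedSpace ℝ A] [FiniteDimensional ℝ A]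

instance (x : M) : FiniteDimensional ℝ (TangentSpace 𝓘(ℝ, E) x) :=
  inferInstanceAs (FiniteDimensional ℝ E)

instance (x : M) : T2Space (TangentSpace 𝓘(ℝ, E) x) :=
  inferInstanceAs (T2Space E)

/-- A bilinear map between finite-dimensional spaces, as a continuous bilinear map. -/
def continuousBilin {A₁ : Type*} [NormedAddCommGroup A₁] [NormedSpace ℝ A₁]
    (B : A →ₗ[ℝ] A →ₗ[ℝ] A₁) : A →L[ℝ] A →L[ℝ] A₁ :=
  LinearMap.toContinuousLinearMap (LinearMap.toContinuousLinearMap.toLinearMap ∘ₗ B)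

theorem continuousBilin_apply {A₁ : Type*} [NormedAddCommGroup A₁] [NormedSpace ℝ A₁]
    (B : A →ₗ[ℝ] A →ₗ[ℝ] A₁) (a b : A) : continuousBilin B a b = B a b := rfl

/-- The curvature of the connection with constant coefficients `Γ`, for the bracket `c`. -/
def algebraicCurvature (c Γ : A →ₗ[ℝ] A →ₗ[ℝ] A) : A →ₗ[ℝ] A →ₗ[ℝ] A →ₗ[ℝ] A :=
  LinearMap.mk₂ ℝ (fun a b ↦ Γ b ∘ₗ Γ a - Γ a ∘ₗ Γ b + Γ (c a b))
    (fun a a' b ↦ by ext; simp; abel) (fun r a b ↦ by ext; simp [smul_sub])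
    (fun a b b' ↦ by ext; simp; abel) (fun r a b ↦ by ext; simp [smul_sub])

theorem algebraicCurvature_apply (c Γ : A →ₗ[ℝ] A →ₗ[ℝ] A) (a b d : A) :
    algebraicCurvature c Γ a b d = Γ b (Γ a d) - Γ a (Γ b d) + Γ (c a b) d := rfl

namespace IsFrame

variable {X : A →ₗ[ℝ] Field E M} (hX : IsFrame X) {c Γ : A →ₗ[ℝ] A →ₗ[ℝ] A}

theorem cov_eq {cov : Connection E M} (hΓ : ∀ a b x, cov (X b) x (X a x) = X (Γ a b) x)
    {W : Field E M} {x : M} (hW : DiffAt W x) (w : TangentSpace 𝓘(ℝ, E) x) :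
    cov W x w = hX.equiv x
      (mvfderiv 𝓘(ℝ, E) (hX.coef W) x w + Γ ((hX.equiv x).symm w) (hX.coef W x)) := by
  have h := hX.derivation_eq w (fun W ↦ cov W x w)
    (fun W W' hW hW' ↦ by rw [cov.isCovariantDerivativeOnUniv.add hW hW']; rfl)
    (fun f W hf hW ↦ by rw [cov.isCovariantDerivativeOnUniv.leibniz hW hf]; rfl) hW
  rw [h, map_add]
  congr 1
  have h1 := hΓ ((hX.equiv x).symm w) (hX.coef W x) x
  rwa [← hX.equiv_apply x ((hX.equiv x).symm w), LinearEquiv.apply_symm_apply] at h1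

variable (Γ) in
/-- The connection with constant coefficients `Γ` in the frame. -/
def connection : Connection E M where
  toFun W x := LinearMap.toContinuousLinearMap ((hX.equiv x).toLinearMap ∘ₗ
    ((mvfderiv 𝓘(ℝ, E) (hX.coef W) x).toLinearMap +
      Γ.flip (hX.coef W x) ∘ₗ (hX.equiv x).symm.toLinearMap))
  isCovariantDerivativeOnUniv :=
    { add := by
        intro W W' x hW hW' _
        ext w
        change hX.equiv x (mvfderiv 𝓘(ℝ, E) (hX.coef (W + W')) x w +
            Γ ((hX.equiv x).symm w) (hX.coef (W + W') x)) =
          hX.equiv x (mvfderiv 𝓘(ℝ, E) (hX.coef W) x w + Γ ((hX.equiv x).symm w) (hX.coef W x)) +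
          hX.equiv x (mvfderiv 𝓘(ℝ, E) (hX.coef W') x w + Γ ((hX.equiv x).symm w) (hX.coef W' x))
        rw [hX.coef_add, mvfderiv_add (hX.diffAt_iff.1 hW) (hX.diffAt_iff.1 hW'), ← map_add]
        simp only [add_apply, Pi.add_apply, map_add]
        abel
      leibniz := by
        intro W f x hW hf _
        ext w
        change hX.equiv x (mvfderiv 𝓘(ℝ, E) (hX.coef (f • W)) x w +
            Γ ((hX.equiv x).symm w) (hX.coef (f • W) x)) =
          f x • hX.equiv x
            (mvfderiv 𝓘(ℝ, E) (hX.coef W) x w + Γ ((hX.equiv x).symm w) (hX.coef W x)) +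
          mvfderiv 𝓘(ℝ, E) f x w • W x
        rw [hX.coef_smul, mvfderiv_smul hf (hX.diffAt_iff.1 hW)]
        rw [← hX.equiv_coef W x]
        simp only [add_apply, Pi.smul_apply', map_add, map_smul, smul_add,
          _root_.smul_apply, ContinuousLinearMap.smulRight_apply]
        abel }

theorem connection_apply {W : Field E M} {x : M} (w : TangentSpace 𝓘(ℝ, E) x) :
    hX.connection Γ W x w = hX.equiv x
      (mvfderiv 𝓘(ℝ, E) (hX.coef W) x w + Γ ((hX.equiv x).symm w) (hX.coef W x)) := rfl

variable {B : LinearMap.BilinForm ℝ A} {g : Metric E M}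

theorem form_apply (hg : ∀ a b x, g.form x (X a x) (X b x) = B a b) (x : M)
    (u v : TangentSpace 𝓘(ℝ, E) x) :
    g.form x u v = B ((hX.equiv x).symm u) ((hX.equiv x).symm v) := by
  rw [← hg _ _ x, ← hX.equiv_apply, ← hX.equiv_apply]
  simp

theorem isLeviCivita_connection (hc : ∀ a b, mlieBracket 𝓘(ℝ, E) (X a) (X b) = X (c a b))
    (hg : ∀ a b x, g.form x (X a x) (X b x) = B a b)
    (htor : ∀ a b, Γ a b - Γ b a = c a b)
    (hskew : ∀ a b d, B (Γ a b) d + B b (Γ a d) = 0) :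
    IsLeviCivita g (hX.connection Γ) where
  torsionFree x U V hU hV := by
    rw [hX.mlieBracket_eq hc hU hV, connection_apply, connection_apply, ← map_sub, ← htor]
    congr 1
    change _ + Γ (hX.coef U x) _ - (_ + Γ (hX.coef V x) _) = _
    abel
  metric x U V hU hV w := by
    have h1 : (fun y ↦ g.form y (U y) (V y)) =
        fun y ↦ continuousBilin B (hX.coef U y) (hX.coef V y) :=
      funext fun y ↦ hX.form_apply hg y _ _
    rw [h1, mvfderiv_bilin _ (hX.diffAt_iff.1 hU) (hX.diffAt_iff.1 hV), hX.form_apply hg,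
      hX.form_apply hg, connection_apply, connection_apply, LinearEquiv.symm_apply_apply,
      LinearEquiv.symm_apply_apply]
    simp only [continuousBilin_apply, map_add, LinearMap.add_apply]
    have := hskew ((hX.equiv x).symm w) (hX.coef U x) (hX.coef V x)
    change B _ _ + B (hX.coef U x) _ = B _ (hX.coef V x) + B _ (hX.coef V x) +
      (B (hX.coef U x) _ + B (hX.coef U x) _)
    linarith

/-- The Levi-Civita connection of a metric with constant coefficients in the frame. -/
theorem leviCivita_frame (hX : IsFrame X) (hc : ∀ a b, mlieBracket 𝓘(ℝ, E) (X a) (X b) = X (c a b))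
    (hg : ∀ a b x, g.form x (X a x) (X b x) = B a b)
    (hs : ∀ a b, B a b = B b a) (hB : B.Nondegenerate)
    (htor : ∀ a b, Γ a b - Γ b a = c a b)
    (hskew : ∀ a b d, B (Γ a b) d + B b (Γ a d) = 0)
    {cov : Connection E M} (hcov : IsLeviCivita g cov) (a b : A) (x : M) :
    cov (X b) x (X a x) = X (Γ a b) x := by
  let D : A → A → A := fun a b ↦ (hX.equiv x).symm (cov (X b) x (X a x)) - Γ a b
  have hsymm : ∀ a b, D a b = D b a := by
    intro a b
    have h1 := hcov.torsionFree x (X a) (X b) (hX.diffAt_frame _ _) (hX.diffAt_frame _ _)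
    rw [hc, ← htor] at h1
    have h2 := congrArg (hX.equiv x).symm h1
    rw [map_sub, equiv_symm_apply] at h2
    rw [← sub_eq_zero]
    simp only [D]
    rw [sub_sub_sub_comm, h2, sub_self]
  have hsk : ∀ a b d, B (D a b) d = - B b (D a d) := by
    intro a b d
    have h1 := hcov.metric x (X b) (X d) (hX.diffAt_frame _ _) (hX.diffAt_frame _ _) (X a x)
    simp only [hg] at h1
    rw [mvfderiv_const, hX.form_apply hg, hX.form_apply hg, equiv_symm_apply,
      equiv_symm_apply] at h1
    have h2 := hskew a b d
    simp only [D, map_sub, LinearMap.sub_apply]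
    simp only [zero_apply] at h1
    linarith
  have hD : D a b = 0 := by
    apply hB.1
    intro d
    have h1 := hsk a b d
    rw [hsymm a d, hs b, hsk d a b, hsymm d b, hs a, hsk b d a, hsymm b a, hs d] at h1
    linarith
  have h3 : (hX.equiv x).symm (cov (X b) x (X a x)) = Γ a b := sub_eq_zero.1 hD
  rw [← hX.equiv_apply x (Γ a b), ← h3, LinearEquiv.apply_symm_apply]

variable (c Γ) in
/-- The curvature tensor of the connection with constant coefficients `Γ` in the frame. -/
def curvature : CurvatureField E M := fun x ↦
  LinearMap.mk₂ ℝ (fun u v ↦ (hX.equiv x).toLinearMap ∘ₗ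
      algebraicCurvature c Γ ((hX.equiv x).symm u) ((hX.equiv x).symm v) ∘ₗ
      (hX.equiv x).symm.toLinearMap)
    (fun a a' b ↦ by ext; simp) (fun r a b ↦ by ext; simp)
    (fun a b b' ↦ by ext; simp) (fun r a b ↦ by ext; simp)

theorem curvature_apply (x : M) (u v w : TangentSpace 𝓘(ℝ, E) x) :
    hX.curvature c Γ x u v w = hX.equiv x (algebraicCurvature c Γ ((hX.equiv x).symm u)
      ((hX.equiv x).symm v) ((hX.equiv x).symm w)) := rfl

theorem isCurvatureTensor_curvature [Nontrivial A]
    (hc : ∀ a b, mlieBracket 𝓘(ℝ, E) (X a) (X b) = X (c a b))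
    {cov : Connection E M} (hΓ : ∀ a b x, cov (X b) x (X a x) = X (Γ a b) x) :
    IsCurvatureTensor cov (hX.curvature c Γ) := by
  intro x U V W hU hV hW
  have hu := hX.smoothAt_iff.1 hU
  have hv := hX.smoothAt_iff.1 hV
  have hw := hX.smoothAt_iff.1 hW
  have hu1 := hX.diffAt_iff.1 hU.diffAt
  have hv1 := hX.diffAt_iff.1 hV.diffAt
  have hw1 := hX.diffAt_iff.1 hW.diffAt
  have key : ∀ {U : Field E M}, SmoothAt U x →
      hX.coef (fun y ↦ cov W y (U y)) =ᶠ[nhds x] (fun y ↦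
        mvfderiv 𝓘(ℝ, E) (hX.coef W) y (U y) +
          continuousBilin Γ (hX.coef U y) (hX.coef W y)) := by
    intro U hU
    filter_upwards [hW.eventually_diffAt] with y hy
    change (hX.equiv y).symm (cov W y (U y)) = _
    rw [hX.cov_eq hΓ hy, LinearEquiv.symm_apply_apply]
    rfl
  have key2 : ∀ {U : Field E M}, SmoothAt U x → ∀ w : TangentSpace 𝓘(ℝ, E) x,
      cov (fun y ↦ cov W y (U y)) x w = hX.equiv x
        (mvfderiv 𝓘(ℝ, E) (fun y ↦ mvfderiv 𝓘(ℝ, E) (hX.coef W) y (U y)) x w +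
          (Γ (mvfderiv 𝓘(ℝ, E) (hX.coef U) x w) (hX.coef W x) +
            Γ (hX.coef U x) (mvfderiv 𝓘(ℝ, E) (hX.coef W) x w)) +
          Γ ((hX.equiv x).symm w) (mvfderiv 𝓘(ℝ, E) (hX.coef W) x (U x) +
            Γ (hX.coef U x) (hX.coef W x))) := by
    intro U hU w
    have hu1 := hX.diffAt_iff.1 hU.diffAt
    have h1 := (contMDiffAt_mvfderiv_apply hw hU).mdifferentiableAt (by simp)
    have h2 : MDifferentiableAt 𝓘(ℝ, E) 𝓘(ℝ, A)
        (fun y ↦ continuousBilin Γ (hX.coef U y) (hX.coef W y)) x :=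
      MDifferentiableAt.clm_apply (((continuousBilin Γ).contMDiff.contMDiffAt.mdifferentiableAt
        (n := 1) (by simp)).comp x hu1) hw1
    have hd : DiffAt (fun y ↦ cov W y (U y)) x :=
      hX.diffAt_iff.2 ((h1.add h2).congr_of_eventuallyEq (key hU))
    rw [hX.cov_eq hΓ hd, mvfderiv_congr_of_eventuallyEq (key hU), (key hU).self_of_nhds]
    have h3 := mvfderiv_add h1 h2
    have h4 := mvfderiv_bilin (continuousBilin Γ) hu1 hw1 w
    change hX.equiv x (mvfderiv 𝓘(ℝ, E) ((fun y ↦ mvfderiv 𝓘(ℝ, E) (hX.coef W) y (U y)) +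
      fun y ↦ continuousBilin Γ (hX.coef U y) (hX.coef W y)) x w + _) = _
    rw [h3, add_apply, h4]
    rfl
  obtain ⟨a, ha⟩ := exists_ne (0 : A)
  have ha' : X a x ≠ 0 := by
    rw [← hX.equiv_apply]
    exact (hX.equiv x).map_ne_zero_iff.2 ha
  have hcomm := mvfderiv_commutator hw hU hV (hX.smooth a x) ha'
  have hbr := hX.mlieBracket_eq hc hU.diffAt hV.diffAt
  rw [curvature_apply, key2 hU, key2 hV, hX.cov_eq hΓ hW.diffAt, ← map_sub, ← map_add, ← hcomm,
    hbr, LinearEquiv.symm_apply_apply, algebraicCurvature_apply]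
  congr 1
  change Γ (hX.coef V x) (Γ (hX.coef U x) (hX.coef W x)) - Γ (hX.coef U x)
      (Γ (hX.coef V x) (hX.coef W x)) + Γ (c (hX.coef U x) (hX.coef V x)) (hX.coef W x) =
    _ + _ + Γ (hX.coef V x) _ - (_ + _ + Γ (hX.coef U x) _) + _
  simp only [map_add, map_sub, LinearMap.add_apply, LinearMap.sub_apply]
  abel

/-- The curvature tensor of a connection is unique, and given by its values on the frame. -/
theorem curvatureTensor_eq (hX : IsFrame X) [Nontrivial A]
    (hc : ∀ a b, mlieBracket 𝓘(ℝ, E) (X a) (X b) = X (c a b))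
    {cov : Connection E M} (hΓ : ∀ a b x, cov (X b) x (X a x) = X (Γ a b) x)
    {R : CurvatureField E M} (hR : IsCurvatureTensor cov R) (x : M) (a b d : A) :
    R x (X a x) (X b x) (X d x) = X (algebraicCurvature c Γ a b d) x := by
  rw [hR x _ _ _ (hX.smooth a x) (hX.smooth b x) (hX.smooth d x),
    ← hX.isCurvatureTensor_curvature hc hΓ x _ _ _ (hX.smooth a x) (hX.smooth b x)
      (hX.smooth d x), curvature_apply]
  simp

end IsFrame
end FrameConnection

section Algebra

theorem q_re : q.re = -1 / 2 := by
  have h : (2 * Real.pi * Complex.I / 3 : ℂ) = ((Real.pi - Real.pi / 3 : ℝ) : ℂ) * Complex.I := by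
    push_cast; ring
  rw [q, h, Complex.exp_ofReal_mul_I_re, Real.cos_pi_sub, Real.cos_pi_div_three]
  norm_num

theorem q_im : q.im = √3 / 2 := by
  have h : (2 * Real.pi * Complex.I / 3 : ℂ) = ((Real.pi - Real.pi / 3 : ℝ) : ℂ) * Complex.I := by
    push_cast; ring
  rw [q, h, Complex.exp_ofReal_mul_I_im, Real.sin_pi_sub, Real.sin_pi_div_three]

theorem q_im_sq : q.im * q.im = 3 / 4 := by
  rw [q_im]
  have := Real.mul_self_sqrt (show (0 : ℝ) ≤ 3 by norm_num)
  linarith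

theorem q_sq : q ^ 2 = -1 - q := by
  apply Complex.ext <;> simp [pow_two, q_re, q_im_sq] <;> ring

theorem q_cube : q ^ 3 = 1 := by
  linear_combination (q - 1) * q_sq

theorem exampleForm_apply (ε : ℝ) (a b : ℂ × ℝ) :
    exampleForm ε a b = (a.1 * b.1).im + ε * a.2 * b.2 := rfl

theorem exampleForm_symm (ε : ℝ) (a b : ℂ × ℝ) : exampleForm ε a b = exampleForm ε b a := by
  rw [exampleForm_apply, exampleForm_apply, mul_comm a.1]
  ring

theorem exampleOperator_apply (p : ℝ) (a : ℂ × ℝ) :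
    exampleOperator p a = (p * q * a.1, p * a.2) := rfl

theorem exampleForm_operator (ε p : ℝ) (a b : ℂ × ℝ) :
    exampleForm ε (exampleOperator p a) b = exampleForm ε a (exampleOperator p b) := by
  simp only [exampleForm_apply, exampleOperator_apply]
  rw [show p * q * a.1 * b.1 = a.1 * (p * q * b.1) by ring]
  ring

theorem exampleOperator_cube (p : ℝ) (a : ℂ × ℝ) :
    exampleOperator p (exampleOperator p (exampleOperator p a)) = p ^ 3 • a := by
  simp only [exampleOperator_apply]
  ext1
  · simp only [Prod.smul_fst, Complex.real_smul]
    push_cast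
    linear_combination (p : ℂ) ^ 3 * a.1 * q_cube
  · simp only [Prod.smul_snd, smul_eq_mul]
    ring

/-- The form on `(ℂ × ℝ) × ℝ` for which `g(u, u) = δ`, `g(u, v) = 0`, `g(v, v') = ⟨v, v'⟩`. -/
def totalForm (ε δ : ℝ) : LinearMap.BilinForm ℝ ((ℂ × ℝ) × ℝ) :=
  LinearMap.mk₂ ℝ (fun a b ↦ exampleForm ε a.1 b.1 + δ * a.2 * b.2)
    (fun a a' b ↦ by simp; ring) (fun c a b ↦ by simp; ring)
    (fun a b b' ↦ by simp; ring) (fun c a b ↦ by simp; ring)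

theorem totalForm_apply (ε δ : ℝ) (a b : (ℂ × ℝ) × ℝ) :
    totalForm ε δ a b = exampleForm ε a.1 b.1 + δ * a.2 * b.2 := rfl

theorem totalForm_symm (ε δ : ℝ) (a b : (ℂ × ℝ) × ℝ) :
    totalForm ε δ a b = totalForm ε δ b a := by
  rw [totalForm_apply, totalForm_apply, exampleForm_symm]
  ring

theorem totalForm_nondegenerate {ε δ : ℝ} (hε : ε ≠ 0) (hδ : δ ≠ 0) :
    (totalForm ε δ).Nondegenerate := by
  have h : ∀ a, (∀ b, totalForm ε δ a b = 0) → a = 0 := by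
    intro a ha
    have h1 := ha ((1, 0), 0)
    have h2 := ha ((Complex.I, 0), 0)
    have h3 := ha ((0, 1), 0)
    have h4 := ha (0, 1)
    simp [totalForm_apply, exampleForm_apply, hε, hδ] at h1 h2 h3 h4
    exact Prod.ext (Prod.ext (Complex.ext h2 h1) h3) h4
  exact ⟨h, fun a ha ↦ h a fun b ↦ by rw [totalForm_symm]; exact ha b⟩

/-- The bracket of `V ⊕ ℝu`, with `[u, v] = Fv` and `[v, v'] = 0`. -/
def bracket (p : ℝ) : (ℂ × ℝ) × ℝ →ₗ[ℝ] (ℂ × ℝ) × ℝ →ₗ[ℝ] (ℂ × ℝ) × ℝ :=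
  LinearMap.mk₂ ℝ (fun a b ↦ (a.2 • exampleOperator p b.1 - b.2 • exampleOperator p a.1, 0))
    (fun a a' b ↦ by ext1 <;> simp; module) (fun c a b ↦ by ext1 <;> simp; module)
    (fun a b b' ↦ by ext1 <;> simp; module) (fun c a b ↦ by ext1 <;> simp; module)

theorem bracket_apply (p : ℝ) (a b : (ℂ × ℝ) × ℝ) :
    bracket p a b = (a.2 • exampleOperator p b.1 - b.2 • exampleOperator p a.1, 0) := rfl

/-- The Levi-Civita connection on left-invariant fields: `∇_v u = -Fv`, `∇_v v' = δ⟨Fv, v'⟩u`,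
`∇_u u = ∇_u v = 0`. -/
def christoffel (ε δ p : ℝ) : (ℂ × ℝ) × ℝ →ₗ[ℝ] (ℂ × ℝ) × ℝ →ₗ[ℝ] (ℂ × ℝ) × ℝ :=
  LinearMap.mk₂ ℝ (fun a b ↦
      (-b.2 • exampleOperator p a.1, δ * exampleForm ε (exampleOperator p a.1) b.1))
    (fun a a' b ↦ by ext1 <;> simp; ring) (fun c a b ↦ by
      ext1 <;> simp only [Prod.smul_fst, Prod.smul_snd, map_smul, LinearMap.smul_apply, smul_eq_mul]
      · module
      · ring)
    (fun a b b' ↦ by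
      ext1 <;> simp only [Prod.fst_add, Prod.snd_add, map_add]
      · module
      · ring) (fun c a b ↦ by
      ext1 <;> simp only [Prod.smul_fst, Prod.smul_snd, map_smul, smul_eq_mul]
      · module
      · ring)

theorem christoffel_apply (ε δ p : ℝ) (a b : (ℂ × ℝ) × ℝ) : christoffel ε δ p a b =
    (-b.2 • exampleOperator p a.1, δ * exampleForm ε (exampleOperator p a.1) b.1) := rfl

theorem christoffel_torsion (ε δ p : ℝ) (a b : (ℂ × ℝ) × ℝ) :
    christoffel ε δ p a b - christoffel ε δ p b a = bracket p a b := by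
  rw [christoffel_apply, christoffel_apply, bracket_apply, Prod.mk_sub_mk,
    exampleForm_operator, exampleForm_symm, sub_self]
  congr 1
  module

theorem christoffel_skew {ε δ : ℝ} (hδ : δ * δ = 1) (p : ℝ) (a b d : (ℂ × ℝ) × ℝ) :
    totalForm ε δ (christoffel ε δ p a b) d + totalForm ε δ b (christoffel ε δ p a d) = 0 := by
  simp only [christoffel_apply, totalForm_apply, map_smul, LinearMap.smul_apply, smul_eq_mul]
  rw [exampleForm_symm ε b.1]
  linear_combination (exampleForm ε (exampleOperator p a.1) b.1 * d.2 +
    exampleForm ε (exampleOperator p a.1) d.1 * b.2) * hδ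

/-- The curvature tensor on left-invariant fields. -/
def curv (ε δ p : ℝ) := algebraicCurvature (bracket p) (christoffel ε δ p)

theorem curv_apply (ε δ p : ℝ) (a b d : (ℂ × ℝ) × ℝ) : curv ε δ p a b d =
    ((δ * exampleForm ε (exampleOperator p b.1) d.1) • exampleOperator p a.1
      - (δ * exampleForm ε (exampleOperator p a.1) d.1) • exampleOperator p b.1
      - (d.2 * a.2) • exampleOperator p (exampleOperator p b.1)
      + (d.2 * b.2) • exampleOperator p (exampleOperator p a.1),
    δ * (a.2 * exampleForm ε (exampleOperator p (exampleOperator p b.1)) d.1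
      - b.2 * exampleForm ε (exampleOperator p (exampleOperator p a.1)) d.1)) := by
  rw [curv, algebraicCurvature_apply]
  simp only [christoffel_apply, bracket_apply, map_smul, map_sub, LinearMap.sub_apply,
    LinearMap.smul_apply, Prod.mk_sub_mk, Prod.mk_add_mk, smul_eq_mul]
  rw [exampleForm_symm ε (exampleOperator p b.1) (exampleOperator p a.1)]
  congr 1
  · module
  · ring

/-- The trace of an endomorphism of `(ℂ × ℝ) × ℝ`. -/
theorem trace_eq (T : (ℂ × ℝ) × ℝ →ₗ[ℝ] (ℂ × ℝ) × ℝ) : LinearMap.trace ℝ _ T =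
    (T ((1, 0), 0)).1.1.re + (T ((Complex.I, 0), 0)).1.1.im + (T ((0, 1), 0)).1.2
      + (T (0, 1)).2 := by
  let b := (Complex.basisOneI.prod (Basis.singleton Unit ℝ)).prod (Basis.singleton Unit ℝ)
  rw [LinearMap.trace_eq_matrix_trace ℝ b, Matrix.trace]
  simp [b, LinearMap.toMatrix_apply, Fintype.sum_sum_type, Fin.sum_univ_two]

theorem curv_trace (ε δ p : ℝ) (a d : (ℂ × ℝ) × ℝ) :
    LinearMap.trace ℝ _ ((curv ε δ p a).flip d) = 0 := by
  rw [trace_eq]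
  simp only [LinearMap.flip_apply, curv_apply]
  simp [exampleOperator_apply, exampleForm_apply, q_re]
  linear_combination 2 * p ^ 2 * d.2 * a.2 * q_im_sq

theorem curv_not_parallel {ε δ p : ℝ} (hδ : δ ≠ 0) (hp : p ≠ 0) :
    ∃ z a b d : (ℂ × ℝ) × ℝ, christoffel ε δ p z (curv ε δ p a b d)
      - curv ε δ p (christoffel ε δ p z a) b d - curv ε δ p a (christoffel ε δ p z b) d
      - curv ε δ p a b (christoffel ε δ p z d) ≠ 0 := by
  refine ⟨((0, 1), 0), (0, 1), ((1, 0), 0), ((1, 0), 0), fun h ↦ ?_⟩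
  have h1 := congrArg (fun w ↦ w.1.2) h
  simp [curv_apply, christoffel_apply, exampleOperator_apply, exampleForm_apply, q_re] at h1
  have h2 : δ * p ^ 3 * (2 * q.im) = 0 := by linear_combination h1
  have h3 : q.im ≠ 0 := fun h ↦ by
    have := q_im_sq
    norm_num [h] at this
  simp [hδ, hp, h3] at h2

theorem finrank_total : finrank ℝ ((ℂ × ℝ) × ℝ) = 4 := by
  simp

end Algebra

section Exterior

variable {W : Type*} [AddCommGroup W] [Module ℝ W]

theorem wedge_add_left (a a' b : W) : wedge (a + a') b = wedge a b + wedge a' b :=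
  (exteriorPower.ιMulti ℝ 2 (M := W)).map_vecCons_add ![b] a a'

theorem wedge_swap (a b : W) : wedge a b = - wedge b a := by
  have := (exteriorPower.ιMulti ℝ 2 (M := W)).map_swap ![b, a] (i := 0) (j := 1) (by simp)
  rw [wedge, wedge, ← this]
  congr 1
  ext i
  fin_cases i <;> simp

theorem wedge_self (a : W) : wedge a a = 0 := by
  exact (exteriorPower.ιMulti ℝ 2 (M := W)).map_eq_zero_of_eq ![a, a] (i := 0) (j := 1) rfl
    (by simp)

theorem wedge_smul_left (r : ℝ) (a b : W) : wedge (r • a) b = r • wedge a b :=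
  (exteriorPower.ιMulti ℝ 2 (M := W)).map_vecCons_smul ![b] r a

theorem wedge_add_right (a b b' : W) : wedge a (b + b') = wedge a b + wedge a b' := by
  rw [wedge_swap, wedge_add_left, neg_add, ← wedge_swap, ← wedge_swap]

theorem wedge_smul_right (r : ℝ) (a b : W) : wedge a (r • b) = r • wedge a b := by
  rw [wedge_swap, wedge_smul_left, wedge_swap a b, smul_neg]

/-- `u ∧ v` as a bilinear map. -/
def wedgeL : W →ₗ[ℝ] W →ₗ[ℝ] ⋀[ℝ]^2 W :=
  LinearMap.mk₂ ℝ wedge wedge_add_left wedge_smul_left wedge_add_right wedge_smul_right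

theorem wedgeL_apply (a b : W) : wedgeL a b = wedge a b := rfl

theorem linearMap_ext_wedge {N : Type*} [AddCommGroup N] [Module ℝ N] {f g : ⋀[ℝ]^2 W →ₗ[ℝ] N}
    (h : ∀ a b, f (wedge a b) = g (wedge a b)) : f = g := by
  apply exteriorPower.linearMap_ext
  ext m
  have : m = ![m 0, m 1] := by
    ext i
    fin_cases i <;> rfl
  simp only [LinearMap.compAlternatingMap_apply]
  rw [this]
  exact h _ _

theorem linearMap_ext_wedge_basis {ι : Type*} (e : Basis ι ℝ W)
    {N : Type*} [AddCommGroup N] [Module ℝ N] {f g : ⋀[ℝ]^2 W →ₗ[ℝ] N}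
    (h : ∀ i j, i ≠ j → f (wedge (e i) (e j)) = g (wedge (e i) (e j))) : f = g := by
  have h1 : wedgeL.compr₂ f = wedgeL.compr₂ g := by
    refine e.ext fun i ↦ e.ext fun j ↦ ?_
    simp only [LinearMap.compr₂_apply, wedgeL_apply]
    by_cases hij : i = j
    · rw [hij, wedge_self, map_zero, map_zero]
    · exact h i j hij
  exact linearMap_ext_wedge fun a b ↦ congr($h1 a b)

theorem map_wedge (f : W →ₗ[ℝ] W) (a b : W) :
    exteriorPower.map 2 f (wedge a b) = wedge (f a) (f b) := by
  rw [wedge, exteriorPower.map_apply_ιMulti, wedge]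
  congr 1
  ext i
  fin_cases i <;> rfl

theorem bivectorForm_symm {B : LinearMap.BilinForm ℝ W} (hs : ∀ a b, B a b = B b a)
    (α β : ⋀[ℝ]^2 W) : bivectorForm B α β = bivectorForm B β α := by
  have h : bivectorForm B = (bivectorForm B).flip := by
    refine linearMap_ext_wedge fun a b ↦ linearMap_ext_wedge fun c d ↦ ?_
    change _ = bivectorForm B (wedge c d) (wedge a b)
    rw [bivectorForm_wedge, bivectorForm_wedge, hs a, hs b, hs a, hs b]
    ring
  exact congr($h α β)

theorem bivectorForm_ext [FiniteDimensional ℝ W] {B : LinearMap.BilinForm ℝ W}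
    (hs : ∀ a b, B a b = B b a) (hB : B.Nondegenerate) {α β : ⋀[ℝ]^2 W}
    (h : ∀ c d, bivectorForm B α (wedge c d) = bivectorForm B β (wedge c d)) : α = β := by
  let b := finBasis ℝ W
  apply (b.exteriorPower 2).ext_elem
  intro s
  rw [exteriorPower.basis_repr_apply, exteriorPower.basis_repr_apply]
  have h1 : ∀ i, ∃ w, B w = b.coord i := fun i ↦
    ⟨(B.toDual hB).symm (b.coord i), LinearMap.ext fun v ↦ by
      rw [← LinearMap.BilinForm.toDual_def hB, LinearEquiv.apply_symm_apply]⟩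
  choose w hw using h1
  have h2 : ∀ α, exteriorPower.ιMultiDual ℝ 2 b s α = bivectorForm B
      (wedge (w (Set.powersetCard.ofFinEmbEquiv.symm s 0))
        (w (Set.powersetCard.ofFinEmbEquiv.symm s 1))) α := by
    intro α
    rw [exteriorPower.ιMultiDual, bivectorForm, LinearMap.comp_apply, wedge,
      exteriorPower.map_apply_ιMulti, exteriorPower.ιMulti_family]
    congr 3
    ext1 i
    fin_cases i <;> simp [hw]
  rw [h2, h2, bivectorForm_symm hs, h, bivectorForm_symm hs]

theorem bivectorForm_nondegenerate [FiniteDimensional ℝ W] {B : LinearMap.BilinForm ℝ W}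
    (hs : ∀ a b, B a b = B b a) (hB : B.Nondegenerate) : (bivectorForm B).Nondegenerate := by
  have h : ∀ α, (∀ β, bivectorForm B α β = 0) → α = 0 := fun α hα ↦
    bivectorForm_ext hs hB fun c d ↦ by rw [hα, map_zero, LinearMap.zero_apply]
  exact ⟨h, fun α hα ↦ h α fun β ↦ by rw [bivectorForm_symm hs]; exact hα β⟩

/-- The bilinear form `(a ∧ b, c ∧ d) ↦ f(a, b, c, d)` on bivectors. -/
def volumePairing (f : W [⋀^Fin 4]→ₗ[ℝ] ℝ) : LinearMap.BilinForm ℝ (⋀[ℝ]^2 W) :=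
  ((LinearMap.mul ℝ (ExteriorAlgebra ℝ W)).compl₁₂ (Submodule.subtype _)
    (Submodule.subtype _)).compr₂ (ExteriorAlgebra.liftAlternating fun n ↦
      if h : n = 4 then f.domDomCongr (finCongr h.symm) else 0)

theorem volumePairing_wedge (f : W [⋀^Fin 4]→ₗ[ℝ] ℝ) (a b c d : W) :
    volumePairing f (wedge a b) (wedge c d) = f ![a, b, c, d] := by
  simp only [volumePairing, LinearMap.compr₂_apply, LinearMap.compl₁₂_apply, LinearMap.mul_apply',
    Submodule.subtype_apply, wedge, exteriorPower.ιMulti_apply_coe]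
  have h : ExteriorAlgebra.ιMulti ℝ 2 ![a, b] * ExteriorAlgebra.ιMulti ℝ 2 ![c, d] =
      ExteriorAlgebra.ιMulti ℝ 4 ![a, b, c, d] := by
    simp [ExteriorAlgebra.ιMulti_apply, mul_assoc]
  rw [h, ExteriorAlgebra.liftAlternating_apply_ιMulti]
  rfl

end Exterior

section Hodge

variable {W : Type*} [AddCommGroup W] [Module ℝ W] {B : LinearMap.BilinForm ℝ W}
  {e e' : Basis (Fin 4) ℝ W} {o : Orientation ℝ W (Fin 4)}

theorem IsOrthonormal.sq_eq_one (he : IsOrthonormal B e) (i : Fin 4) :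
    B (e i) (e i) * B (e i) (e i) = 1 := by
  rcases he.2 i with h | h <;> rw [h] <;> norm_num

theorem IsOrthonormal.apply (he : IsOrthonormal B e) (i : Fin 4) (c : W) :
    B (e i) c = B (e i) (e i) * e.repr c i := by
  conv_lhs => rw [← e.sum_repr c, map_sum]
  rw [Finset.sum_eq_single i]
  · rw [map_smul, smul_eq_mul, mul_comm]
  · intro j _ hj
    rw [map_smul, he.1 i j hj.symm, smul_zero]
  · simp

theorem IsOrthonormal.reindex (he : IsOrthonormal B e) (σ : Equiv.Perm (Fin 4)) :
    IsOrthonormal B (e.reindex σ) :=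
  ⟨fun i j hij ↦ by
    simpa using he.1 _ _ fun h ↦ hij (σ.symm.injective h), fun i ↦ by simpa using he.2 _⟩

theorem det_reindex_of_sign {σ : Equiv.Perm (Fin 4)} (hσ : Equiv.Perm.sign σ = 1) :
    (e.reindex σ).det = e.det := by
  ext v
  rw [Basis.det_reindex, AlternatingMap.map_perm, hσ, one_smul]

theorem orientation_reindex_of_sign {σ : Equiv.Perm (Fin 4)} (hσ : Equiv.Perm.sign σ = 1) :
    (e.reindex σ).orientation = e.orientation := by
  rw [Basis.orientation, Basis.orientation, ray_eq_iff, det_reindex_of_sign hσ]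
  exact SameRay.refl _

theorem IsOrthonormal.bivectorForm_eq_det (he : IsOrthonormal B e) (c d : W) :
    bivectorForm B ((B (e 2) (e 2) * B (e 3) (e 3)) • wedge (e 2) (e 3)) (wedge c d) =
      e.det ![e 0, e 1, c, d] := by
  rw [map_smul, LinearMap.smul_apply, bivectorForm_wedge, he.apply 2 c, he.apply 2 d,
    he.apply 3 c, he.apply 3 d, Basis.det_apply, Matrix.det_succ_column_zero]
  simp [Basis.toMatrix_apply, Matrix.det_fin_three, Fin.succAbove,
    Finsupp.single_apply]
  have h2 := he.sq_eq_one 2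
  have h3 := he.sq_eq_one 3
  linear_combination (e.repr c 2 * e.repr d 3 - e.repr d 2 * e.repr c 3) *
    (B (e 3) (e 3) * B (e 3) (e 3) * h2 + h3)

theorem IsOrthonormal.det_eq (he : IsOrthonormal B e) (he' : IsOrthonormal B e')
    (h : e.orientation = e'.orientation) : e.det = e'.det := by
  have hpos : 0 < e.det e' := (e.orientation_eq_iff_det_pos e').1 h
  have hd : ∀ {e : Basis (Fin 4) ℝ W}, IsOrthonormal B e →
      (LinearMap.BilinForm.toMatrix e B).det * (LinearMap.BilinForm.toMatrix e B).det = 1 := by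
    intro e he
    have h1 : LinearMap.BilinForm.toMatrix e B = Matrix.diagonal fun i ↦ B (e i) (e i) := by
      ext i j
      rw [LinearMap.BilinForm.toMatrix_apply, Matrix.diagonal_apply]
      split_ifs with hij
      · rw [hij]
      · exact he.1 i j hij
    rw [h1, Matrix.det_diagonal, ← Finset.prod_mul_distrib]
    exact Finset.prod_eq_one fun i _ ↦ he.sq_eq_one i
  have h2 := congrArg Matrix.det (LinearMap.BilinForm.toMatrix_mul_basis_toMatrix e e' B)
  rw [Matrix.det_mul, Matrix.det_mul, Matrix.det_transpose, ← Basis.det_apply] at h2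
  have h3 : (e.det e') ^ 4 = 1 := by
    have h4 := hd he'
    rw [← h2] at h4
    have h5 := hd he
    linear_combination h4 - (e.det e') ^ 4 * h5
  have h6 : e.det e' = 1 := (pow_eq_one_iff_of_nonneg hpos.le (by norm_num)).1 h3
  have h7 := AlternatingMap.eq_smul_basis_det e' e.det
  rw [h6, one_smul] at h7
  exact h7

theorem exists_even_perm : ∀ i j : Fin 4, i ≠ j →
    ∃ σ : Equiv.Perm (Fin 4), Equiv.Perm.sign σ = 1 ∧ σ.symm 0 = i ∧ σ.symm 1 = j := by
  decide

theorem IsHodgeStar.bivectorForm_eq {S : End ℝ (⋀[ℝ]^2 W)} (hS : IsHodgeStar B o S)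
    (he : IsOrthonormal B e) (ho : e.orientation = o) (α β : ⋀[ℝ]^2 W) :
    bivectorForm B (S α) β = volumePairing e.det α β := by
  have h : bivectorForm B ∘ₗ S = volumePairing e.det := by
    refine linearMap_ext_wedge_basis e fun i j hij ↦ linearMap_ext_wedge fun c d ↦ ?_
    obtain ⟨σ, hσ, rfl, rfl⟩ := exists_even_perm i j hij
    have h1 := hS (e.reindex σ) (he.reindex σ) ((orientation_reindex_of_sign hσ).trans ho)
    have h2 := (he.reindex σ).bivectorForm_eq_det c d
    rw [← h1, det_reindex_of_sign hσ] at h2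
    rw [volumePairing_wedge, LinearMap.comp_apply]
    simpa using h2
  exact congr($h α β)

theorem exists_isHodgeStar [FiniteDimensional ℝ W] (hs : ∀ a b, B a b = B b a)
    (hB : B.Nondegenerate) (he : IsOrthonormal B e) (ho : e.orientation = o) :
    ∃ S, IsHodgeStar B o S := by
  have hΛ := bivectorForm_nondegenerate hs hB
  refine ⟨((bivectorForm B).toDual hΛ).symm.toLinearMap ∘ₗ volumePairing e.det,
    fun e' he' ho' ↦ bivectorForm_ext hs hB fun c d ↦ ?_⟩
  rw [he'.bivectorForm_eq_det, ← he.det_eq he' (ho.trans ho'.symm), ← volumePairing_wedge]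
  exact LinearMap.BilinForm.apply_toDual_symm_apply (hB := hΛ) _ _

theorem IsHodgeStar.sq_eq {S : End ℝ (⋀[ℝ]^2 W)} (hS : IsHodgeStar B o S)
    (he : IsOrthonormal B e) (ho : e.orientation = o) :
    S * S = (∏ i, B (e i) (e i)) • 1 := by
  refine linearMap_ext_wedge_basis e fun i j hij ↦ ?_
  obtain ⟨σ, hσ, rfl, rfl⟩ := exists_even_perm i j hij
  have key : ∀ f : Basis (Fin 4) ℝ W, IsOrthonormal B f → f.orientation = o →
      S (S (wedge (f 0) (f 1))) = (∏ i, B (f i) (f i)) • wedge (f 0) (f 1) := by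
    intro f hf hfo
    let τ : Equiv.Perm (Fin 4) := finRotate 4 * finRotate 4
    have hτ : Equiv.Perm.sign τ = 1 := by decide
    have h1 := hS _ (hf.reindex τ) ((orientation_reindex_of_sign hτ).trans hfo)
    have h0 : τ.symm 0 = 2 := by decide
    have h1' : τ.symm 1 = 3 := by decide
    have h2 : τ.symm 2 = 0 := by decide
    have h3 : τ.symm 3 = 1 := by decide
    simp only [Basis.reindex_apply, h0, h1', h2, h3] at h1
    rw [hS f hf hfo, map_smul, h1, smul_smul, Fin.prod_univ_four]
    congr 1
    ring
  have h := key _ (he.reindex σ) ((orientation_reindex_of_sign hσ).trans ho)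
  simp only [Basis.reindex_apply] at h
  rw [Equiv.prod_comp σ.symm (fun i ↦ B (e i) (e i))] at h
  exact h

/-- An orthonormal basis can be adjusted to any orientation by changing signs. -/
theorem IsOrthonormal.adjust (he : IsOrthonormal B e) (o : Orientation ℝ W (Fin 4)) :
    ∃ e' : Basis (Fin 4) ℝ W, IsOrthonormal B e' ∧ e'.orientation = o ∧
      ∀ i, B (e' i) (e' i) = B (e i) (e i) := by
  have h := e.adjustToOrientation_apply_eq_or_eq_neg o
  have h1 : ∀ i, B (e.adjustToOrientation o i) (e.adjustToOrientation o i) = B (e i) (e i) := by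
    intro i
    rcases h i with h | h <;> simp [h]
  refine ⟨e.adjustToOrientation o, ⟨fun i j hij ↦ ?_, fun i ↦ ?_⟩,
    e.orientation_adjustToOrientation o, h1⟩
  · rcases h i with hi | hi <;> rcases h j with hj | hj <;> rw [hi, hj] <;> simp [he.1 i j hij]
  · rw [h1]
    exact he.2 i

end Hodge

section Diagonalization

theorem IsDiagonalizableWith.of_eigenvectors {W : Type*} [AddCommGroup W] [Module ℂ W]
    (hW : finrank ℂ W = 3) {T : End ℂ W} {μ : Fin 3 → ℂ} (hμ : Function.Injective μ)
    {w : Fin 3 → W} (hw : ∀ k, w k ≠ 0) (hT : ∀ k, T (w k) = μ k • w k) :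
    IsDiagonalizableWith T μ := by
  have h : LinearIndependent ℂ w := End.eigenvectors_linearIndependent' T μ hμ w
    fun k ↦ ⟨End.mem_eigenspace_iff.2 (hT k), hw k⟩
  refine ⟨basisOfLinearIndependentOfCardEqFinrank h (by simp [hW]), fun k ↦ ?_⟩
  rw [coe_basisOfLinearIndependentOfCardEqFinrank, hT]

variable {W : Type*} [AddCommGroup W] [Module ℝ W]

theorem IsStarDiagonalizableWith.of_eigenvectors [FiniteDimensional ℝ W] (hW : finrank ℝ W = 6)
    {S A : End ℝ W} {μ : Fin 3 → ℂ} (hμ : Function.Injective μ) (hS : S * S = -1)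
    (hA : ∀ w, A (S w) = S (A w)) {w : Fin 3 → W} (hw : ∀ k, w k ≠ 0)
    (hT : ∀ k, A (w k) = (μ k).re • w k + (μ k).im • S (w k)) :
    IsStarDiagonalizableWith S A μ := by
  refine ⟨hS, ?_⟩
  let _ : Module ℂ W := complexModule S hS
  have hsmul : ∀ (z : ℂ) (w : W), z • w = z.re • w + z.im • S w := by
    intro z w
    change (Complex.lift ⟨S, hS⟩ : ℂ →ₐ[ℝ] End ℝ W) z w = _
    rw [Complex.lift_apply, Complex.liftAux_apply]
    simp [Algebra.algebraMap_eq_smul_one]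
  have : IsScalarTower ℝ ℂ W := ⟨fun r z w ↦ by
    rw [hsmul, hsmul]
    simp [mul_smul]⟩
  have h3 : finrank ℂ W = 3 := by
    have := Module.finrank_mul_finrank ℝ ℂ W
    rw [hW, Complex.finrank_real_complex] at this
    omega
  let A' : End ℂ W :=
    { toFun := A
      map_add' := map_add A
      map_smul' := fun z w ↦ by
        rw [hsmul, map_add, map_smul, map_smul, hA, RingHom.id_apply, hsmul] }
  exact ⟨A', fun _ ↦ rfl, IsDiagonalizableWith.of_eigenvectors h3 hμ hw fun k ↦ by
    rw [hsmul]; exact hT k⟩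

theorem tmul_add_I_tmul_ne_zero {x : W} (y : W) (hx : x ≠ 0) :
    (1 : ℂ) ⊗ₜ[ℝ] x + Complex.I ⊗ₜ[ℝ] y ≠ 0 := by
  intro h
  obtain ⟨f, hf⟩ : ∃ f : Module.Dual ℝ W, f x ≠ 0 := by
    by_contra! hcon
    exact hx ((Module.forall_dual_apply_eq_zero_iff ℝ x).1 hcon)
  have h1 := congrArg (TensorProduct.rid ℝ ℂ) (congrArg (f.lTensor ℂ) h)
  simp only [map_add, LinearMap.lTensor_tmul, TensorProduct.rid_tmul, map_zero] at h1
  have h2 := congrArg Complex.re h1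
  simp at h2
  exact hf h2

theorem IsSelfDualDiagonalizableWith.of_eigenvectors [FiniteDimensional ℝ W]
    {S A : End ℝ W} {μ : Fin 3 → ℂ} (hμ : Function.Injective μ)
    (hW : finrank ℝ (End.eigenspace S 1) = 3)
    (hA : ∀ w, A (S w) = S (A w)) {x y : Fin 3 → W} (hx : ∀ k, x k ≠ 0)
    (hSx : ∀ k, S (x k) = x k) (hSy : ∀ k, S (y k) = y k)
    (hTx : ∀ k, A (x k) = (μ k).re • x k - (μ k).im • y k)
    (hTy : ∀ k, A (y k) = (μ k).im • x k + (μ k).re • y k) :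
    IsSelfDualDiagonalizableWith S A μ := by
  have hinv : ∀ w ∈ End.eigenspace S 1, A w ∈ End.eigenspace S 1 := by
    intro w hw
    rw [End.mem_eigenspace_iff, one_smul] at hw ⊢
    rw [← hA, hw]
  refine ⟨hinv, ?_⟩
  have hmem : ∀ {w}, S w = w → w ∈ End.eigenspace S 1 := fun h ↦ by
    rw [End.mem_eigenspace_iff, one_smul, h]
  let x' : Fin 3 → End.eigenspace S 1 := fun k ↦ ⟨x k, hmem (hSx k)⟩
  let y' : Fin 3 → End.eigenspace S 1 := fun k ↦ ⟨y k, hmem (hSy k)⟩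
  refine IsDiagonalizableWith.of_eigenvectors ?_ hμ
    (w := fun k ↦ (1 : ℂ) ⊗ₜ[ℝ] x' k + Complex.I ⊗ₜ[ℝ] y' k) ?_ ?_
  · rw [Module.finrank_baseChange, hW]
  · exact fun k ↦ tmul_add_I_tmul_ne_zero _ fun h ↦ hx k (congrArg Subtype.val h)
  · intro k
    have h1 : A.restrict hinv (x' k) = (μ k).re • x' k - (μ k).im • y' k :=
      Subtype.ext (hTx k)
    have h2 : A.restrict hinv (y' k) = (μ k).im • x' k + (μ k).re • y' k :=
      Subtype.ext (hTy k)
    rw [map_add, LinearMap.baseChange_tmul, LinearMap.baseChange_tmul, h1, h2,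
      TensorProduct.tmul_sub, TensorProduct.tmul_add, smul_add, TensorProduct.smul_tmul',
      TensorProduct.smul_tmul', ← TensorProduct.smul_tmul, ← TensorProduct.smul_tmul,
      ← TensorProduct.smul_tmul, ← TensorProduct.smul_tmul]
    have h3 : μ k • (1 : ℂ) = (μ k).re • (1 : ℂ) + (μ k).im • Complex.I := by
      apply Complex.ext <;> simp
    have h4 : μ k • Complex.I = (μ k).re • Complex.I - (μ k).im • (1 : ℂ) := by
      apply Complex.ext <;> simp
    rw [h3, h4, TensorProduct.add_tmul, TensorProduct.sub_tmul]
    abel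

theorem cubeRootTriple_injective {l : ℝ} (hl : l ≠ 0) :
    Function.Injective (cubeRootTriple l) := by
  have hl' : (l : ℂ) ≠ 0 := by exact_mod_cast hl
  have him : q.im ≠ 0 := fun h ↦ by
    have := q_im_sq
    norm_num [h] at this
  have h1 : q ≠ 1 := fun h ↦ him (by simp [h])
  have h0 : q ≠ 0 := fun h ↦ him (by simp [h])
  have h2 : q ^ 2 ≠ 1 := fun h ↦ h1 (by linear_combination q_cube - q * h)
  have h3 : q ^ 2 ≠ q := fun h ↦ h1 (mul_left_cancel₀ h0 (by linear_combination h))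
  intro i j hij
  fin_cases i <;> fin_cases j <;> simp [cubeRootTriple, hl', h1, h2, h3,
    h3.symm] at hij ⊢

theorem isComplexDiagonalizable_of_cube {A : End ℝ W} {l : ℝ} (hl : l ≠ 0)
    (hA : ∀ w, A (A (A w)) = l ^ 3 • w) : IsComplexDiagonalizable A := by
  have hl' : (l : ℂ) ≠ 0 := by exact_mod_cast hl
  set T : End ℂ (ℂ ⊗[ℝ] W) := A.baseChange ℂ with hTdef
  have hT : ∀ w, T (T (T w)) = (l : ℂ) ^ 3 • w := by
    intro w
    induction w with
    | zero => simp
    | tmul z w =>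
      simp only [hTdef, LinearMap.baseChange_tmul, hA]
      rw [← TensorProduct.smul_tmul, TensorProduct.smul_tmul']
      congr 1
      rw [Complex.real_smul, smul_eq_mul]
      push_cast
      rfl
    | add x y hx hy => simp only [map_add, hx, hy, smul_add]
  rw [IsComplexDiagonalizable, eq_top_iff]
  rintro w -
  have key : ∀ μ : ℂ, μ ^ 3 = (l : ℂ) ^ 3 → ∀ r : ℂ,
      r • (T (T w) + μ • T w + μ ^ 2 • w) ∈ ⨆ μ : ℂ, End.eigenspace T μ := by
    intro μ hμ r
    refine Submodule.smul_mem _ _ (Submodule.mem_iSup_of_mem μ ?_)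
    rw [End.mem_eigenspace_iff, map_add, map_add, map_smul, map_smul, hT, ← hμ]
    module
  have h1 := key l rfl (1 / (3 * l ^ 2))
  have h2 := key (l * q) (by rw [mul_pow, q_cube, mul_one]) (q / (3 * l ^ 2))
  have h3 := key (l * q ^ 2) (by rw [mul_pow, ← pow_mul, mul_comm 2 3, pow_mul, q_cube]; simp)
    (q ^ 2 / (3 * l ^ 2))
  have h4 := add_mem (add_mem h1 h2) h3
  convert h4 using 1
  have e1 : 1 + q + q ^ 2 = 0 := by linear_combination q_sq
  have e2 : 1 + q ^ 2 + q ^ 4 = 0 := by linear_combination q_sq + q * q_cube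
  have e3 : 1 + q ^ 3 + q ^ 6 = 3 := by linear_combination (q ^ 3 + 2) * q_cube
  have e4 : (1 / (3 * (l : ℂ) ^ 2)) • (T (T w) + (l : ℂ) • T w + (l : ℂ) ^ 2 • w)
      + (q / (3 * (l : ℂ) ^ 2)) • (T (T w) + ((l : ℂ) * q) • T w + ((l : ℂ) * q) ^ 2 • w)
      + (q ^ 2 / (3 * (l : ℂ) ^ 2)) •
        (T (T w) + ((l : ℂ) * q ^ 2) • T w + ((l : ℂ) * q ^ 2) ^ 2 • w) =
      ((1 + q + q ^ 2) * (1 / (3 * (l : ℂ) ^ 2))) • T (T w)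
      + ((1 + q ^ 2 + q ^ 4) * (l * (1 / (3 * (l : ℂ) ^ 2)))) • T w
      + ((1 + q ^ 3 + q ^ 6) * (l ^ 2 * (1 / (3 * (l : ℂ) ^ 2)))) • w := by
    module
  rw [e4, e1, e2, e3, zero_mul, zero_mul, zero_smul, zero_smul, zero_add, zero_add]
  rw [show (3 : ℂ) * (l ^ 2 * (1 / (3 * (l : ℂ) ^ 2))) = 1 by field_simp, one_smul]

end Diagonalization

section CurvatureOperator

variable {W : Type*} [AddCommGroup W] [Module ℝ W] (L : ((ℂ × ℝ) × ℝ) ≃ₗ[ℝ] W) {ε δ p : ℝ}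
  {B : LinearMap.BilinForm ℝ W}

theorem linearMap_ext_wedge_split {N : Type*} [AddCommGroup N] [Module ℝ N]
    {f g : ⋀[ℝ]^2 W →ₗ[ℝ] N}
    (hu : ∀ v, f (wedge (L (0, 1)) (L (v, 0))) = g (wedge (L (0, 1)) (L (v, 0))))
    (hv : ∀ v v', f (wedge (L (v, 0)) (L (v', 0))) = g (wedge (L (v, 0)) (L (v', 0)))) :
    f = g := by
  refine linearMap_ext_wedge fun a b ↦ ?_
  have h1 : ∀ a : W, a = L ((L.symm a).1, 0) + (L.symm a).2 • L (0, 1) := by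
    intro a
    rw [← map_smul, ← map_add]
    simp
  rw [h1 a, h1 b]
  simp only [wedge_add_left, wedge_add_right, wedge_smul_left, wedge_smul_right, map_add, map_smul,
    wedge_self, smul_zero, add_zero, hu, hv]
  rw [wedge_swap (L ((L.symm a).1, 0)) (L (0, 1)), map_neg, map_neg, hu]

/-- The linear operator `v + ru ↦ fv + kru`. -/
def splitOp (f : ℂ × ℝ →ₗ[ℝ] ℂ × ℝ) (k : ℝ) : W →ₗ[ℝ] W :=
  L.toLinearMap ∘ₗ f.prodMap (k • LinearMap.id) ∘ₗ L.symm.toLinearMap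

theorem splitOp_apply (f : ℂ × ℝ →ₗ[ℝ] ℂ × ℝ) (k : ℝ) (a : (ℂ × ℝ) × ℝ) :
    splitOp L f k (L a) = L (f a.1, k * a.2) := by
  simp [splitOp]

theorem splitOp_selfAdjoint (hB : ∀ a b, B (L a) (L b) = totalForm ε δ a b)
    {f : ℂ × ℝ →ₗ[ℝ] ℂ × ℝ} (hf : ∀ v w, exampleForm ε (f v) w = exampleForm ε v (f w)) (k : ℝ)
    (a b : W) : B (splitOp L f k a) b = B a (splitOp L f k b) := by
  obtain ⟨a, rfl⟩ := L.surjective a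
  obtain ⟨b, rfl⟩ := L.surjective b
  rw [splitOp_apply, splitOp_apply, hB, hB, totalForm_apply, totalForm_apply, hf]
  ring

theorem bivectorForm_map {f : W →ₗ[ℝ] W} (hf : ∀ a b, B (f a) b = B a (f b)) (α β : ⋀[ℝ]^2 W) :
    bivectorForm B (exteriorPower.map 2 f α) β = bivectorForm B α (exteriorPower.map 2 f β) := by
  have h : bivectorForm B ∘ₗ exteriorPower.map 2 f =
      (bivectorForm B).compl₂ (exteriorPower.map 2 f) := by
    refine linearMap_ext_wedge fun a b ↦ linearMap_ext_wedge fun c d ↦ ?_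
    change bivectorForm B (exteriorPower.map 2 f (wedge a b)) (wedge c d) =
      bivectorForm B (wedge a b) (exteriorPower.map 2 f (wedge c d))
    rw [map_wedge, map_wedge, bivectorForm_wedge, bivectorForm_wedge, hf, hf, hf, hf]
  exact congr($h α β)

/-- The operator on bivectors with `v ∧ v' ↦ -δ Fv ∧ Fv'` and `u ∧ v ↦ -δ u ∧ F²v`. -/
def curvOp (δ p : ℝ) : End ℝ (⋀[ℝ]^2 W) :=
  -δ • (exteriorPower.map 2 (splitOp L (exampleOperator p) 0)
    + exteriorPower.map 2 (splitOp L (exampleOperator p ∘ₗ exampleOperator p) 1)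
    - exteriorPower.map 2 (splitOp L (exampleOperator p ∘ₗ exampleOperator p) 0))

theorem curvOp_wedge (a b : (ℂ × ℝ) × ℝ) : curvOp L δ p (wedge (L a) (L b)) =
    -δ • (wedge (L (exampleOperator p a.1, 0)) (L (exampleOperator p b.1, 0))
      + wedge (L (exampleOperator p (exampleOperator p a.1), a.2))
          (L (exampleOperator p (exampleOperator p b.1), b.2))
      - wedge (L (exampleOperator p (exampleOperator p a.1), 0))
          (L (exampleOperator p (exampleOperator p b.1), 0))) := by
  simp [curvOp, map_wedge, splitOp_apply]
  exact (neg_smul _ _).symm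

theorem curvOp_wedge_left (v : ℂ × ℝ) : curvOp L δ p (wedge (L (0, 1)) (L (v, 0))) =
    -δ • wedge (L (0, 1)) (L (exampleOperator p (exampleOperator p v), 0)) := by
  rw [curvOp_wedge]
  simp only [map_zero]
  rw [show ((0 : ℂ × ℝ), (0 : ℝ)) = 0 from rfl, map_zero, ← zero_smul ℝ (0 : W), wedge_smul_left,
    wedge_smul_left]
  simp

theorem curvOp_wedge_base (v v' : ℂ × ℝ) : curvOp L δ p (wedge (L (v, 0)) (L (v', 0))) =
    -δ • wedge (L (exampleOperator p v, 0)) (L (exampleOperator p v', 0)) := by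
  rw [curvOp_wedge, add_sub_cancel_right]

theorem curvOp_selfAdjoint (hB : ∀ a b, B (L a) (L b) = totalForm ε δ a b) (α β : ⋀[ℝ]^2 W) :
    bivectorForm B (curvOp L δ p α) β = bivectorForm B α (curvOp L δ p β) := by
  have h1 := exampleForm_operator ε p
  have h2 : ∀ v w, exampleForm ε ((exampleOperator p ∘ₗ exampleOperator p) v) w =
      exampleForm ε v ((exampleOperator p ∘ₗ exampleOperator p) w) := fun v w ↦ by
    simp [h1]
  simp only [curvOp, LinearMap.smul_apply, LinearMap.add_apply, LinearMap.sub_apply, map_smul,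
    map_add, map_sub, bivectorForm_map (splitOp_selfAdjoint L hB h1 _),
    bivectorForm_map (splitOp_selfAdjoint L hB h2 _)]

theorem isCurvatureOperator_curvOp (hδ : δ * δ = 1)
    (hB : ∀ a b, B (L a) (L b) = totalForm ε δ a b) {R : W →ₗ[ℝ] W →ₗ[ℝ] W →ₗ[ℝ] W}
    (hR : ∀ a b d, R (L a) (L b) (L d) = L (curv ε δ p a b d)) :
    IsCurvatureOperator B R (curvOp L δ p) := by
  intro a b c d
  obtain ⟨a, rfl⟩ := L.surjective a
  obtain ⟨b, rfl⟩ := L.surjective b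
  obtain ⟨c, rfl⟩ := L.surjective c
  obtain ⟨d, rfl⟩ := L.surjective d
  rw [hR, hB, curvOp_wedge, curv_apply]
  simp only [map_smul, map_add, map_sub, LinearMap.smul_apply, LinearMap.add_apply,
    LinearMap.sub_apply, bivectorForm_wedge, hB, totalForm_apply, smul_eq_mul]
  linear_combination
    (c.2 * b.2 * exampleForm ε (exampleOperator p (exampleOperator p a.1)) d.1
      - c.2 * a.2 * exampleForm ε (exampleOperator p (exampleOperator p b.1)) d.1) * hδ

theorem IsCurvatureOperator.unique [FiniteDimensional ℝ W] (hs : ∀ a b, B a b = B b a)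
    (hB : B.Nondegenerate) {R : W →ₗ[ℝ] W →ₗ[ℝ] W →ₗ[ℝ] W} {A A' : End ℝ (⋀[ℝ]^2 W)}
    (hA : IsCurvatureOperator B R A) (hA' : IsCurvatureOperator B R A') : A = A' :=
  linearMap_ext_wedge fun a b ↦ bivectorForm_ext hs hB fun c d ↦ by rw [hA, hA']

theorem curvOp_cube (α : ⋀[ℝ]^2 W) :
    curvOp L δ p (curvOp L δ p (curvOp L δ p α)) = (-δ * p ^ 2) ^ 3 • α := by
  have h : curvOp L δ p ∘ₗ curvOp L δ p ∘ₗ curvOp L δ p = (-δ * p ^ 2) ^ 3 • LinearMap.id := by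
    have hL : ∀ (r : ℝ) (v : ℂ × ℝ), L (r • v, 0) = r • L (v, 0) := fun r v ↦ by
      rw [← map_smul]; simp
    refine linearMap_ext_wedge_split L (fun v ↦ ?_) fun v v' ↦ ?_
    · simp only [LinearMap.comp_apply, curvOp_wedge_left, map_smul, exampleOperator_cube, hL,
        wedge_smul_right, LinearMap.smul_apply, LinearMap.id_apply]
      module
    · simp only [LinearMap.comp_apply, curvOp_wedge_base, map_smul, exampleOperator_cube, hL,
        wedge_smul_right, wedge_smul_left, LinearMap.smul_apply, LinearMap.id_apply]
      module
  exact congr($h α)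

end CurvatureOperator

section StarSpectrum

/-- Real coordinates on `(ℂ × ℝ) × ℝ`. -/
def coordinates : ((ℂ × ℝ) × ℝ) ≃ₗ[ℝ] (Fin 4 → ℝ) where
  toFun a := ![a.1.1.re, a.1.1.im, a.1.2, a.2]
  map_add' a b := by ext i; fin_cases i <;> simp
  map_smul' r a := by ext i; fin_cases i <;> simp
  invFun c := ((⟨c 0, c 1⟩, c 2), c 3)
  left_inv a := by simp
  right_inv c := by ext i; fin_cases i <;> simp

variable {W : Type*} [AddCommGroup W] [Module ℝ W] (L : ((ℂ × ℝ) × ℝ) ≃ₗ[ℝ] W) {ε δ p : ℝ}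
  {B : LinearMap.BilinForm ℝ W}

theorem alternating_eq_det (f : W [⋀^Fin 4]→ₗ[ℝ] ℝ) : ∃ k : ℝ, ∀ a b c d : (ℂ × ℝ) × ℝ,
    f ![L a, L b, L c, L d] = k * Matrix.det !![a.1.1.re, b.1.1.re, c.1.1.re, d.1.1.re;
      a.1.1.im, b.1.1.im, c.1.1.im, d.1.1.im; a.1.2, b.1.2, c.1.2, d.1.2; a.2, b.2, c.2, d.2] := by
  let e : Basis (Fin 4) ℝ W := Basis.ofEquivFun (L.symm.trans coordinates)
  refine ⟨f e, fun a b c d ↦ ?_⟩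
  conv_lhs => rw [AlternatingMap.eq_smul_basis_det e f]
  rw [AlternatingMap.smul_apply, Basis.det_apply, smul_eq_mul]
  congr 2
  ext i j
  fin_cases i <;> fin_cases j <;> simp [e, Basis.toMatrix_apply, coordinates]

theorem det_four {a₀ a₁ a₂ a₃ b₀ b₁ b₂ b₃ c₀ c₁ c₂ c₃ d₀ d₁ d₂ d₃ : ℝ} :
    Matrix.det !![a₀, b₀, c₀, d₀; a₁, b₁, c₁, d₁; a₂, b₂, c₂, d₂; a₃, b₃, c₃, d₃] =
      a₀ * (b₁ * (c₂ * d₃ - c₃ * d₂) - c₁ * (b₂ * d₃ - b₃ * d₂) + d₁ * (b₂ * c₃ - b₃ * c₂))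
      - b₀ * (a₁ * (c₂ * d₃ - c₃ * d₂) - c₁ * (a₂ * d₃ - a₃ * d₂) + d₁ * (a₂ * c₃ - a₃ * c₂))
      + c₀ * (a₁ * (b₂ * d₃ - b₃ * d₂) - b₁ * (a₂ * d₃ - a₃ * d₂) + d₁ * (a₂ * b₃ - a₃ * b₂))
      - d₀ * (a₁ * (b₂ * c₃ - b₃ * c₂) - b₁ * (a₂ * c₃ - a₃ * c₂) + c₁ * (a₂ * b₃ - a₃ * b₂)) := by
  rw [Matrix.det_succ_row_zero]
  simp [Fin.sum_univ_succ, Matrix.det_fin_three, Fin.succAbove]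
  ring

theorem alternating_operator (f : W [⋀^Fin 4]→ₗ[ℝ] ℝ) (v c d : ℂ × ℝ) :
    f ![L (0, 1), L (v, 0), L (exampleOperator p c, 0), L (exampleOperator p d, 0)] =
      f ![L (0, 1), L (exampleOperator p (exampleOperator p v), 0), L (c, 0), L (d, 0)] := by
  obtain ⟨k, hk⟩ := alternating_eq_det L f
  rw [hk, hk, det_four, det_four]
  simp [exampleOperator_apply, q_re]
  left
  linear_combination p ^ 2 * (c.1.im * d.1.re * v.2 - c.1.re * d.1.im * v.2
    - v.1.re * c.1.im * d.2 + v.1.re * d.1.im * c.2 + c.1.re * d.2 * v.1.im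
    - d.1.re * c.2 * v.1.im) * q_im_sq

theorem alternating_base (f : W [⋀^Fin 4]→ₗ[ℝ] ℝ) (a b c d : ℂ × ℝ) :
    f ![L (a, 0), L (b, 0), L (c, 0), L (d, 0)] = 0 := by
  obtain ⟨k, hk⟩ := alternating_eq_det L f
  rw [hk, det_four]
  ring

theorem volumePairing_symm (f : W [⋀^Fin 4]→ₗ[ℝ] ℝ) (α β : ⋀[ℝ]^2 W) :
    volumePairing f α β = volumePairing f β α := by
  have h : volumePairing f = (volumePairing f).flip := by
    refine linearMap_ext_wedge fun a b ↦ linearMap_ext_wedge fun c d ↦ ?_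
    change _ = volumePairing f (wedge c d) (wedge a b)
    rw [volumePairing_wedge, volumePairing_wedge]
    have h1 := f.map_perm ![c, d, a, b] (finRotate 4 * finRotate 4)
    have h2 : Equiv.Perm.sign (finRotate 4 * finRotate 4) = 1 := by decide
    rw [h2, one_smul] at h1
    rw [← h1]
    congr 1
    ext i
    fin_cases i <;> rfl
  exact congr($h α β)

theorem bilinForm_adjoint_ext {P : LinearMap.BilinForm ℝ (⋀[ℝ]^2 W)} {A : End ℝ (⋀[ℝ]^2 W)}
    (huu : ∀ v w, P (A (wedge (L (0, 1)) (L (v, 0)))) (wedge (L (0, 1)) (L (w, 0))) =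
      P (wedge (L (0, 1)) (L (v, 0))) (A (wedge (L (0, 1)) (L (w, 0)))))
    (huv : ∀ v w w', P (A (wedge (L (0, 1)) (L (v, 0)))) (wedge (L (w, 0)) (L (w', 0))) =
      P (wedge (L (0, 1)) (L (v, 0))) (A (wedge (L (w, 0)) (L (w', 0)))))
    (hvu : ∀ v v' w, P (A (wedge (L (v, 0)) (L (v', 0)))) (wedge (L (0, 1)) (L (w, 0))) =
      P (wedge (L (v, 0)) (L (v', 0))) (A (wedge (L (0, 1)) (L (w, 0)))))
    (hvv : ∀ v v' w w', P (A (wedge (L (v, 0)) (L (v', 0)))) (wedge (L (w, 0)) (L (w', 0))) =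
      P (wedge (L (v, 0)) (L (v', 0))) (A (wedge (L (w, 0)) (L (w', 0))))) (α β : ⋀[ℝ]^2 W) :
    P (A α) β = P α (A β) := by
  have hu : ∀ v, P (A (wedge (L (0, 1)) (L (v, 0)))) = P (wedge (L (0, 1)) (L (v, 0))) ∘ₗ A :=
    fun v ↦ linearMap_ext_wedge_split L (huu v) (huv v)
  have hv : ∀ v v', P (A (wedge (L (v, 0)) (L (v', 0)))) =
      P (wedge (L (v, 0)) (L (v', 0))) ∘ₗ A :=
    fun v v' ↦ linearMap_ext_wedge_split L (hvu v v') (hvv v v')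
  have h : P.flip β ∘ₗ A = P.flip (A β) :=
    linearMap_ext_wedge_split L (fun v ↦ congr($(hu v) β)) fun v v' ↦ congr($(hv v v') β)
  exact congr($h α)

theorem volumePairing_curvOp (f : W [⋀^Fin 4]→ₗ[ℝ] ℝ) (α β : ⋀[ℝ]^2 W) :
    volumePairing f (curvOp L δ p α) β = volumePairing f α (curvOp L δ p β) := by
  have huu : ∀ v w : W, f ![L (0, 1), v, L (0, 1), w] = 0 := fun v w ↦
    f.map_eq_zero_of_eq _ (i := 0) (j := 2) rfl (by decide)
  have hs := volumePairing_symm f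
  have huv : ∀ v w w', volumePairing f (curvOp L δ p (wedge (L (0, 1)) (L (v, 0))))
      (wedge (L (w, 0)) (L (w', 0))) =
      volumePairing f (wedge (L (0, 1)) (L (v, 0))) (curvOp L δ p (wedge (L (w, 0)) (L (w', 0)))) :=
    fun v w w' ↦ by
      rw [curvOp_wedge_left, curvOp_wedge_base, map_smul, map_smul, LinearMap.smul_apply,
        volumePairing_wedge, volumePairing_wedge, alternating_operator]
  refine bilinForm_adjoint_ext L (fun v w ↦ ?_) huv (fun v v' w ↦ ?_) (fun v v' w w' ↦ ?_) α β
  · rw [curvOp_wedge_left, curvOp_wedge_left, map_smul, map_smul, LinearMap.smul_apply,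
      volumePairing_wedge, volumePairing_wedge, huu, huu]
  · exact (hs _ _).trans ((huv w v v').symm.trans (hs _ _))
  · rw [curvOp_wedge_base, curvOp_wedge_base, map_smul, map_smul, LinearMap.smul_apply,
      volumePairing_wedge, volumePairing_wedge, alternating_base, alternating_base]

theorem nondegenerate_of_totalForm (hε : ε ≠ 0) (hδ : δ ≠ 0)
    (hB : ∀ a b, B (L a) (L b) = totalForm ε δ a b) : B.Nondegenerate := by
  have h := totalForm_nondegenerate hε hδ
  refine ⟨fun a ha ↦ ?_, fun a ha ↦ ?_⟩
  · obtain ⟨a, rfl⟩ := L.surjective a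
    rw [h.1 a fun b ↦ by rw [← hB]; exact ha _, map_zero]
  · obtain ⟨a, rfl⟩ := L.surjective a
    rw [h.2 a fun b ↦ by rw [← hB]; exact ha _, map_zero]

theorem symm_of_totalForm (hB : ∀ a b, B (L a) (L b) = totalForm ε δ a b) (a b : W) :
    B a b = B b a := by
  obtain ⟨a, rfl⟩ := L.surjective a
  obtain ⟨b, rfl⟩ := L.surjective b
  rw [hB, hB, totalForm_symm]

theorem curvOp_comm_star (hε : ε ≠ 0) (hδ : δ ≠ 0)
    (hB : ∀ a b, B (L a) (L b) = totalForm ε δ a b) {f : W [⋀^Fin 4]→ₗ[ℝ] ℝ}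
    {S : End ℝ (⋀[ℝ]^2 W)} (hS : ∀ α β, bivectorForm B (S α) β = volumePairing f α β)
    (α : ⋀[ℝ]^2 W) : curvOp L δ p (S α) = S (curvOp L δ p α) := by
  have : FiniteDimensional ℝ W := L.finiteDimensional
  refine bivectorForm_ext (symm_of_totalForm L hB) (nondegenerate_of_totalForm L hε hδ hB)
    fun c d ↦ ?_
  rw [curvOp_selfAdjoint L hB, hS, hS, volumePairing_curvOp]

/-- A basis in which the form is diagonal, with the sign pattern `- + ε δ`. -/
theorem exists_diagonal_basis (hε : ε ≠ 0) (hδ : δ ≠ 0)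
    (hB : ∀ a b, B (L a) (L b) = totalForm ε δ a b) :
    ∃ b : Basis (Fin 4) ℝ W, ∀ i j, B (b i) (b j) = if i = j then ![-1, 1, ε, δ] i else 0 := by
  have : FiniteDimensional ℝ W := L.finiteDimensional
  let s : ℝ := √(1 / 2)
  have hs : s * s = 1 / 2 := Real.mul_self_sqrt (by norm_num)
  let w : Fin 4 → W := ![L ((⟨s, -s⟩, 0), 0), L ((⟨s, s⟩, 0), 0), L ((0, 1), 0), L (0, 1)]
  have hw : ∀ i j, B (w i) (w j) = if i = j then ![-1, 1, ε, δ] i else 0 := by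
    intro i j
    fin_cases i <;> fin_cases j <;>
      simp [w, hB, totalForm_apply, exampleForm_apply, hs] <;> norm_num
  have hli : LinearIndependent ℝ w := by
    refine LinearMap.BilinForm.linearIndependent_of_iIsOrtho (B := B) ?_ fun i ↦ ?_
    · intro i j hij
      change B (w i) (w j) = 0
      rw [hw, if_neg hij]
    · change B (w i) (w i) ≠ 0
      rw [hw, if_pos rfl]
      fin_cases i <;> simp [hε, hδ]
  refine ⟨basisOfLinearIndependentOfCardEqFinrank hli ?_, fun i j ↦ ?_⟩
  · rw [← L.finrank_eq, finrank_total, Fintype.card_fin]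
  · rw [coe_basisOfLinearIndependentOfCardEqFinrank, hw]

end StarSpectrum

section Spectrum

variable {W : Type*} [AddCommGroup W] [Module ℝ W] (L : ((ℂ × ℝ) × ℝ) ≃ₗ[ℝ] W) {ε δ p : ℝ}
  {B : LinearMap.BilinForm ℝ W}

/-- The map `v ↦ u ∧ v`. -/
def wedgeU : ℂ × ℝ →ₗ[ℝ] ⋀[ℝ]^2 W :=
  wedgeL (L (0, 1)) ∘ₗ L.toLinearMap ∘ₗ LinearMap.inl ℝ (ℂ × ℝ) ℝ

theorem wedgeU_apply (v : ℂ × ℝ) : wedgeU L v = wedge (L (0, 1)) (L (v, 0)) := rfl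

theorem curvOp_wedgeU (v : ℂ × ℝ) : curvOp L δ p (wedgeU L v) =
    -δ • wedgeU L (exampleOperator p (exampleOperator p v)) :=
  curvOp_wedge_left L v

theorem exampleOperator_sq (z : ℂ) (t : ℝ) :
    exampleOperator p (exampleOperator p (z, t)) = p ^ 2 • (q ^ 2 * z, t) := by
  rw [exampleOperator_apply, exampleOperator_apply]
  ext1
  · simp only [Prod.smul_fst, Complex.real_smul, Complex.ofReal_pow]
    ring
  · simp only [Prod.smul_snd, smul_eq_mul]
    ring

theorem curvOp_wedgeU_real :
    curvOp L δ p (wedgeU L (0, 1)) = (-δ * p ^ 2) • wedgeU L (0, 1) := by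
  rw [curvOp_wedgeU, exampleOperator_sq, map_smul, mul_zero, smul_smul]

theorem curvOp_wedgeU_one : curvOp L δ p (wedgeU L (1, 0)) =
    (-δ * p ^ 2) • ((-1 / 2 : ℝ) • wedgeU L (1, 0) - q.im • wedgeU L (Complex.I, 0)) := by
  have h : (q ^ 2 * 1, (0 : ℝ)) =
      (-1 / 2 : ℝ) • ((1 : ℂ), (0 : ℝ)) - q.im • (Complex.I, (0 : ℝ)) := by
    refine Prod.ext (Complex.ext ?_ ?_) ?_ <;> norm_num [q_sq, q_re]
  rw [curvOp_wedgeU, exampleOperator_sq, map_smul, h, map_sub, map_smul, map_smul, smul_smul]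

theorem curvOp_wedgeU_I : curvOp L δ p (wedgeU L (Complex.I, 0)) =
    (-δ * p ^ 2) • (q.im • wedgeU L (1, 0) + (-1 / 2 : ℝ) • wedgeU L (Complex.I, 0)) := by
  have h : (q ^ 2 * Complex.I, (0 : ℝ)) =
      q.im • ((1 : ℂ), (0 : ℝ)) + (-1 / 2 : ℝ) • (Complex.I, (0 : ℝ)) := by
    refine Prod.ext (Complex.ext ?_ ?_) ?_ <;> norm_num [q_sq, q_re]
  rw [curvOp_wedgeU, exampleOperator_sq, map_smul, h, map_add, map_smul, map_smul, smul_smul]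

theorem eq_zero_of_wedgeU_add_star (hε : ε ≠ 0) (hδ : δ ≠ 0)
    (hB : ∀ a b, B (L a) (L b) = totalForm ε δ a b) {f : W [⋀^Fin 4]→ₗ[ℝ] ℝ}
    {S : End ℝ (⋀[ℝ]^2 W)} (hS : ∀ α β, bivectorForm B (S α) β = volumePairing f α β)
    {v v' : ℂ × ℝ} (h : wedgeU L v + S (wedgeU L v') = 0) : v = 0 := by
  have h1 : ∀ b, totalForm ε δ (v, 0) b = 0 := by
    intro b
    have h2 := congrArg (fun α ↦ bivectorForm B α (wedgeU L b.1)) h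
    have h3 : f ![L (0, 1), L (v', 0), L (0, 1), L (b.1, 0)] = 0 :=
      f.map_eq_zero_of_eq _ (i := 0) (j := 2) rfl (by decide)
    simp only [map_add, LinearMap.add_apply, map_zero, LinearMap.zero_apply, hS, wedgeU_apply,
      volumePairing_wedge, bivectorForm_wedge, hB, totalForm_apply, h3, add_zero] at h2
    have h4 : δ * exampleForm ε v b.1 = 0 := by simpa using h2
    rw [totalForm_apply, (mul_eq_zero.1 h4).resolve_left hδ]
    simp
  exact congrArg Prod.fst ((totalForm_nondegenerate hε hδ).1 (v, 0) h1)

theorem finrank_bivectors (L : ((ℂ × ℝ) × ℝ) ≃ₗ[ℝ] W) : finrank ℝ (⋀[ℝ]^2 W) = 6 := by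
  have : FiniteDimensional ℝ W := L.finiteDimensional
  rw [exteriorPower.finrank_eq, ← L.finrank_eq, finrank_total]
  rfl

theorem finrank_eigenspace_star (hε : ε ≠ 0) (hδ : δ ≠ 0)
    (hB : ∀ a b, B (L a) (L b) = totalForm ε δ a b) {f : W [⋀^Fin 4]→ₗ[ℝ] ℝ}
    {S : End ℝ (⋀[ℝ]^2 W)} (hS : ∀ α β, bivectorForm B (S α) β = volumePairing f α β)
    (hS2 : ∀ α, S (S α) = α) : finrank ℝ (End.eigenspace S 1) = 3 := by
  have : FiniteDimensional ℝ W := L.finiteDimensional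
  have h3 : finrank ℝ (ℂ × ℝ) = 3 := by simp
  have key : ∀ s : ℝ, s * s = 1 → 3 ≤ finrank ℝ (End.eigenspace S s) := by
    intro s hs
    let φ : ℂ × ℝ →ₗ[ℝ] End.eigenspace S s :=
      LinearMap.codRestrict _ (wedgeU L + s • (S ∘ₗ wedgeU L)) fun v ↦ by
        rw [End.mem_eigenspace_iff]
        simp only [LinearMap.add_apply, LinearMap.smul_apply, LinearMap.comp_apply, map_add,
          map_smul, hS2, smul_add, smul_smul, hs, one_smul]
        rw [add_comm]
    rw [← h3]
    refine LinearMap.finrank_le_finrank_of_injective (f := φ) ?_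
    rw [injective_iff_map_eq_zero]
    intro v hv
    have h1 : wedgeU L v + s • S (wedgeU L v) = 0 := congrArg Subtype.val hv
    rw [← map_smul, ← map_smul] at h1
    exact eq_zero_of_wedgeU_add_star L hε hδ hB hS h1
  have hd : Disjoint (End.eigenspace S 1) (End.eigenspace S (-1)) := by
    rw [Submodule.disjoint_def]
    intro w h1 h2
    rw [End.mem_eigenspace_iff] at h1 h2
    rw [h1, one_smul, neg_smul, one_smul] at h2
    have h3 : (2 : ℝ) • w = 0 := by rw [two_smul]; exact eq_neg_iff_add_eq_zero.1 h2
    exact (smul_eq_zero.1 h3).resolve_left two_ne_zero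
  have h1 := key 1 (by norm_num)
  have h2 := key (-1) (by norm_num)
  have h4 := Submodule.finrank_add_finrank_le_of_disjoint hd
  rw [finrank_bivectors L] at h4
  omega

variable {o : Orientation ℝ W (Fin 4)}

theorem exists_orthonormal (hε : ε = 1 ∨ ε = -1) (hδ : δ = 1 ∨ δ = -1)
    (hB : ∀ a b, B (L a) (L b) = totalForm ε δ a b) (o : Orientation ℝ W (Fin 4)) :
    ∃ e : Basis (Fin 4) ℝ W, IsOrthonormal B e ∧ e.orientation = o ∧
      ∏ i, B (e i) (e i) = -(ε * δ) := by
  have hε0 : ε ≠ 0 := by rcases hε with rfl | rfl <;> norm_num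
  have hδ0 : δ ≠ 0 := by rcases hδ with rfl | rfl <;> norm_num
  obtain ⟨b, hb⟩ := exists_diagonal_basis L hε0 hδ0 hB
  have hbo : IsOrthonormal B b := by
    refine ⟨fun i j hij ↦ by rw [hb, if_neg hij], fun i ↦ ?_⟩
    rw [hb, if_pos rfl]
    fin_cases i <;> simp [hε, hδ]
  obtain ⟨e, he, ho, hbe⟩ := hbo.adjust o
  refine ⟨e, he, ho, ?_⟩
  simp only [hbe, hb, if_true]
  simp [Fin.prod_univ_four]

theorem isStarDiagonalizableWith_curvOp (hp : p ≠ 0) (hε : ε = 1) (hδ : δ = 1)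
    (hB : ∀ a b, B (L a) (L b) = totalForm ε δ a b) {S : End ℝ (⋀[ℝ]^2 W)}
    (hS : IsHodgeStar B o S) :
    IsStarDiagonalizableWith S (curvOp L δ p) (cubeRootTriple (-δ * p ^ 2)) := by
  have : FiniteDimensional ℝ W := L.finiteDimensional
  have hε0 : ε ≠ 0 := by rw [hε]; norm_num
  have hδ0 : δ ≠ 0 := by rw [hδ]; norm_num
  obtain ⟨e, he, ho, hpr⟩ := exists_orthonormal L (.inl hε) (.inl hδ) hB o
  have hS' := hS.bivectorForm_eq he ho
  have hS2 : S * S = -1 := by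
    rw [hS.sq_eq he ho, hpr, hε, hδ, mul_one]
    exact (neg_smul (1 : ℝ) (1 : End ℝ (⋀[ℝ]^2 W))).trans (congrArg _ (one_smul _ _))
  have hS2' : ∀ α, S (S α) = -α := fun α ↦ congr($hS2 α)
  have hl : -δ * p ^ 2 ≠ 0 := by simp [hδ0, hp]
  have hc := curvOp_comm_star (p := p) L hε0 hδ0 hB hS'
  have ha := curvOp_wedgeU_one (δ := δ) (p := p) L
  have hb := curvOp_wedgeU_I (δ := δ) (p := p) L
  have hr := curvOp_wedgeU_real (δ := δ) (p := p) L
  set l := -δ * p ^ 2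
  clear_value l
  refine .of_eigenvectors (finrank_bivectors L) (cubeRootTriple_injective hl) hS2 hc
    (w := ![wedgeU L (0, 1), wedgeU L (1, 0) + S (wedgeU L (Complex.I, 0)),
      wedgeU L (1, 0) - S (wedgeU L (Complex.I, 0))]) ?_ ?_
  · intro k h
    fin_cases k
    · have h1 : wedgeU L (0, 1) + S (wedgeU L 0) = 0 := by simpa using h
      simpa using eq_zero_of_wedgeU_add_star L hε0 hδ0 hB hS' h1
    · simpa using eq_zero_of_wedgeU_add_star L hε0 hδ0 hB hS' h
    · have h1 : wedgeU L (1, 0) + S (wedgeU L (-(Complex.I, 0))) = 0 := by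
        rw [map_neg, map_neg, ← sub_eq_add_neg]
        exact h
      simpa using eq_zero_of_wedgeU_add_star L hε0 hδ0 hB hS' h1
  · intro k
    fin_cases k
    · simp [cubeRootTriple, hr]
    · simp [cubeRootTriple, ha, hb, hc, hS2', q_re]
      module
    · simp [cubeRootTriple, ha, hb, hc, hS2', q_re, q_sq]
      module

theorem isSelfDualDiagonalizableWith_curvOp (hp : p ≠ 0) (hε : ε = 1 ∨ ε = -1)
    (hδ : δ = 1 ∨ δ = -1) (hεδ : δ = -ε)
    (hB : ∀ a b, B (L a) (L b) = totalForm ε δ a b) {S : End ℝ (⋀[ℝ]^2 W)}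
    (hS : IsHodgeStar B o S) :
    IsSelfDualDiagonalizableWith S (curvOp L δ p) (cubeRootTriple (-δ * p ^ 2)) := by
  have : FiniteDimensional ℝ W := L.finiteDimensional
  have hε0 : ε ≠ 0 := by rcases hε with rfl | rfl <;> norm_num
  have hδ0 : δ ≠ 0 := by rcases hδ with rfl | rfl <;> norm_num
  obtain ⟨e, he, ho, hpr⟩ := exists_orthonormal L hε hδ hB o
  have hS' := hS.bivectorForm_eq he ho
  have h1 : -(ε * δ) = 1 := by rcases hε with rfl | rfl <;> rw [hεδ] <;> norm_num
  have hS2 : S * S = 1 := by rw [hS.sq_eq he ho, hpr, h1, one_smul]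
  have hS2' : ∀ α, S (S α) = α := fun α ↦ congr($hS2 α)
  have hl : -δ * p ^ 2 ≠ 0 := by simp [hδ0, hp]
  have hc := curvOp_comm_star (p := p) L hε0 hδ0 hB hS'
  have ha := curvOp_wedgeU_one (δ := δ) (p := p) L
  have hb := curvOp_wedgeU_I (δ := δ) (p := p) L
  have hr := curvOp_wedgeU_real (δ := δ) (p := p) L
  have hne : ∀ v : ℂ × ℝ, v ≠ 0 → wedgeU L v + S (wedgeU L v) ≠ 0 := fun v hv h ↦
    hv (eq_zero_of_wedgeU_add_star L hε0 hδ0 hB hS' h)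
  have hfix : ∀ v, S (wedgeU L v + S (wedgeU L v)) = wedgeU L v + S (wedgeU L v) := fun v ↦ by
    rw [map_add, hS2', add_comm]
  set l := -δ * p ^ 2
  clear_value l
  refine .of_eigenvectors (cubeRootTriple_injective hl)
    (finrank_eigenspace_star L hε0 hδ0 hB hS' hS2') hc
    (x := ![wedgeU L (0, 1) + S (wedgeU L (0, 1)), wedgeU L (1, 0) + S (wedgeU L (1, 0)),
      wedgeU L (1, 0) + S (wedgeU L (1, 0))])
    (y := ![0, wedgeU L (Complex.I, 0) + S (wedgeU L (Complex.I, 0)),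
      -(wedgeU L (Complex.I, 0) + S (wedgeU L (Complex.I, 0)))]) ?_ ?_ ?_ ?_ ?_
  · intro k
    fin_cases k <;> exact hne _ (by simp)
  · intro k
    fin_cases k <;> exact hfix _
  · intro k
    fin_cases k
    · exact map_zero S
    · exact hfix _
    · exact (map_neg S _).trans congr(-$(hfix _))
  · intro k
    fin_cases k <;> simp [cubeRootTriple, ha, hc, hr, q_re, q_sq] <;> module
  · intro k
    fin_cases k <;> simp [cubeRootTriple, hb, hc, q_re, q_sq] <;> module

end Spectrum

section Developing

variable {V : Type*} [NormedAddCommGroup V] [NormedSpace ℝ V] (F : V →L[ℝ] V)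

/-- The one-parameter group `s ↦ e^{sF}`. -/
def expOp (s : ℝ) : V →L[ℝ] V := NormedSpace.exp (s • F)

theorem expOp_zero : expOp F 0 = 1 := by
  rw [expOp, zero_smul, NormedSpace.exp_zero]

variable [CompleteSpace V]

theorem expOp_add (s t : ℝ) : expOp F (s + t) = expOp F s * expOp F t := by
  let _ : NormedAlgebra ℚ (V →L[ℝ] V) := NormedAlgebra.restrictScalars ℚ ℝ _
  rw [expOp, add_smul]
  exact NormedSpace.exp_add_of_commute (((Commute.refl F).smul_left s).smul_right t)

theorem expOp_neg_apply (s : ℝ) (v : V) : expOp F (-s) (expOp F s v) = v := by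
  have h := expOp_add F (-s) s
  rw [neg_add_cancel, expOp_zero] at h
  exact congr($h v).symm

theorem expOp_apply_neg (s : ℝ) (v : V) : expOp F s (expOp F (-s) v) = v := by
  simpa using expOp_neg_apply F (-s) v

theorem hasDerivAt_expOp (s : ℝ) : HasDerivAt (expOp F) (expOp F s * F) s :=
  hasDerivAt_exp_smul_const F s

theorem contDiff_expOp {n : WithTop ℕ∞} : ContDiff ℝ n (expOp F) := by
  have h : ContDiff ℝ n (NormedSpace.exp : (V →L[ℝ] V) → V →L[ℝ] V) :=
    contDiff_iff_contDiffAt.2 fun x ↦ (NormedSpace.exp_analytic (𝕂 := ℝ) x).contDiffAt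
  exact h.comp (contDiff_id.smul contDiff_const)

/-- The operator `(v, r) ↦ (e^{sF}v, r)`. -/
def expShift (s : ℝ) : (V × ℝ) ≃L[ℝ] V × ℝ :=
  (ContinuousLinearEquiv.equivOfInverse (expOp F s) (expOp F (-s)) (expOp_neg_apply F s)
    (expOp_apply_neg F s)).prodCongr (ContinuousLinearEquiv.refl ℝ ℝ)

theorem expShift_apply (s : ℝ) (a : V × ℝ) : expShift F s a = (expOp F s a.1, a.2) := rfl

variable {E : Type*} [NormedAddCommGroup E] [NormedSpace ℝ E]

/-- A flat one-form with values in `V ⋊ ℝ` has a developing map on a convex open set. -/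
theorem exists_developing {U : Set E} (hU : Convex ℝ U) (hUo : IsOpen U) (y₀ : E)
    {θ : E → E →L[ℝ] V × ℝ} (hθ : ContDiffOn ℝ ∞ θ U)
    (hd : ∀ y ∈ U, ∀ e e', fderiv ℝ θ y e e' - fderiv ℝ θ y e' e =
      -((θ y e).2 • F (θ y e').1 - (θ y e').2 • F (θ y e).1, 0)) :
    ∃ Φ : E → V × ℝ, Φ y₀ = 0 ∧ ContDiffOn ℝ ∞ Φ U ∧
      ∀ y ∈ U, HasFDerivAt Φ ((expShift F (Φ y).2 : V × ℝ →L[ℝ] V × ℝ) ∘L θ y) y := by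
  have hθd : ∀ y ∈ U, HasFDerivAt θ (fderiv ℝ θ y) y := fun y hy ↦
    ((hθ.contDiffAt (hUo.mem_nhds hy)).differentiableAt (by simp)).hasFDerivAt
  have hfst : ContDiffOn ℝ ∞ (fun y ↦ ContinuousLinearMap.fst ℝ V ℝ ∘L θ y) U :=
    contDiffOn_const.clm_comp hθ
  have hsnd : ContDiffOn ℝ ∞ (fun y ↦ ContinuousLinearMap.snd ℝ V ℝ ∘L θ y) U :=
    contDiffOn_const.clm_comp hθ
  have hfstd : ∀ y ∈ U, HasFDerivAt (fun y ↦ ContinuousLinearMap.fst ℝ V ℝ ∘L θ y)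
      (ContinuousLinearMap.compL ℝ E (V × ℝ) V (ContinuousLinearMap.fst ℝ V ℝ) ∘L
        fderiv ℝ θ y) y := fun y hy ↦
    (ContinuousLinearMap.compL ℝ E (V × ℝ) V
      (ContinuousLinearMap.fst ℝ V ℝ)).hasFDerivAt.comp y (hθd y hy)
  have hsndd : ∀ y ∈ U, HasFDerivAt (fun y ↦ ContinuousLinearMap.snd ℝ V ℝ ∘L θ y)
      (ContinuousLinearMap.compL ℝ E (V × ℝ) ℝ (ContinuousLinearMap.snd ℝ V ℝ) ∘L
        fderiv ℝ θ y) y := fun y hy ↦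
    (ContinuousLinearMap.compL ℝ E (V × ℝ) ℝ
      (ContinuousLinearMap.snd ℝ V ℝ)).hasFDerivAt.comp y (hθd y hy)
  obtain ⟨s₀, hs₀⟩ := hU.exists_forall_hasFDerivAt_of_fderiv_symmetric hUo
    (hsnd.differentiableOn (by simp)) fun y hy e e' ↦ by
      rw [(hsndd y hy).fderiv]
      have h := congrArg Prod.snd (hd y hy e e')
      exact sub_eq_zero.1 (by simpa using h)
  let s : E → ℝ := fun y ↦ s₀ y - s₀ y₀
  have hs : ∀ y ∈ U, HasFDerivAt s (ContinuousLinearMap.snd ℝ V ℝ ∘L θ y) y := fun y hy ↦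
    (hs₀ y hy).sub_const _
  have hss : ContDiffOn ℝ ∞ s U := (contDiffOn_infty_iff_fderiv_of_isOpen hUo).2
    ⟨fun y hy ↦ (hs y hy).differentiableAt.differentiableWithinAt,
      hsnd.congr fun y hy ↦ (hs y hy).fderiv⟩
  have hT : ContDiffOn ℝ ∞ (fun y ↦ expOp F (s y)) U := (contDiff_expOp F).comp_contDiffOn hss
  have hη : ContDiffOn ℝ ∞ (fun y ↦ expOp F (s y) ∘L ContinuousLinearMap.fst ℝ V ℝ ∘L θ y) U :=
    hT.clm_comp hfst
  have hTd : ∀ y ∈ U, HasFDerivAt (fun y ↦ expOp F (s y))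
      ((ContinuousLinearMap.snd ℝ V ℝ ∘L θ y).smulRight (expOp F (s y) * F)) y := fun y hy ↦
    ((hasDerivAt_expOp F (s y)).hasFDerivAt.comp y (hs y hy)).congr_fderiv (by
      ext; simp)
  obtain ⟨w₀, hw₀⟩ := hU.exists_forall_hasFDerivAt_of_fderiv_symmetric hUo
    (hη.differentiableOn (by simp)) fun y hy e e' ↦ by
      rw [((hTd y hy).clm_comp (hfstd y hy)).fderiv]
      have h := congrArg (fun a ↦ expOp F (s y) a.1) (hd y hy e e')
      simp only [Prod.fst_sub, Prod.fst_neg, map_sub, map_neg, map_smul] at h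
      simp only [_root_.add_apply, ContinuousLinearMap.comp_apply,
        ContinuousLinearMap.compL_apply, ContinuousLinearMap.flip_apply,
        ContinuousLinearMap.smulRight_apply, _root_.smul_apply,
        mul_apply_eq_comp, ContinuousLinearMap.coe_fst', ContinuousLinearMap.coe_snd']
      rw [← sub_eq_zero] at h ⊢
      rw [← h]
      module
  let w : E → V := fun y ↦ w₀ y - w₀ y₀
  have hw : ∀ y ∈ U, HasFDerivAt w
      (expOp F (s y) ∘L ContinuousLinearMap.fst ℝ V ℝ ∘L θ y) y := fun y hy ↦
    (hw₀ y hy).sub_const _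
  have hws : ContDiffOn ℝ ∞ w U := (contDiffOn_infty_iff_fderiv_of_isOpen hUo).2
    ⟨fun y hy ↦ (hw y hy).differentiableAt.differentiableWithinAt,
      hη.congr fun y hy ↦ (hw y hy).fderiv⟩
  exact ⟨fun y ↦ (w y, s y), by simp [w, s], hws.prodMk hss,
    fun y hy ↦ (hw y hy).prodMk (hs y hy)⟩

/-- The inverse function theorem for a map with invertible derivatives on an open set. -/
theorem exists_openPartialHomeomorph [CompleteSpace E] {A : Type*} [NormedAddCommGroup A]
    [NormedSpace ℝ A] {U : Set E} (hUo : IsOpen U) {y₀ : E} (hy₀ : y₀ ∈ U) {Φ : E → A}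
    (hΦ : ContDiffOn ℝ ∞ Φ U)
    (hΦ' : ∀ y ∈ U, ∃ e : E ≃L[ℝ] A, HasFDerivAt Φ (e : E →L[ℝ] A) y) :
    ∃ P : OpenPartialHomeomorph E A, y₀ ∈ P.source ∧ P.source ⊆ U ∧ (P : E → A) = Φ ∧
      ContDiffOn ℝ ∞ P.symm P.target := by
  have hat : ∀ y ∈ U, ContDiffAt ℝ ∞ Φ y := fun y hy ↦ hΦ.contDiffAt (hUo.mem_nhds hy)
  obtain ⟨e, he⟩ := hΦ' y₀ hy₀
  let P₀ := (hat y₀ hy₀).toOpenPartialHomeomorph Φ he (by simp)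
  let P := P₀.restrOpen U hUo
  have hP : (P : E → A) = Φ := rfl
  have hsub : P.source ⊆ U := fun y hy ↦ hy.2
  refine ⟨P, ⟨ContDiffAt.mem_toOpenPartialHomeomorph_source _ he (by simp), hy₀⟩, hsub, hP,
    fun a ha ↦ ?_⟩
  have hmem := hsub (P.map_target ha)
  obtain ⟨e', he'⟩ := hΦ' _ hmem
  exact (P.contDiffAt_symm ha (hP ▸ he') (hP ▸ hat _ hmem)).contDiffWithinAt

end Developing

section LocalModel

set_option linter.unusedSectionVars false

variable {E : Type*} [NormedAddCommGroup E] [NormedSpace ℝ E] [FiniteDimensional ℝ E]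
  {M : Type*} [TopologicalSpace M] [ChartedSpace E M] [IsManifold 𝓘(ℝ, E) ∞ M]
  {A : Type*} [NormedAddCommGroup A] [NormedSpace ℝ A] [FiniteDimensional ℝ A]
  {X : A →ₗ[ℝ] Field E M} (hX : IsFrame X)

/-- The frame in the chart at `x₀`. -/
def IsFrame.inChart (x₀ : M) (y : E) : A →L[ℝ] E :=
  LinearMap.toContinuousLinearMap
    ((mfderiv 𝓘(ℝ, E) 𝓘(ℝ, E) (chartAt E x₀).symm y).inverse.toLinearMap ∘ₗ
      (hX.equiv ((chartAt E x₀).symm y)).toLinearMap)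

theorem IsFrame.inChart_apply (x₀ : M) (y : E) (a : A) : hX.inChart x₀ y a =
    VectorField.mpullback 𝓘(ℝ, E) 𝓘(ℝ, E) (chartAt E x₀).symm (X a) y := rfl

theorem isInvertible_mfderiv_chart_symm (x₀ : M) {y : E} (hy : y ∈ (chartAt E x₀).target) :
    (mfderiv 𝓘(ℝ, E) 𝓘(ℝ, E) (chartAt E x₀).symm y).IsInvertible :=
  have : IsManifold 𝓘(ℝ, E) 1 M := .of_le (n := ∞) (by simp)
  ⟨((mdifferentiable_chart (I := 𝓘(ℝ, E)) x₀).symm).mfderiv hy, rfl⟩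

theorem IsFrame.isInvertible_inChart (x₀ : M) {y : E} (hy : y ∈ (chartAt E x₀).target) :
    (hX.inChart x₀ y).IsInvertible := by
  obtain ⟨e, he⟩ := isInvertible_mfderiv_chart_symm x₀ hy
  refine ⟨((hX.equiv ((chartAt E x₀).symm y)).trans
    e.symm.toLinearEquiv).toContinuousLinearEquiv, ?_⟩
  ext a
  rw [hX.inChart_apply, VectorField.mpullback_apply, ← he, ContinuousLinearMap.inverse_equiv]
  rfl

theorem IsFrame.mfderiv_chart (x₀ : M) {x : M} (hx : x ∈ (chartAt E x₀).source) (a : A) :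
    mfderiv 𝓘(ℝ, E) 𝓘(ℝ, E) (chartAt E x₀) x (X a x) = hX.inChart x₀ (chartAt E x₀ x) a := by
  have : IsManifold 𝓘(ℝ, E) 1 M := .of_le (n := ∞) (by simp)
  have h := mdifferentiable_chart (I := 𝓘(ℝ, E)) x₀
  obtain ⟨e, he⟩ := isInvertible_mfderiv_chart_symm x₀ ((chartAt E x₀).map_source hx)
  rw [hX.inChart_apply, VectorField.mpullback_apply, ← he, ContinuousLinearMap.inverse_equiv]
  refine (e.symm_apply_eq.2 ?_).symm
  have h1 := congr($(h.symm_comp_deriv hx) (X a x))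
  rw [← ContinuousLinearEquiv.coe_coe, he]
  refine Eq.trans ?_ h1.symm
  have key : ∀ z, z = x → (X a z : E) = X a x := by rintro _ rfl; rfl
  exact key _ ((chartAt E x₀).left_inv hx)

theorem IsFrame.contDiffAt_inChart (x₀ : M) {y : E} (hy : y ∈ (chartAt E x₀).target) :
    ContDiffAt ℝ ∞ (hX.inChart x₀) y := by
  have : IsManifold 𝓘(ℝ, E) 1 M := .of_le (n := ∞) (by simp)
  have h : ContDiffOn ℝ ∞ (hX.inChart x₀) (chartAt E x₀).target := by
    refine contDiffOn_clm_apply.2 fun a z hz ↦ ?_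
    have h1 : ContMDiffAt 𝓘(ℝ, E) 𝓘(ℝ, E) ∞ (chartAt E x₀).symm z :=
      contMDiffOn_chart_symm.contMDiffAt ((chartAt E x₀).open_target.mem_nhds hz)
    have h2 := ContMDiffAt.mpullback_vectorField_preimage (hX.smooth a _) h1
      (isInvertible_mfderiv_chart_symm x₀ hz) (m := ∞) (by simp)
    exact (contMDiffAt_vectorSpace_iff_contDiffAt.1 h2).contDiffWithinAt
  exact h.contDiffAt ((chartAt E x₀).open_target.mem_nhds hy)

theorem IsFrame.contDiffAt_inverse_inChart (x₀ : M) {y : E} (hy : y ∈ (chartAt E x₀).target) :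
    ContDiffAt ℝ ∞ (fun z ↦ (hX.inChart x₀ z).inverse) y := by
  obtain ⟨f, hf⟩ := hX.isInvertible_inChart x₀ hy
  have h : ContDiffAt ℝ ∞ ContinuousLinearMap.inverse (hX.inChart x₀ y) := by
    rw [← hf]
    exact contDiffAt_map_inverse f
  exact h.comp y (hX.contDiffAt_inChart x₀ hy)

theorem IsFrame.lieBracket_inChart {c : A →ₗ[ℝ] A →ₗ[ℝ] A}
    (hc : ∀ a b, VectorField.mlieBracket 𝓘(ℝ, E) (X a) (X b) = X (c a b)) (x₀ : M) {y : E}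
    (hy : y ∈ (chartAt E x₀).target) (a b : A) :
    VectorField.lieBracket ℝ (fun z ↦ hX.inChart x₀ z a) (fun z ↦ hX.inChart x₀ z b) y =
      hX.inChart x₀ y (c a b) := by
  have := isManifold_minSmoothness (E := E) (M := M) 2
  have h1 : ContMDiffAt 𝓘(ℝ, E) 𝓘(ℝ, E) ∞ (chartAt E x₀).symm y :=
    contMDiffOn_chart_symm.contMDiffAt ((chartAt E x₀).open_target.mem_nhds hy)
  have h := VectorField.mpullback_mlieBracket (hX.diffAt_frame a _) (hX.diffAt_frame b _) h1
    (by simpa using natCast_le_infty 2)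
  rw [hc] at h
  rw [← VectorField.lieBracketWithin_univ]
  refine Eq.trans (congrFun (VectorField.mlieBracketWithin_eq_lieBracketWithin
    (V := fun z ↦ hX.inChart x₀ z a) (W := fun z ↦ hX.inChart x₀ z b)).symm y) ?_
  exact (congrFun VectorField.mlieBracketWithin_univ y).trans h.symm

theorem IsFrame.fderiv_inverse_inChart {c : A →ₗ[ℝ] A →ₗ[ℝ] A}
    (hc : ∀ a b, VectorField.mlieBracket 𝓘(ℝ, E) (X a) (X b) = X (c a b)) (x₀ : M) {y : E}
    (hy : y ∈ (chartAt E x₀).target) (e e' : E) :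
    fderiv ℝ (fun z ↦ (hX.inChart x₀ z).inverse) y e e'
      - fderiv ℝ (fun z ↦ (hX.inChart x₀ z).inverse) y e' e =
      -c ((hX.inChart x₀ y).inverse e) ((hX.inChart x₀ y).inverse e') := by
  have hQ := hX.contDiffAt_inChart x₀ hy
  have hθ := hX.contDiffAt_inverse_inChart x₀ hy
  have hQd := (hQ.differentiableAt (by simp)).hasFDerivAt
  have hθd := (hθ.differentiableAt (by simp)).hasFDerivAt
  set θ' := fderiv ℝ (fun z ↦ (hX.inChart x₀ z).inverse) y
  set Q' := fderiv ℝ (hX.inChart x₀) y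
  have hinv : ∀ z ∈ (chartAt E x₀).target, ∀ a,
      (hX.inChart x₀ z).inverse (hX.inChart x₀ z a) = a := by
    intro z hz a
    obtain ⟨f, hf⟩ := hX.isInvertible_inChart x₀ hz
    rw [← hf, ContinuousLinearMap.inverse_equiv]
    exact f.symm_apply_apply a
  have key : ∀ a e, θ' e (hX.inChart x₀ y a) = -(hX.inChart x₀ y).inverse (Q' e a) := by
    intro a e
    have h1 : HasFDerivAt (fun z ↦ (hX.inChart x₀ z).inverse (hX.inChart x₀ z a)) _ y :=
      hθd.clm_apply (hQd.clm_apply (hasFDerivAt_const a y))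
    have h2 : HasFDerivAt (fun z ↦ (hX.inChart x₀ z).inverse (hX.inChart x₀ z a))
        (0 : E →L[ℝ] A) y := by
      refine (hasFDerivAt_const a y).congr_of_eventuallyEq ?_
      filter_upwards [(chartAt E x₀).open_target.mem_nhds hy] with z hz using hinv z hz a
    have h3 := congr($(h1.unique h2) e)
    simp at h3
    exact eq_neg_of_add_eq_zero_right h3
  obtain ⟨f, hf⟩ := hX.isInvertible_inChart x₀ hy
  obtain ⟨a, rfl⟩ : ∃ a, hX.inChart x₀ y a = e := ⟨f.symm e, by rw [← hf]; simp⟩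
  obtain ⟨b, rfl⟩ : ∃ b, hX.inChart x₀ y b = e' := ⟨f.symm e', by rw [← hf]; simp⟩
  have hbr := hX.lieBracket_inChart hc x₀ hy a b
  have hQa : ∀ a, fderiv ℝ (fun z ↦ hX.inChart x₀ z a) y = Q'.flip a := fun a ↦ by
    rw [(hQd.clm_apply (hasFDerivAt_const a y)).fderiv]
    simp
  rw [VectorField.lieBracket_eq] at hbr
  beta_reduce at hbr
  rw [hQa, hQa] at hbr
  rw [key, key, hinv y hy, hinv y hy, ← hinv y hy (c a b), ← hbr, map_sub]
  simp only [ContinuousLinearMap.flip_apply]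
  abel

/-- A frame whose brackets are those of `V ⋊ ℝ` is locally diffeomorphic to the frame
`(v, r) ↦ (e^{sF}v, r)` on `V × ℝ`, where `s` is the second coordinate. -/
theorem exists_developing_diffeo {V : Type*} [NormedAddCommGroup V] [NormedSpace ℝ V]
    [FiniteDimensional ℝ V] [CompleteSpace V] (F : V →L[ℝ] V) {X : V × ℝ →ₗ[ℝ] Field E M}
    (hX : IsFrame X) {c : V × ℝ →ₗ[ℝ] V × ℝ →ₗ[ℝ] V × ℝ}
    (hcF : ∀ a b, c a b = (a.2 • F b.1 - b.2 • F a.1, 0))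
    (hc : ∀ a b, VectorField.mlieBracket 𝓘(ℝ, E) (X a) (X b) = X (c a b)) (x₀ : M) :
    ∃ Φ : PartialDiffeomorph 𝓘(ℝ, E) 𝓘(ℝ, V × ℝ) M (V × ℝ) ∞, x₀ ∈ Φ.source ∧ Φ x₀ = 0 ∧
      ∀ x ∈ Φ.source, ∀ a, mfderiv 𝓘(ℝ, E) 𝓘(ℝ, V × ℝ) Φ x (X a x) = expShift F (Φ x).2 a := by
  have : CompleteSpace E := FiniteDimensional.complete ℝ E
  set χ := chartAt E x₀ with hχ
  have hx₀ : x₀ ∈ χ.source := mem_chart_source E x₀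
  obtain ⟨r, hr, hball⟩ := Metric.isOpen_iff.1 χ.open_target _ (χ.map_source hx₀)
  have hy₀ : χ x₀ ∈ Metric.ball (χ x₀) r := Metric.mem_ball_self hr
  obtain ⟨Φ₀, h0, hsm, hder⟩ := exists_developing F (convex_ball (χ x₀) r) Metric.isOpen_ball
    (χ x₀) (θ := fun z ↦ (hX.inChart x₀ z).inverse)
    (fun y hy ↦ (hX.contDiffAt_inverse_inChart x₀ (hball hy)).contDiffWithinAt)
    (fun y hy e e' ↦ by rw [hX.fderiv_inverse_inChart hc x₀ (hball hy), hcF])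
  obtain ⟨P, hyP, hPU, hPΦ, hPs⟩ := exists_openPartialHomeomorph Metric.isOpen_ball hy₀ hsm
    fun y hy ↦ by
      obtain ⟨f, hf⟩ := hX.isInvertible_inChart x₀ (hball hy)
      refine ⟨f.symm.trans (expShift F (Φ₀ y).2), ?_⟩
      refine (hder y hy).congr_fderiv ?_
      rw [← hf, ContinuousLinearMap.inverse_equiv]
      rfl
  let Pχ : PartialDiffeomorph 𝓘(ℝ, E) 𝓘(ℝ, E) M E ∞ :=
    { toPartialEquiv := χ.toPartialEquiv
      open_source := χ.open_source
      open_target := χ.open_target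
      contMDiffOn_toFun := contMDiffOn_chart
      contMDiffOn_invFun := contMDiffOn_chart_symm }
  let PP : PartialDiffeomorph 𝓘(ℝ, E) 𝓘(ℝ, V × ℝ) E (V × ℝ) ∞ :=
    { toPartialEquiv := P.toPartialEquiv
      open_source := P.open_source
      open_target := P.open_target
      contMDiffOn_toFun := contMDiffOn_iff_contDiffOn.2 ((hsm.mono hPU).congr fun y _ ↦
        congrFun hPΦ y)
      contMDiffOn_invFun := contMDiffOn_iff_contDiffOn.2 hPs }
  have hcoe : ∀ x, (Pχ.trans PP) x = Φ₀ (χ x) := fun x ↦ congrFun hPΦ (χ x)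
  refine ⟨Pχ.trans PP, ⟨hx₀, hyP⟩, (hcoe x₀).trans h0, fun x hx a ↦ ?_⟩
  have hxs : x ∈ χ.source := hx.1
  have hxU : χ x ∈ Metric.ball (χ x₀) r := hPU hx.2
  have hfun : ((Pχ.trans PP : M → V × ℝ)) = Φ₀ ∘ χ := funext hcoe
  rw [hcoe, hfun, mfderiv_comp x (hder _ hxU).differentiableAt.mdifferentiableAt
    (Pχ.mdifferentiableAt (by simp) hxs), mfderiv_eq_fderiv, (hder _ hxU).fderiv]
  have h1 := hX.mfderiv_chart x₀ hxs a
  obtain ⟨f, hf⟩ := hX.isInvertible_inChart x₀ (hball hxU)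
  change expShift F (Φ₀ (χ x)).2 ((hX.inChart x₀ (χ x)).inverse
    (mfderiv 𝓘(ℝ, E) 𝓘(ℝ, E) χ x (X a x))) = _
  rw [h1, ← hf, ContinuousLinearMap.inverse_equiv]
  congr 1
  exact f.symm_apply_apply a

end LocalModel

section ExpGroup

set_option linter.unusedSectionVars false

variable {V : Type*} [NormedAddCommGroup V] [NormedSpace ℝ V]

/-- The semidirect product `V ⋊ ℝ` in which `s ∈ ℝ` acts on `V` as `e^{sF}`. -/
def ExpGroup (_F : V →L[ℝ] V) : Type _ := V × ℝ

namespace ExpGroup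

variable (F : V →L[ℝ] V)

instance : TopologicalSpace (ExpGroup F) := inferInstanceAs (TopologicalSpace (V × ℝ))

instance : T2Space (ExpGroup F) := inferInstanceAs (T2Space (V × ℝ))

instance [SecondCountableTopology V] : SecondCountableTopology (ExpGroup F) :=
  inferInstanceAs (SecondCountableTopology (V × ℝ))

instance : ChartedSpace (V × ℝ) (ExpGroup F) := inferInstanceAs (ChartedSpace (V × ℝ) (V × ℝ))

instance : IsManifold 𝓘(ℝ, V × ℝ) ∞ (ExpGroup F) :=
  inferInstanceAs (IsManifold 𝓘(ℝ, V × ℝ) ∞ (V × ℝ))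

variable [CompleteSpace V]

instance : Group (ExpGroup F) where
  mul a b := (a.1 + expOp F a.2 b.1, a.2 + b.2)
  one := (0, 0)
  inv a := (-expOp F (-a.2) a.1, -a.2)
  mul_assoc a b c := by
    refine Prod.ext ?_ (add_assoc a.2 b.2 c.2)
    change a.1 + expOp F a.2 b.1 + expOp F (a.2 + b.2) c.1 =
      a.1 + expOp F a.2 (b.1 + expOp F b.2 c.1)
    rw [map_add, expOp_add, add_assoc]
    rfl
  one_mul a := by
    refine Prod.ext ?_ (zero_add a.2)
    change 0 + expOp F 0 a.1 = a.1
    rw [expOp_zero, zero_add]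
    rfl
  mul_one a := by
    refine Prod.ext ?_ (add_zero a.2)
    change a.1 + expOp F a.2 0 = a.1
    rw [map_zero, add_zero]
  inv_mul_cancel a := by
    refine Prod.ext ?_ (neg_add_cancel a.2)
    change -expOp F (-a.2) a.1 + expOp F (-a.2) a.1 = 0
    rw [neg_add_cancel]

instance : LieGroup 𝓘(ℝ, V × ℝ) ∞ (ExpGroup F) where
  contMDiff_mul := by
    have h : ContDiff ℝ ∞ (fun a : (V × ℝ) × (V × ℝ) ↦
        ((a.1.1 + expOp F a.1.2 a.2.1, a.1.2 + a.2.2) : V × ℝ)) :=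
      (contDiff_fst.fst.add (((contDiff_expOp F).comp contDiff_fst.snd).clm_apply
        contDiff_snd.fst)).prodMk (contDiff_fst.snd.add contDiff_snd.snd)
    have h1 : ContMDiff (𝓘(ℝ, V × ℝ).prod 𝓘(ℝ, V × ℝ)) 𝓘(ℝ, V × ℝ) ∞
        (fun a : (V × ℝ) × (V × ℝ) ↦ a.1) := contMDiff_fst
    have h2 : ContMDiff (𝓘(ℝ, V × ℝ).prod 𝓘(ℝ, V × ℝ)) 𝓘(ℝ, V × ℝ) ∞
        (fun a : (V × ℝ) × (V × ℝ) ↦ a.2) := contMDiff_snd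
    exact h.contMDiff.comp (h1.prodMk_space h2)
  contMDiff_inv := by
    have h : ContDiff ℝ ∞ (fun a : V × ℝ ↦ ((-expOp F (-a.2) a.1, -a.2) : V × ℝ)) :=
      (((contDiff_expOp F).comp contDiff_snd.neg).clm_apply contDiff_fst).neg.prodMk
        contDiff_snd.neg
    exact h.contMDiff

/-- The left-invariant vector fields. -/
def leftField : V × ℝ →ₗ[ℝ] Field (V × ℝ) (ExpGroup F) where
  toFun a := fun y ↦ (expShift F y.2 a : V × ℝ)
  map_add' a b := funext fun y ↦ map_add (expShift F y.2) a b
  map_smul' r a := funext fun y ↦ map_smul (expShift F y.2) r a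

theorem isFrame_leftField : IsFrame (leftField F) where
  smooth a x := by
    have h : ContDiff ℝ ∞ (fun y : V × ℝ ↦ (expShift F y.2 a : V × ℝ)) :=
      (((contDiff_expOp F).comp contDiff_snd).clm_apply contDiff_const).prodMk contDiff_const
    have h1 : ∀ x : V × ℝ, ContMDiffAt 𝓘(ℝ, V × ℝ) 𝓘(ℝ, V × ℝ).tangent ∞
        (fun y ↦ (⟨y, expShift F y.2 a⟩ : TangentBundle 𝓘(ℝ, V × ℝ) (V × ℝ))) x := fun x ↦
      contMDiffAt_vectorSpace_iff_contDiffAt.2 h.contDiffAt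
    exact h1 x
  bijective x := (expShift F x.2).bijective

theorem mfderiv_mul_left (a b : ExpGroup F) (x : V × ℝ) :
    mfderiv 𝓘(ℝ, V × ℝ) 𝓘(ℝ, V × ℝ) (fun c ↦ a * c) b (leftField F x b) =
      leftField F x (a * b) := by
  have h : ∀ b : V × ℝ, HasFDerivAt (fun c : V × ℝ ↦ ((a.1 + expOp F a.2 c.1, a.2 + c.2) : V × ℝ))
      (expShift F a.2 : V × ℝ →L[ℝ] V × ℝ) b := fun b ↦
    have hv : HasFDerivAt (fun c : V × ℝ ↦ a.1 + expOp F a.2 c.1)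
        (expOp F a.2 ∘L ContinuousLinearMap.fst ℝ V ℝ) b :=
      ((expOp F a.2).hasFDerivAt.comp b hasFDerivAt_fst).const_add a.1
    have hr : HasFDerivAt (fun c : V × ℝ ↦ a.2 + c.2) (ContinuousLinearMap.snd ℝ V ℝ) b :=
      hasFDerivAt_snd.const_add a.2
    hv.prodMk hr
  have h1 : mfderiv 𝓘(ℝ, V × ℝ) 𝓘(ℝ, V × ℝ) (fun c : ExpGroup F ↦ a * c) b =
      (expShift F a.2 : V × ℝ →L[ℝ] V × ℝ) := (h b).hasMFDerivAt.mfderiv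
  rw [h1]
  change expShift F a.2 (expShift F b.2 x) = expShift F (a.2 + b.2) x
  simp only [expShift_apply, expOp_add]
  rfl

variable [FiniteDimensional ℝ V] {B : LinearMap.BilinForm ℝ (V × ℝ)}
  (hs : ∀ a b, B a b = B b a) (hB : B.Nondegenerate)

/-- The left-invariant metric with the value `B` at the identity. -/
def leftMetric : Metric (V × ℝ) (ExpGroup F) := (isFrame_leftField F).metric B hs hB

theorem leftMetric_apply (x : ExpGroup F) (a b : V × ℝ) :
    (leftMetric F hs hB).form x (leftField F a x) (leftField F b x) = B a b :=
  (isFrame_leftField F).metric_apply B hs hB x a b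

theorem isLeftInvariant_leftMetric : IsLeftInvariant (leftMetric F hs hB) := by
  intro a b u v
  obtain ⟨u, rfl⟩ := ((isFrame_leftField F).equiv b).surjective u
  obtain ⟨v, rfl⟩ := ((isFrame_leftField F).equiv b).surjective v
  rw [IsFrame.equiv_apply, IsFrame.equiv_apply, mfderiv_mul_left, mfderiv_mul_left,
    leftMetric_apply, leftMetric_apply]

end ExpGroup

variable {E : Type*} [NormedAddCommGroup E] [NormedSpace ℝ E] [FiniteDimensional ℝ E]
  {M : Type*} [TopologicalSpace M] [ChartedSpace E M] [IsManifold 𝓘(ℝ, E) ∞ M]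

theorem IsLocalIsometry.trans_symm {E' : Type*} [NormedAddCommGroup E'] [NormedSpace ℝ E']
    {N : Type*} [TopologicalSpace N] [ChartedSpace E' N] [IsManifold 𝓘(ℝ, E') ∞ N]
    {g : Metric E M} {h : Metric E' N} {Φ Ψ : PartialDiffeomorph 𝓘(ℝ, E) 𝓘(ℝ, E') M N ∞}
    (hΦ : IsLocalIsometry g h Φ) (hΨ : IsLocalIsometry g h Ψ) :
    IsLocalIsometry g g (Φ.trans Ψ.symm) := by
  intro x hx u v
  set Θ := Φ.trans Ψ.symm
  have hxΦ : x ∈ Φ.source := hx.1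
  have hxΨ : Θ x ∈ Ψ.source := Ψ.map_target hx.2
  have hΘ : MDifferentiableAt 𝓘(ℝ, E) 𝓘(ℝ, E) Θ x := Θ.mdifferentiableAt (by simp) hx
  have heq : (fun y ↦ Ψ (Θ y)) =ᶠ[nhds x] Φ := by
    filter_upwards [Θ.open_source.mem_nhds hx] with y hy
    exact Ψ.right_inv hy.2
  have hd : ∀ w, mfderiv 𝓘(ℝ, E) 𝓘(ℝ, E') Ψ (Θ x) (mfderiv 𝓘(ℝ, E) 𝓘(ℝ, E) Θ x w) =
      mfderiv 𝓘(ℝ, E) 𝓘(ℝ, E') Φ x w := by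
    intro w
    have h1 := mfderiv_comp x (Ψ.mdifferentiableAt (by simp) hxΨ) hΘ
    have h2 : mfderiv 𝓘(ℝ, E) 𝓘(ℝ, E') (Ψ ∘ Θ) x = mfderiv 𝓘(ℝ, E) 𝓘(ℝ, E') Φ x :=
      heq.mfderiv_eq
    exact congr($(h1.symm.trans h2) w)
  have hpt : Ψ (Θ x) = Φ x := heq.self_of_nhds
  rw [← hΨ _ hxΨ, ← hΦ x hxΦ, hd, hd, hpt]

variable [FiniteDimensional ℝ V] [CompleteSpace V]

theorem exists_isLocalIsometry_leftMetric (F : V →L[ℝ] V) {X : V × ℝ →ₗ[ℝ] Field E M}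
    (hX : IsFrame X) {c : V × ℝ →ₗ[ℝ] V × ℝ →ₗ[ℝ] V × ℝ}
    (hcF : ∀ a b, c a b = (a.2 • F b.1 - b.2 • F a.1, 0))
    (hc : ∀ a b, VectorField.mlieBracket 𝓘(ℝ, E) (X a) (X b) = X (c a b))
    {B : LinearMap.BilinForm ℝ (V × ℝ)} (hs : ∀ a b, B a b = B b a) (hB : B.Nondegenerate)
    {g : Metric E M} (hg : ∀ a b x, g.form x (X a x) (X b x) = B a b) (x : M) :
    ∃ Φ : PartialDiffeomorph 𝓘(ℝ, E) 𝓘(ℝ, V × ℝ) M (ExpGroup F) ∞,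
      x ∈ Φ.source ∧ Φ x = 1 ∧ IsLocalIsometry g (ExpGroup.leftMetric F hs hB) Φ := by
  obtain ⟨Φ, hx, h0, hΦ⟩ := exists_developing_diffeo F hX hcF hc x
  let Ψ : PartialDiffeomorph 𝓘(ℝ, E) 𝓘(ℝ, V × ℝ) M (ExpGroup F) ∞ := Φ
  have hΨ : ∀ x ∈ Ψ.source, ∀ a, mfderiv 𝓘(ℝ, E) 𝓘(ℝ, V × ℝ) Ψ x (X a x) =
      ExpGroup.leftField F a (Ψ x) := hΦ
  refine ⟨Ψ, hx, h0, fun y hy u v ↦ ?_⟩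
  obtain ⟨a, rfl⟩ := (hX.equiv y).surjective u
  obtain ⟨b, rfl⟩ := (hX.equiv y).surjective v
  rw [hX.equiv_apply, hX.equiv_apply, hΨ y hy, hΨ y hy, ExpGroup.leftMetric_apply, hg]

theorem isLocallyIsometricTo_leftMetric (F : V →L[ℝ] V) {X : V × ℝ →ₗ[ℝ] Field E M}
    (hX : IsFrame X) {c : V × ℝ →ₗ[ℝ] V × ℝ →ₗ[ℝ] V × ℝ}
    (hcF : ∀ a b, c a b = (a.2 • F b.1 - b.2 • F a.1, 0))
    (hc : ∀ a b, VectorField.mlieBracket 𝓘(ℝ, E) (X a) (X b) = X (c a b))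
    {B : LinearMap.BilinForm ℝ (V × ℝ)} (hs : ∀ a b, B a b = B b a) (hB : B.Nondegenerate)
    {g : Metric E M} (hg : ∀ a b x, g.form x (X a x) (X b x) = B a b) :
    IsLocallyIsometricTo g (ExpGroup.leftMetric F hs hB) := fun x ↦
  have ⟨Φ, hx, _, hΦ⟩ := exists_isLocalIsometry_leftMetric F hX hcF hc hs hB hg x
  ⟨Φ, hx, hΦ⟩

theorem isLocallyHomogeneous_of_frame (F : V →L[ℝ] V) {X : V × ℝ →ₗ[ℝ] Field E M}
    (hX : IsFrame X) {c : V × ℝ →ₗ[ℝ] V × ℝ →ₗ[ℝ] V × ℝ}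
    (hcF : ∀ a b, c a b = (a.2 • F b.1 - b.2 • F a.1, 0))
    (hc : ∀ a b, VectorField.mlieBracket 𝓘(ℝ, E) (X a) (X b) = X (c a b))
    {B : LinearMap.BilinForm ℝ (V × ℝ)} (hs : ∀ a b, B a b = B b a) (hB : B.Nondegenerate)
    {g : Metric E M} (hg : ∀ a b x, g.form x (X a x) (X b x) = B a b) : IsLocallyHomogeneous g := by
  intro x y
  obtain ⟨Φ, hx, hΦx, hΦ⟩ := exists_isLocalIsometry_leftMetric F hX hcF hc hs hB hg x
  obtain ⟨Ψ, hy, hΨy, hΨ⟩ := exists_isLocalIsometry_leftMetric F hX hcF hc hs hB hg y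
  have h1 : Φ x = Ψ y := hΦx.trans hΨy.symm
  refine ⟨Φ.trans Ψ.symm, ⟨hx, ?_⟩, ?_, hΦ.trans_symm hΨ⟩
  · change Φ x ∈ Ψ.target
    rw [h1]
    exact Ψ.map_source hy
  · change Ψ.symm (Φ x) = y
    rw [h1]
    exact Ψ.left_inv hy

end ExpGroup

section Model

open VectorField

theorem hasMFDerivAt_subtype_val {E : Type*} [NormedAddCommGroup E] [NormedSpace ℝ E]
    (U : TopologicalSpace.Opens E) (y : U) :
    HasMFDerivAt 𝓘(ℝ, E) 𝓘(ℝ, E) (Subtype.val : U → E) y (ContinuousLinearMap.id ℝ E) := by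
  refine ⟨continuous_subtype_val.continuousAt, ?_⟩
  have h : writtenInExtChartAt 𝓘(ℝ, E) 𝓘(ℝ, E) y (Subtype.val : U → E) =ᶠ[nhds y.1] id := by
    filter_upwards [U.chartAt_subtype_val_symm_eventuallyEq (H := E) (x := y)] with z hz
    exact hz.symm
  exact ((hasFDerivAt_id y.1).congr_of_eventuallyEq h).hasFDerivWithinAt

theorem mpullback_subtype_val {E : Type*} [NormedAddCommGroup E] [NormedSpace ℝ E]
    (U : TopologicalSpace.Opens E) (W : Π y : E, TangentSpace 𝓘(ℝ, E) y) (y : U) :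
    mpullback 𝓘(ℝ, E) 𝓘(ℝ, E) (Subtype.val : U → E) W y = W y.1 := by
  rw [mpullback_apply, (hasMFDerivAt_subtype_val _ y).mfderiv]
  change (ContinuousLinearMap.id ℝ E).inverse _ = _
  rw [ContinuousLinearMap.inverse_id]
  rfl

set_option linter.unusedSectionVars false

variable {V : Type*} [NormedAddCommGroup V] [NormedSpace ℝ V] [FiniteDimensional ℝ V]
  (F : V →L[ℝ] V)

/-- The extension of the model fields to `V × ℝ`. -/
def ambientField (a : V × ℝ) (y : V × ℝ) : V × ℝ := (a.1 - a.2 • F y.1, a.2 * y.2)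

theorem contDiff_ambientField (a : V × ℝ) : ContDiff ℝ ∞ (ambientField F a) :=
  (contDiff_const.sub (contDiff_const.smul (F.contDiff.comp contDiff_fst))).prodMk
    (contDiff_const.mul contDiff_snd)

theorem fderiv_ambientField (a y w : V × ℝ) :
    fderiv ℝ (ambientField F a) y w = (-(a.2 • F w.1), a.2 * w.2) := by
  have h1 : HasFDerivAt (fun y : V × ℝ ↦ a.1 - a.2 • F y.1)
      (-(a.2 • (F ∘L ContinuousLinearMap.fst ℝ V ℝ))) y :=
    ((F.hasFDerivAt.comp y hasFDerivAt_fst).const_smul a.2).const_sub a.1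
  have h2 : HasFDerivAt (fun y : V × ℝ ↦ a.2 * y.2)
      (a.2 • ContinuousLinearMap.snd ℝ V ℝ) y := hasFDerivAt_snd.const_mul a.2
  have h3 : HasFDerivAt (ambientField F a) _ y := h1.prodMk h2
  rw [h3.fderiv]
  simp

theorem lieBracket_ambientField (a b y : V × ℝ) :
    lieBracket ℝ (ambientField F a) (ambientField F b) y =
      (a.2 • F b.1 - b.2 • F a.1, 0) := by
  rw [lieBracket_eq]
  beta_reduce
  rw [fderiv_ambientField, fderiv_ambientField]
  simp only [ambientField, map_sub, map_smul]
  refine Prod.ext ?_ ?_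
  · simp only [Prod.fst_sub]
    module
  · simp only [Prod.snd_sub]
    ring

theorem modelFields_eq_mpullback (a : V × ℝ) : modelFields (F : V →ₗ[ℝ] V) a =
    mpullback 𝓘(ℝ, V × ℝ) 𝓘(ℝ, V × ℝ) (Subtype.val : modelSpace V → V × ℝ) (ambientField F a) :=
  funext fun y ↦ (mpullback_subtype_val _ (ambientField F a) y).symm

theorem mlieBracket_modelFields (a b : V × ℝ) (y : modelSpace V) :
    mlieBracket 𝓘(ℝ, V × ℝ) (modelFields (F : V →ₗ[ℝ] V) a) (modelFields (F : V →ₗ[ℝ] V) b) y =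
      ((a.2 • F b.1 - b.2 • F a.1, 0) : V × ℝ) := by
  have := isManifold_minSmoothness (E := V × ℝ) (M := modelSpace V) 2
  have hd : ∀ a, MDifferentiableAt 𝓘(ℝ, V × ℝ) 𝓘(ℝ, V × ℝ).tangent
      (fun y ↦ (⟨y, ambientField F a y⟩ : TangentBundle 𝓘(ℝ, V × ℝ) (V × ℝ))) y.1 := fun a ↦
    (contMDiffAt_vectorSpace_iff_contDiffAt.2
      (contDiff_ambientField F a).contDiffAt).mdifferentiableAt (by simp)
  have h := mpullback_mlieBracket (hd a) (hd b) (contMDiff_subtype_val.contMDiffAt (x := y))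
    (n := ∞) (by simpa using natCast_le_infty 2)
  rw [modelFields_eq_mpullback, modelFields_eq_mpullback]
  refine (h.symm.trans (mpullback_subtype_val _ _ y)).trans ?_
  refine Eq.trans ?_ (lieBracket_ambientField F a b y.1)
  rw [← lieBracketWithin_univ]
  refine Eq.trans ?_ (congrFun (mlieBracketWithin_eq_lieBracketWithin
    (V := ambientField F a) (W := ambientField F b)) y.1)
  exact (congrFun mlieBracketWithin_univ y.1).symm

theorem isSimplyTransitive_modelFields : IsSimplyTransitive (F : V →ₗ[ℝ] V)
    (modelFields (F : V →ₗ[ℝ] V)) where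
  smooth a x := by
    rw [modelFields_eq_mpullback]
    exact ContMDiffAt.mpullback_vectorField_preimage
      (contMDiffAt_vectorSpace_iff_contDiffAt.2 (contDiff_ambientField F a).contDiffAt)
      (contMDiff_subtype_val.contMDiffAt) (n := ∞) (by
        rw [(hasMFDerivAt_subtype_val _ x).mfderiv]
        exact ⟨ContinuousLinearEquiv.refl ℝ (V × ℝ), rfl⟩) (by simp)
  bijective x := by
    have hx : x.1.2 ≠ 0 := ne_of_gt x.2
    refine ⟨fun a b hab ↦ ?_, fun w ↦ ?_⟩
    · have h2 : a.2 * x.1.2 = b.2 * x.1.2 := congrArg Prod.snd hab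
      have h2' : a.2 = b.2 := mul_right_cancel₀ hx h2
      have h1 : a.1 - a.2 • F x.1.1 = b.1 - b.2 • F x.1.1 := congrArg Prod.fst hab
      rw [h2'] at h1
      exact Prod.ext (sub_left_injective h1) h2'
    · obtain ⟨v, r⟩ : V × ℝ := w
      refine ⟨(v + (r / x.1.2) • F x.1.1, r / x.1.2), Prod.ext ?_ ?_⟩
      · exact add_sub_cancel_right _ _
      · exact div_mul_cancel₀ r hx
  bracket_u v := by
    funext y
    rw [mlieBracket_modelFields]
    refine Prod.ext ?_ ?_
    · change (1 : ℝ) • F v - (0 : ℝ) • F 0 = F v - (0 : ℝ) • F y.1.1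
      module
    · exact (zero_mul _).symm
  bracket_v v v' := by
    funext y
    rw [mlieBracket_modelFields]
    refine Prod.ext ?_ rfl
    change (0 : ℝ) • F v' - (0 : ℝ) • F v = 0
    module

end Model

section Geometry

open VectorField

theorem frame_split {E : Type*} [NormedAddCommGroup E] [NormedSpace ℝ E]
    {M : Type*} [TopologicalSpace M] [ChartedSpace E M]
    (X : (ℂ × ℝ) × ℝ →ₗ[ℝ] Field E M) (a : (ℂ × ℝ) × ℝ) :
    X a = X (a.1, 0) + a.2 • X (0, 1) := by
  rw [← map_smul, ← map_add]
  simp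

variable {E : Type*} [NormedAddCommGroup E] [NormedSpace ℝ E]
  {M : Type*} [TopologicalSpace M] [ChartedSpace E M] [IsManifold 𝓘(ℝ, E) ∞ M]
  {X : (ℂ × ℝ) × ℝ →ₗ[ℝ] Field E M} {ε δ p : ℝ} {g : Metric E M}

theorem IsSimplyTransitive.isFrame {F : ℂ × ℝ →ₗ[ℝ] ℂ × ℝ} (h : IsSimplyTransitive F X) :
    IsFrame X := ⟨h.smooth, h.bijective⟩

theorem IsSimplyTransitive.mlieBracket [FiniteDimensional ℝ E]
    (h : IsSimplyTransitive (exampleOperator p) X)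
    (a b : (ℂ × ℝ) × ℝ) : mlieBracket 𝓘(ℝ, E) (X a) (X b) = X (bracket p a b) := by
  have := FiniteDimensional.complete ℝ E
  have := isManifold_minSmoothness (E := E) (M := M) 2
  have hd := fun a x ↦ h.isFrame.diffAt_frame a x
  have hsm : ∀ (r : ℝ) (x : M), DiffAt (r • X (0, 1)) x := fun r x ↦ by
    rw [← map_smul]
    exact hd _ x
  funext x
  have h1 : ∀ v : ℂ × ℝ, VectorField.mlieBracket 𝓘(ℝ, E) (X (v, 0)) (X b) x =
      -(b.2 • X (exampleOperator p v, 0) x) := by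
    intro v
    rw [frame_split X b, mlieBracket_add_right (hd _ x) (hsm _ x), h.bracket_v,
      mlieBracket_const_smul_right (hd _ x), mlieBracket_swap_apply, h.bracket_u]
    simp
  have h2 : VectorField.mlieBracket 𝓘(ℝ, E) (X (0, 1)) (X b) x = X (exampleOperator p b.1, 0) x := by
    rw [frame_split X b, mlieBracket_add_right (hd _ x) (hsm _ x), h.bracket_u,
      mlieBracket_const_smul_right (hd _ x), mlieBracket_self]
    simp
  rw [frame_split X a, mlieBracket_add_left (hd _ x) (hsm _ x), h1,
    mlieBracket_const_smul_left (hd _ x), h2, bracket_apply]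
  have h3 : ((a.2 • exampleOperator p b.1 - b.2 • exampleOperator p a.1, 0) : (ℂ × ℝ) × ℝ) =
      a.2 • (exampleOperator p b.1, 0) - b.2 • (exampleOperator p a.1, 0) := by simp
  rw [h3, map_sub, map_smul, map_smul, neg_add_eq_sub]
  rfl

theorem isPetrovMetric_iff : IsPetrovMetric (exampleForm ε) δ X g ↔
    ∀ a b x, g.form x (X a x) (X b x) = totalForm ε δ a b := by
  refine ⟨fun h a b x ↦ ?_, fun h x ↦ ⟨?_, fun v ↦ ?_, fun v v' ↦ ?_⟩⟩
  · obtain ⟨huu, huv, hvv⟩ := h x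
    have h1 : ∀ a, X a x = X (a.1, 0) x + a.2 • X (0, 1) x := fun a ↦ congrFun (frame_split X a) x
    rw [h1 a, h1 b, totalForm_apply]
    simp only [map_add, map_smul, LinearMap.add_apply, LinearMap.smul_apply, huu, huv, hvv,
      g.symm x (X (a.1, 0) x) (X (0, 1) x), smul_eq_mul]
    ring
  · simp [h, totalForm_apply]
  · simp [h, totalForm_apply]
  · simp [h, totalForm_apply]

theorem IsFrame.finrank_eq (hX : IsFrame X) [Nonempty M] : finrank ℝ E = 4 := by
  obtain ⟨x⟩ := ‹Nonempty M›
  rw [← finrank_total]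
  exact (hX.equiv x).finrank_eq.symm

theorem hasSignPattern_of_frame (hX : IsFrame X) (hε : ε ≠ 0) (hδ : δ ≠ 0)
    (hg : ∀ a b x, g.form x (X a x) (X b x) = totalForm ε δ a b) :
    HasSignPattern g ![-1, 1, ε, δ] := fun x ↦
  exists_diagonal_basis (hX.equiv x) hε hδ fun a b ↦ hg a b x

theorem HasSignPattern.reindex {s : Fin 4 → ℝ} (h : HasSignPattern g s)
    (σ : Equiv.Perm (Fin 4)) : HasSignPattern g (s ∘ σ) := fun x ↦ by
  obtain ⟨b, hb⟩ := h x
  refine ⟨b.reindex σ.symm, fun i j ↦ ?_⟩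
  rw [Basis.reindex_apply, Basis.reindex_apply, hb]
  simp

theorem isNeutral_of_signPattern (hε : ε = 1 ∨ ε = -1) (h : HasSignPattern g ![-1, 1, ε, -ε]) :
    IsNeutral g := by
  rcases hε with rfl | rfl
  · rw [IsNeutral]
    convert h.reindex (Equiv.swap 1 3) using 1
    ext i
    fin_cases i <;> simp [Equiv.swap_apply_def]
  · rw [IsNeutral]
    convert h.reindex (Equiv.swap 1 2) using 1
    ext i
    fin_cases i <;> simp [Equiv.swap_apply_def]

theorem isRicciFlat_of_frame (hX : IsFrame X) {R : CurvatureField E M}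
    (hR : ∀ x a b d, R x (X a x) (X b x) (X d x) = X (curv ε δ p a b d) x) : IsRicciFlat R := by
  intro x u w
  obtain ⟨a, rfl⟩ := (hX.equiv x).surjective u
  obtain ⟨d, rfl⟩ := (hX.equiv x).surjective w
  have h : (R x (hX.equiv x a)).flip (hX.equiv x d) =
      (hX.equiv x).conj ((curv ε δ p a).flip d) := by
    ext v
    obtain ⟨b, rfl⟩ := (hX.equiv x).surjective v
    simp only [LinearEquiv.conj_apply, LinearMap.comp_apply, LinearEquiv.coe_coe,
      LinearEquiv.symm_apply_apply, LinearMap.flip_apply]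
    exact hR x a b d
  rw [ricci, h, LinearMap.trace_conj', curv_trace]

theorem not_isLocallySymmetric_of_frame [Nonempty M] (hX : IsFrame X) (hδ : δ ≠ 0) (hp : p ≠ 0)
    {cov : Connection E M} (hcov : ∀ a b x, cov (X b) x (X a x) = X (christoffel ε δ p a b) x)
    {R : CurvatureField E M}
    (hR : ∀ x a b d, R x (X a x) (X b x) (X d x) = X (curv ε δ p a b d) x) :
    ¬ IsLocallySymmetric cov R := by
  intro h
  obtain ⟨x⟩ := ‹Nonempty M›
  obtain ⟨z, a, b, d, hne⟩ := curv_not_parallel (ε := ε) hδ hp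
  have h1 := h x (X z) (X a) (X b) (X d) (hX.smooth z x) (hX.smooth a x) (hX.smooth b x)
    (hX.smooth d x)
  have h2 : (fun y ↦ R y (X a y) (X b y) (X d y)) = X (curv ε δ p a b d) :=
    funext fun y ↦ hR y a b d
  rw [covDerivCurvature, h2, hcov, hcov, hcov, hcov, hR, hR, hR] at h1
  apply hne
  apply (hX.equiv x).injective
  rw [map_sub, map_sub, map_sub, map_zero]
  exact h1

end Geometry

end Petrov

end

open Petrov in
theorem mainTheorem6 (ε δ p : ℝ) (hε : ε = 1 ∨ ε = -1) (hδ : δ = 1 ∨ δ = -1) (hp : p ≠ 0) :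
    -- the explicit model is a case of the construction
    IsSimplyTransitive (exampleOperator p) (modelFields (exampleOperator p)) ∧
    ∀ (E : Type u) [NormedAddCommGroup E] [NormedSpace ℝ E] [FiniteDimensional ℝ E]
      (M : Type v) [TopologicalSpace M] [ChartedSpace E M] [IsManifold 𝓘(ℝ, E) ∞ M]
      [T2Space M] [Nonempty M] (X : (ℂ × ℝ) × ℝ →ₗ[ℝ] Field E M),
      IsSimplyTransitive (exampleOperator p) X →
      -- the construction gives a metric on the four-manifold `M`
      Module.finrank ℝ E = 4 ∧
      (∃ g : Petrov.Metric E M, IsPetrovMetric (exampleForm ε) δ X g) ∧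
      ∀ g : Petrov.Metric E M, IsPetrovMetric (exampleForm ε) δ X g →
        -- sign patterns
        HasSignPattern g ![-1, 1, ε, δ] ∧
        (δ = 1 ∧ ε = 1 → IsLorentzian g) ∧
        (δ = -ε → IsNeutral g) ∧
        -- local homogeneity
        IsLocallyHomogeneous g ∧
        (∃ (G : Type) (_ : TopologicalSpace G) (_ : ChartedSpace ((ℂ × ℝ) × ℝ) G) (_ : Group G)
          (_ : LieGroup 𝓘(ℝ, (ℂ × ℝ) × ℝ) ∞ G) (_ : IsManifold 𝓘(ℝ, (ℂ × ℝ) × ℝ) ∞ G)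
          (_ : T2Space G) (_ : SecondCountableTopology G) (h : Petrov.Metric ((ℂ × ℝ) × ℝ) G),
          IsLeftInvariant h ∧ IsLocallyIsometricTo g h) ∧
        -- curvature
        (∃ cov : Connection E M, IsLeviCivita g cov) ∧
        ∀ cov : Connection E M, IsLeviCivita g cov →
          (∃ R : CurvatureField E M, IsCurvatureTensor cov R) ∧
          ∀ R : CurvatureField E M, IsCurvatureTensor cov R →
            IsRicciFlat R ∧
            ¬ IsLocallySymmetric cov R ∧
            ∀ x : M,
              (∃ A, IsCurvatureOperator (g.form x) (R x) A) ∧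
              ∀ A, IsCurvatureOperator (g.form x) (R x) A →
                IsComplexDiagonalizable A ∧
                ∀ o : Orientation ℝ (TangentSpace 𝓘(ℝ, E) x) (Fin 4),
                  (∃ S, IsHodgeStar (g.form x) o S) ∧
                  ∀ S, IsHodgeStar (g.form x) o S →
                    (δ = 1 ∧ ε = 1 →
                      IsStarDiagonalizableWith S A (cubeRootTriple (-δ * p ^ 2))) ∧
                    (δ = -ε →
                      IsSelfDualDiagonalizableWith S A (cubeRootTriple (-δ * p ^ 2))) := by
  have hε0 : ε ≠ 0 := by rcases hε with rfl | rfl <;> norm_num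
  have hδ0 : δ ≠ 0 := by rcases hδ with rfl | rfl <;> norm_num
  have hδδ : δ * δ = 1 := by rcases hδ with rfl | rfl <;> norm_num
  let F := LinearMap.toContinuousLinearMap (exampleOperator p)
  refine ⟨isSimplyTransitive_modelFields F, ?_⟩
  intro E _ _ _ M _ _ _ _ _ X hST
  have hX := hST.isFrame
  have hc := hST.mlieBracket
  have hs := totalForm_symm ε δ
  have hB := totalForm_nondegenerate hε0 hδ0
  have hl : -δ * p ^ 2 ≠ 0 := mul_ne_zero (neg_ne_zero.2 hδ0) (pow_ne_zero 2 hp)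
  refine ⟨hX.finrank_eq, ⟨hX.metric _ hs hB, isPetrovMetric_iff.2 fun a b x ↦
    hX.metric_apply _ hs hB x a b⟩, fun g hg ↦ ?_⟩
  rw [isPetrovMetric_iff] at hg
  have hsign := hasSignPattern_of_frame hX hε0 hδ0 hg
  refine ⟨hsign, ?_, ?_, isLocallyHomogeneous_of_frame F hX (bracket_apply p) hc hs hB hg,
    ⟨ExpGroup F, inferInstance, inferInstance, inferInstance, inferInstance, inferInstance,
      inferInstance, inferInstance, ExpGroup.leftMetric F hs hB,
      ExpGroup.isLeftInvariant_leftMetric F hs hB,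
      isLocallyIsometricTo_leftMetric F hX (bracket_apply p) hc hs hB hg⟩,
    ⟨_, hX.isLeviCivita_connection hc hg (christoffel_torsion ε δ p) (christoffel_skew hδδ p)⟩, ?_⟩
  · rintro ⟨rfl, rfl⟩
    exact hsign
  · rintro rfl
    exact isNeutral_of_signPattern hε hsign
  intro cov hcov
  have hΓ := hX.leviCivita_frame hc hg hs hB (christoffel_torsion ε δ p) (christoffel_skew hδδ p)
    hcov
  refine ⟨⟨_, hX.isCurvatureTensor_curvature hc hΓ⟩, fun R hR ↦ ?_⟩
  have hRX : ∀ x a b d, R x (X a x) (X b x) (X d x) = X (curv ε δ p a b d) x :=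
    hX.curvatureTensor_eq hc hΓ hR
  refine ⟨isRicciFlat_of_frame hX hRX, not_isLocallySymmetric_of_frame hX hδ0 hp hΓ hRX,
    fun x ↦ ?_⟩
  have hgx : ∀ a b, g.form x (hX.equiv x a) (hX.equiv x b) = totalForm ε δ a b :=
    fun a b ↦ hg a b x
  have hop := isCurvatureOperator_curvOp (hX.equiv x) hδδ hgx (hRX x)
  refine ⟨⟨_, hop⟩, fun A hA ↦ ?_⟩
  obtain rfl := hA.unique (g.symm x) (g.nondegenerate x) hop
  refine ⟨isComplexDiagonalizable_of_cube hl (curvOp_cube (hX.equiv x)), fun o ↦ ?_⟩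
  obtain ⟨e, he, ho, -⟩ := exists_orthonormal (hX.equiv x) hε hδ hgx o
  exact ⟨exists_isHodgeStar (g.symm x) (g.nondegenerate x) he ho, fun S hS ↦
    ⟨fun h ↦ isStarDiagonalizableWith_curvOp (hX.equiv x) hp h.2 h.1 hgx hS,
      fun h ↦ isSelfDualDiagonalizableWith_curvOp (hX.equiv x) hp hε hδ h hgx hS⟩⟩
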